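/- Let $\beta>0$, $\mathbf T=\mathbf R/2\pi\mathbf Z$, and let $L$ be the unbounded operator on the complex Hilbert space $L^2(\mathbf R\times\mathbf T)^3$ given, in the sense of distributions, by $$L(\eta,u_1,u_2)=\big(\partial_1u_1+\partial_2u_2,\ \beta x_1u_2+\partial_1\eta,\ -\beta x_1u_1+\partial_2\eta\big).$$ Let $(\psi_n)_{n\ge 0}$ be the Hermite functions normalized in $L^2(\mathbf R)$, $\psi_n(x_1)=\left(\frac{\beta}{\pi}\right)^{1/4}(2^n n!)^{-1/2}H_n(\sqrt\beta x_1)e^{-\beta x_1^2/2}$ with $H_n$ the physicists' Hermite polynomials, so that $-\psi_n''+\beta^2x_1^2\psi_n=\beta(2n+1)\psi_n$, and put $\psi_{-1}=0$. For $n\ge 1$ and $k\in\mathbf Z$ let $\tau(n,k,-1)<\tau(n,k,0)<\tau(n,k,1)$ be the three real roots of $$\tau^3-(k^2+\beta(2n+1))\tau-\beta k=0,$$ and for $n=0$ let $\tau(0,k,\pm1)=\frac k2\pm\frac12\sqrt{k^2+4\beta}$ and $\tau(0,k,0)=k$. For $(n,k,j)\in\mathbf N\times\mathbf Z\times\{-1,0,1\}$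 define $\Psi_{n,k,j}$ as follows. If $n=j=0$, $$\Psi_{0,k,0}=\frac{1}{\sqrt{4\pi}}e^{ikx_2}\,(\psi_0(x_1),\,0,\,\psi_0(x_1)).$$ If $n\ge1$ and $k=j=0$, $$\Psi_{n,0,0}=\frac{1}{\sqrt{2\pi(2n+1)}}\left(-\sqrt{\tfrac{n+1}2}\,\psi_{n-1}-\sqrt{\tfrac n2}\,\psi_{n+1},\ 0,\ \sqrt{\tfrac{n+1}2}\,\psi_{n-1}-\sqrt{\tfrac n2}\,\psi_{n+1}\right).$$ In all other cases, with $\tau=\tau(n,k,j)$, $$\Psi_{n,k,j}=C_{n,k,j}\,e^{ikx_2}\begin{pmatrix}\frac{-i}{\tau+k}\sqrt{\frac{\beta n}{2}}\,\psi_{n-1}(x_1)+\frac{i}{\tau-k}\sqrt{\frac{\beta(n+1)}{2}}\,\psi_{n+1}(x_1)\\ \psi_n(x_1)\\ \frac{i}{\tau+k}\sqrt{\frac{\beta n}{2}}\,\psi_{n-1}(x_1)+\frac{i}{\tau-k}\sqrt{\frac{\beta(n+1)}{2}}\,\psi_{n+1}(x_1)\end{pmatrix},$$ $$C_{n,k,j}=(2\pi)^{-1/2}\left(\frac{\beta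 n}{(\tau+k)^2}+\frac{\beta(n+1)}{(\tau-k)^2}+1\right)^{-1/2},$$ where the terms with the factor $n$ are absent when $n=0$. Then $(\Psi_{n,k,j})_{(n,k,j)\in\mathbf N\times\mathbf Z\times\{-1,0,1\}}$ is a Hilbert basis of $L^2(\mathbf R\times\mathbf T)^3$ consisting of eigenvectors of $L$: $$L\Psi_{n,k,j}=i\,\tau(n,k,j)\,\Psi_{n,k,j}\qquad\text{for all }(n,k,j).$$ Furthermore, for every real $s\ge0$ there is a constant $C_s>0$, depending only on $s$ and $\beta$, such that for all $(n,k,j)\in\mathbf N\times\mathbf Z\times\{-1,0,1\}$ $$\|\Psi_{n,k,j}\|_{L^\infty}\le C_0,\qquad \|\Psi_{n,k,j}\|_{W^{s,\infty}}\le C_s(1+k^2+n)^{s/2},$$ $$C_s^{-1}(1+k^2+n)^{s/2}\le\|\Psi_{n,k,j}\|_{H^s}\le C_s(1+k^2+n)^{s/2}.$$ Here $\|f\|_{H^s}^2=\sum_{k\in\mathbf Z}\int_{\mathbf R}(1+\xi^2+k^2)^s|\mathcal Ff(\xi,k)|^2\,d\xi$ with $\mathcal Ff(\xi,k)=\int e^{-ikx_2}e^{-i\xi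 x_1}f(x)\,dx$, and $W^{s,\infty}$ is the usual Sobolev space (for non-integer $s$: bounded weak derivatives up to order $\lfloor s\rfloor$, those of order $\lfloor s\rfloor$ being Hölder continuous of exponent $s-\lfloor s\rfloor$). Moreover, for every $\mu\in\mathbf C\setminus\{0\}$ (in particular for every nonzero eigenvalue of $L$) the eigenspace $\{\Phi\in L^2(\mathbf R\times\mathbf T)^3 : L\Phi=\mu\Phi\}$ is finite-dimensional. -/

import Mathlib

open MeasureTheory Filter Topology
open scoped ENNReal ContDiff

namespace EquatorialWaves

instance factTwoPiPos : Fact (0 < 2 * Real.pi) := ⟨Real.two_pi_pos⟩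

/-- The torus `ℝ / 2πℤ`; its volume has total mass `2π`. -/
abbrev Torus : Type := AddCircle (2 * Real.pi)

/-- The space domain `ℝ × 𝕋`, with the product of the Lebesgue measures. -/
abbrev Dom : Type := ℝ × Torus

/-- Values of the fields `(η, u₁, u₂)`: `ℂ³` with its Hermitian norm. -/
abbrev Val : Type := EuclideanSpace ℂ (Fin 3)

/-- The complex Hilbert space `L²(ℝ × 𝕋)³`. -/
abbrev L2 : Type := Lp Val 2 (volume : Measure Dom)

/-! ### Derivatives and test functions on `ℝ × 𝕋` -/

/-- Classical directional derivative of `f` on `ℝ × 𝕋` in the direction `v`. -/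
noncomputable def dirDeriv (v : ℝ × ℝ) (f : Dom → ℂ) (x : Dom) : ℂ :=
  deriv (fun t : ℝ => f (x.1 + t * v.1, x.2 + ((t * v.2 : ℝ) : Torus))) 0

/-- The partial derivative `∂₁`. -/
noncomputable def d1 (f : Dom → ℂ) : Dom → ℂ := dirDeriv (1, 0) f

/-- The partial derivative `∂₂`. -/
noncomputable def d2 (f : Dom → ℂ) : Dom → ℂ := dirDeriv (0, 1) f

/-- The pull-back to `ℝ²` of a function on `ℝ × 𝕋`. -/
noncomputable def pullBack (f : Dom → ℂ) (y : ℝ × ℝ) : ℂ := f (y.1, (y.2 : Torus))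

/-- Test functions: smooth functions with compact support on `ℝ × 𝕋`. -/
def IsTest (φ : Dom → ℂ) : Prop :=
  ContDiff ℝ ∞ (pullBack φ) ∧ HasCompactSupport φ

theorem dirDeriv_mk (v : ℝ × ℝ) (f : Dom → ℂ) (y : ℝ × ℝ)
    (hf : DifferentiableAt ℝ (pullBack f) y) :
    dirDeriv v f (y.1, (y.2 : Torus)) = fderiv ℝ (pullBack f) y v := by
  have h1 : HasDerivAt (fun t : ℝ => y + t • v) v 0 := by
    simpa using ((hasDerivAt_id (0 : ℝ)).smul_const v).const_add y
  have h2 : HasFDerivAt (pullBack f) (fderiv ℝ (pullBack f) y) (y + (0 : ℝ) • v) := by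
    simpa using hf.hasFDerivAt
  have h3 := h2.comp_hasDerivAt (0 : ℝ) h1
  rw [← h3.deriv]
  unfold dirDeriv
  congr 1

theorem IsTest.continuous {φ : Dom → ℂ} (h : IsTest φ) : Continuous φ := by
  have hq : IsOpenQuotientMap (Prod.map (id : ℝ → ℝ) (fun t : ℝ => (t : Torus))) :=
    IsOpenQuotientMap.id.prodMap QuotientAddGroup.isOpenQuotientMap_mk
  rw [← hq.continuous_comp_iff]
  exact h.1.continuous

theorem IsTest.dirDeriv {φ : Dom → ℂ} (h : IsTest φ) (v : ℝ × ℝ) :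
    IsTest (dirDeriv v φ) := by
  refine ⟨?_, ?_⟩
  · have he : pullBack (EquatorialWaves.dirDeriv v φ) =
        fun y => fderiv ℝ (pullBack φ) y v := by
      funext y
      exact dirDeriv_mk v φ y (h.1.differentiable (by simp) y)
    rw [he]
    exact (h.1.fderiv_right (m := ∞) (by simp)).clm_apply contDiff_const
  · refine HasCompactSupport.intro h.2 (fun x hx => ?_)
    have h0 : φ =ᶠ[𝓝 x] 0 := notMem_tsupport_iff_eventuallyEq.mp hx
    have hc : Tendsto (fun t : ℝ => ((x.1 + t * v.1, x.2 + ((t * v.2 : ℝ) : Torus)) : Dom))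
        (𝓝 0) (𝓝 x) := by
      have : Continuous
          (fun t : ℝ => ((x.1 + t * v.1, x.2 + ((t * v.2 : ℝ) : Torus)) : Dom)) := by
        refine Continuous.prodMk (by fun_prop) (continuous_const.add ?_)
        exact (AddCircle.continuous_mk' (2 * Real.pi)).comp (by fun_prop)
      simpa using this.tendsto 0
    have h1 : (fun t : ℝ => φ (x.1 + t * v.1, x.2 + ((t * v.2 : ℝ) : Torus)))
        =ᶠ[𝓝 0] fun _ => (0 : ℂ) := hc.eventually h0
    unfold EquatorialWaves.dirDeriv
    rw [h1.deriv_eq]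
    simp

/-! ### The operator `L (η, u) = (∇ · u, β x₁ u^⊥ + ∇ η)`, where `u^⊥ = (u₂, -u₁)` -/

/-- `L Φ = G` in the sense of distributions, for fields `Φ = (η, u₁, u₂)` and `G` in `L²`. -/
def LEq (β : ℝ) (Φ G : L2) : Prop :=
  ∀ φ : Dom → ℂ, IsTest φ →
    (∫ x, (-(Φ x 1 * d1 φ x) - Φ x 2 * d2 φ x) = ∫ x, G x 0 * φ x) ∧
    (∫ x, (Φ x 2 * (((β * x.1 : ℝ) : ℂ) * φ x) - Φ x 0 * d1 φ x) = ∫ x, G x 1 * φ x) ∧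
    (∫ x, (-(Φ x 1 * (((β * x.1 : ℝ) : ℂ) * φ x)) - Φ x 0 * d2 φ x) = ∫ x, G x 2 * φ x)

theorem integrable_mul_test (Φ : L2) (i : Fin 3) {w : Dom → ℂ} (hw : Continuous w)
    (hc : HasCompactSupport w) : Integrable (fun x => Φ x i * w x) := by
  have h1 : MemLp (fun x => Φ x i) 2 (volume : Measure Dom) :=
    (EuclideanSpace.proj (𝕜 := ℂ) i : Val →L[ℂ] ℂ).comp_memLp' (Lp.memLp Φ)
  have h2 : MemLp w 2 (volume : Measure Dom) := hw.memLp_of_hasCompactSupport hc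
  exact h1.integrable_mul h2

theorem IsTest.integrable_aux (Φ : L2) (i : Fin 3) (β : ℝ) {φ : Dom → ℂ} (h : IsTest φ) :
    Integrable (fun x => Φ x i * φ x) ∧ Integrable (fun x => Φ x i * d1 φ x) ∧
      Integrable (fun x => Φ x i * d2 φ x) ∧
      Integrable (fun x => Φ x i * (((β * x.1 : ℝ) : ℂ) * φ x)) := by
  refine ⟨integrable_mul_test Φ i h.continuous h.2,
    integrable_mul_test Φ i (h.dirDeriv _).continuous (h.dirDeriv _).2,
    integrable_mul_test Φ i (h.dirDeriv _).continuous (h.dirDeriv _).2,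
    integrable_mul_test Φ i ?_ h.2.mul_left⟩
  exact (Complex.continuous_ofReal.comp (by fun_prop)).mul h.continuous

theorem LEq.zero (β : ℝ) : LEq β 0 0 := by
  intro φ _
  have h (i : Fin 3) : ∀ᵐ x : Dom, (0 : L2) x i = 0 := by
    filter_upwards [Lp.coeFn_zero Val 2 (volume : Measure Dom)] with x hx
    rw [hx]; rfl
  refine ⟨integral_congr_ae ?_, integral_congr_ae ?_, integral_congr_ae ?_⟩ <;>
    filter_upwards [h 0, h 1, h 2] with x h0 h1 h2 <;> simp_all

theorem LEq.add {β : ℝ} {Φ G Φ' G' : L2} (h : LEq β Φ G) (h' : LEq β Φ' G') :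
    LEq β (Φ + Φ') (G + G') := by
  intro φ hφ
  have e (A B : L2) (i : Fin 3) : ∀ᵐ x : Dom, (A + B) x i = A x i + B x i := by
    filter_upwards [Lp.coeFn_add A B] with x hx
    rw [hx]; rfl
  have I (A : L2) (i : Fin 3) := hφ.integrable_aux A i β
  obtain ⟨a0, a1, a2⟩ := h φ hφ
  obtain ⟨b0, b1, b2⟩ := h' φ hφ
  refine ⟨?_, ?_, ?_⟩
  · rw [integral_congr_ae (f := fun x => (G + G') x 0 * φ x)
      (g := fun x => (G x 0 * φ x) + (G' x 0 * φ x)),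
      integral_add (I G 0).1 (I G' 0).1, ← a0, ← b0, ← integral_add]
    · refine integral_congr_ae ?_
      filter_upwards [e Φ Φ' 1, e Φ Φ' 2] with x h1 h2
      rw [h1, h2]; ring
    · exact ((I Φ 1).2.1.neg).sub (I Φ 2).2.2.1
    · exact ((I Φ' 1).2.1.neg).sub (I Φ' 2).2.2.1
    · filter_upwards [e G G' 0] with x h1
      rw [h1]; ring
  · rw [integral_congr_ae (f := fun x => (G + G') x 1 * φ x)
      (g := fun x => (G x 1 * φ x) + (G' x 1 * φ x)),
      integral_add (I G 1).1 (I G' 1).1, ← a1, ← b1, ← integral_add]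
    · refine integral_congr_ae ?_
      filter_upwards [e Φ Φ' 0, e Φ Φ' 2] with x h1 h2
      rw [h1, h2]; ring
    · exact ((I Φ 2).2.2.2).sub (I Φ 0).2.1
    · exact ((I Φ' 2).2.2.2).sub (I Φ' 0).2.1
    · filter_upwards [e G G' 1] with x h1
      rw [h1]; ring
  · rw [integral_congr_ae (f := fun x => (G + G') x 2 * φ x)
      (g := fun x => (G x 2 * φ x) + (G' x 2 * φ x)),
      integral_add (I G 2).1 (I G' 2).1, ← a2, ← b2, ← integral_add]
    · refine integral_congr_ae ?_
      filter_upwards [e Φ Φ' 0, e Φ Φ' 1] with x h1 h2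
      rw [h1, h2]; ring
    · exact ((I Φ 1).2.2.2.neg).sub (I Φ 0).2.2.1
    · exact ((I Φ' 1).2.2.2.neg).sub (I Φ' 0).2.2.1
    · filter_upwards [e G G' 2] with x h1
      rw [h1]; ring

theorem LEq.smul {β : ℝ} (c : ℂ) {Φ G : L2} (h : LEq β Φ G) : LEq β (c • Φ) (c • G) := by
  intro φ hφ
  have e (A : L2) (i : Fin 3) : ∀ᵐ x : Dom, (c • A) x i = c * A x i := by
    filter_upwards [Lp.coeFn_smul c A] with x hx
    rw [hx]; rfl
  obtain ⟨a0, a1, a2⟩ := h φ hφ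
  refine ⟨?_, ?_, ?_⟩
  · rw [integral_congr_ae (f := fun x => (c • G) x 0 * φ x)
      (g := fun x => c * (G x 0 * φ x)), integral_const_mul, ← a0,
      ← integral_const_mul]
    · refine integral_congr_ae ?_
      filter_upwards [e Φ 1, e Φ 2] with x h1 h2
      rw [h1, h2]; ring
    · filter_upwards [e G 0] with x h1
      rw [h1]; ring
  · rw [integral_congr_ae (f := fun x => (c • G) x 1 * φ x)
      (g := fun x => c * (G x 1 * φ x)), integral_const_mul, ← a1,
      ← integral_const_mul]
    · refine integral_congr_ae ?_
      filter_upwards [e Φ 0, e Φ 2] with x h1 h2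
      rw [h1, h2]; ring
    · filter_upwards [e G 1] with x h1
      rw [h1]; ring
  · rw [integral_congr_ae (f := fun x => (c • G) x 2 * φ x)
      (g := fun x => c * (G x 2 * φ x)), integral_const_mul, ← a2,
      ← integral_const_mul]
    · refine integral_congr_ae ?_
      filter_upwards [e Φ 0, e Φ 1] with x h1 h2
      rw [h1, h2]; ring
    · filter_upwards [e G 2] with x h1
      rw [h1]; ring

/-- The eigenspace `{Φ ∈ L² | L Φ = μ Φ}` of the unbounded operator `L`. -/
def eigenspace (β : ℝ) (μ : ℂ) : Submodule ℂ L2 where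
  carrier := {Φ | LEq β Φ (μ • Φ)}
  zero_mem' := by simpa using LEq.zero β
  add_mem' := by
    intro Φ Φ' h h'
    simpa [smul_add] using LEq.add h h'
  smul_mem' := by
    intro c Φ h
    simpa [smul_comm μ c Φ] using LEq.smul c h

/-! ### Sobolev norms of fields on `ℝ × 𝕋` -/

/-- `g` is the weak derivative `∂₁^a ∂₂^b f`, where `α = (a, b)`. -/
def IsWeakDeriv (α : ℕ × ℕ) (f g : Dom → Val) : Prop :=
  LocallyIntegrable f ∧ LocallyIntegrable g ∧
    ∀ φ : Dom → ℂ, IsTest φ →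
      ∫ x, (d1^[α.1] (d2^[α.2] φ)) x • f x = (-1 : ℂ) ^ (α.1 + α.2) • ∫ x, φ x • g x

/-- The Hölder seminorm of exponent `σ`. -/
noncomputable def holderSeminorm (σ : ℝ) (g : Dom → Val) : ℝ≥0∞ :=
  ⨆ (x : Dom) (y : Dom), edist (g x) (g y) / edist x y ^ σ

/-- The norm of `W^{s,∞}(ℝ × 𝕋)` for real `s ≥ 0`: with `m` the integer part of `s`, the
`L^∞` norms of the weak derivatives of order at most `m` and, if `s` is not an integer, the Hölder
seminorms of exponent `s - m` of those of order `m`. It is `⊤` outside the space. The infimum only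
serves to choose the representatives of the weak derivatives, which are unique up to null sets. -/
noncomputable def WNorm (s : ℝ) (f : Dom → Val) : ℝ≥0∞ :=
  ⨅ (g : ℕ × ℕ → Dom → Val) (_ : ∀ α : ℕ × ℕ, α.1 + α.2 ≤ ⌊s⌋₊ → IsWeakDeriv α f (g α)),
    (⨆ (α : ℕ × ℕ) (_ : α.1 + α.2 ≤ ⌊s⌋₊), eLpNorm (g α) ∞ volume) +
      (if s = (⌊s⌋₊ : ℝ) then 0
        else ⨆ (α : ℕ × ℕ) (_ : α.1 + α.2 = ⌊s⌋₊), holderSeminorm (s - ⌊s⌋₊) (g α))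

/-- The Fourier transform `∫ e^{-ikx₂} e^{-iξx₁} f(x₁, x₂) dx₁ dx₂` of an integrable field. -/
noncomputable def fourierTransform (f : Dom → Val) (ξ : ℝ) (k : ℤ) : Val :=
  ∫ x : Dom, (fourier (-k) x.2 * Complex.exp (-(Complex.I * ξ * x.1))) • f x

/-- The norm of `H^s(ℝ × 𝕋)`, for integrable fields. -/
noncomputable def HNorm (s : ℝ) (f : Dom → Val) : ℝ≥0∞ :=
  (∑' k : ℤ, ∫⁻ ξ : ℝ, ENNReal.ofReal ((1 + ξ ^ 2 + (k : ℝ) ^ 2) ^ s) *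
    ‖fourierTransform f ξ k‖ₑ ^ 2) ^ (1 / 2 : ℝ)

/-! ### Hermite functions, eigenvalues and eigenvectors -/

/-- The Hermite functions `ψ_n`, normalized in `L²(ℝ)`, with the convention `ψ_n = 0` for `n < 0`.
`Polynomial.hermite n` is the probabilists' polynomial `He_n`. -/
noncomputable def psi (β : ℝ) : ℤ → ℝ → ℝ
  | .ofNat n, x => (β / Real.pi) ^ (1 / 4 : ℝ) / √(n.factorial : ℝ) *
      Polynomial.aeval (√(2 * β) * x) (Polynomial.hermite n) * Real.exp (-(β * x ^ 2 / 2))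
  | .negSucc _, _ => 0

open Polynomial in
/-- The polynomial `X³ - (k² + β (2n+1)) X - β k`. -/
noncomputable def dispersionPoly (β : ℝ) (n : ℕ) (k : ℤ) : Polynomial ℝ :=
  X ^ 3 - C ((k : ℝ) ^ 2 + β * (2 * n + 1)) * X - C (β * k)

/-- The frequencies `τ(n, k, j)`. For `n ≠ 0` these are the three real roots of the dispersion
polynomial in increasing order (entries `0, 1, 2` of the sorted list of roots for
`j = -1, 0, 1`). -/
noncomputable def tau (β : ℝ) (n : ℕ) (k : ℤ) (j : SignType) : ℝ :=
  if n = 0 then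
    match j with
    | -1 => (k : ℝ) / 2 - √((k : ℝ) ^ 2 + 4 * β) / 2
    | 0 => (k : ℝ)
    | 1 => (k : ℝ) / 2 + √((k : ℝ) ^ 2 + 4 * β) / 2
  else
    let l := (dispersionPoly β n k).roots.sort
    match j with
    | -1 => l.getD 0 0
    | 0 => l.getD 1 0
    | 1 => l.getD 2 0

/-- The normalizing constant `C_{n,k,j}`. For `n = 0` the first term is absent, also when its
denominator vanishes. -/
noncomputable def normConst (β : ℝ) (n : ℕ) (k : ℤ) (j : SignType) : ℝ :=
  1 / √(2 * Real.pi *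
    (β * n / (tau β n k j + k) ^ 2 + β * (n + 1) / (tau β n k j - k) ^ 2 + 1))

/-- The vectors `Ψ_{n,k,j}`: Kelvin modes (`n = j = 0`), non-oscillating modes
(`n ≠ 0`, `k = j = 0`), and Poincaré, Rossby and mixed modes. -/
noncomputable def Psi (β : ℝ) (n : ℕ) (k : ℤ) (j : SignType) (x : Dom) : Val :=
  if j = 0 ∧ n = 0 then
    ((1 / √(4 * Real.pi) : ℝ) * fourier k x.2 : ℂ) • !₂[(psi β 0 x.1 : ℂ), 0, (psi β 0 x.1 : ℂ)]
  else if j = 0 ∧ k = 0 then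
    ((1 / √(2 * Real.pi * (2 * n + 1)) : ℝ) : ℂ) •
      !₂[((-√(((n : ℝ) + 1) / 2) * psi β (n - 1) x.1 - √((n : ℝ) / 2) * psi β (n + 1) x.1 : ℝ) : ℂ),
        0,
        ((√(((n : ℝ) + 1) / 2) * psi β (n - 1) x.1 - √((n : ℝ) / 2) * psi β (n + 1) x.1 : ℝ) : ℂ)]
  else
    (normConst β n k j * fourier k x.2 : ℂ) •
      !₂[-Complex.I / ((tau β n k j + k : ℝ) : ℂ) * (√(β * n / 2) * psi β (n - 1) x.1 : ℝ) +
          Complex.I / ((tau β n k j - k : ℝ) : ℂ) * (√(β * (n + 1) / 2) * psi β (n + 1) x.1 : ℝ),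
        (psi β n x.1 : ℂ),
        Complex.I / ((tau β n k j + k : ℝ) : ℂ) * (√(β * n / 2) * psi β (n - 1) x.1 : ℝ) +
          Complex.I / ((tau β n k j - k : ℝ) : ℂ) * (√(β * (n + 1) / 2) * psi β (n + 1) x.1 : ℝ)]

end EquatorialWaves

/-! Fourier series in x₂ and Hermite functions in x₁ split L into blocks of dimension at most three.
Apart from signs, the combinations βx₁ ± ∂₁ acting on η ± u₂ and u₁ are twice the annihilation and
creation operators of the Hermite basis. Hence, for fixed k and m, the space spanned by e^{ikx₂}
times ψ_{m-1}(1,0,-1), ψ_m(0,1,0) and ψ_{m+1}(1,0,1) is invariant. For m = 0 the first vector is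
absent, and for m = -1 only the Kelvin vector ψ_0(1,0,1) remains.

In each block L is a skew-Hermitian matrix with eigenvalues iτ, where τ runs over the roots of the
dispersion cubic. For m = 0 that cubic is (τ + k)(τ² - kτ - β) and only the quadratic factor counts.
The roots used in a block are distinct, so their eigenvectors form an orthogonal basis of it. All
modes are written with the three coefficients `coefA`, `coefB`, `coefC`, and the algebra is in
`coef_eigen`, `coef_orthogonal` and `coef_norm`. Completeness of the modes then follows from
totality of the products ψ_n(x₁) e^{ikx₂}. If f is orthogonal to every ψ_n, all moments of ψ_0 f
vanish. So does its Fourier transform, by power series expansion, and ψ_0 has no zeros.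

The L^∞ bound amounts to a bound on ψ_n uniform in n (`exists_psi_bound`). It comes from the
generating function of the Hermite polynomials integrated over the circle of radius √n, together
with Stirling's formula. Every x₁-derivative costs a factor √(1 + |m|) and every x₂-derivative a
factor |k|, which gives the integer orders of W^{s,∞}. Hölder seminorms follow by interpolating
between a sup bound and a Lipschitz bound.

Hermite functions are eigenfunctions of the Fourier transform up to scaling. The squared H^s norm of
a mode is therefore exactly a combination, with nonnegative coefficients, of the integrals of (1 +
k² + β²x²)^s ψ_l² (`HNorm_Psi`). These are comparable to (1 + k² + l)^s by `exists_wt_rpow_bounds`: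
integer moments bound them above, and the first two powers of the weight bound them below.

If LΦ = μΦ, skew-symmetry of L tested against the modes gives (iτ - μ)⟨Ψ, Φ⟩ = 0. So Φ is a
combination of the modes with iτ = μ, and a nonzero frequency is taken only finitely often
(`finite_tau_eq`). -/

namespace EquatorialWaves

/-! ### Functions with Gaussian decay -/

/-- Continuous functions on `ℝ` bounded by a multiple of a Gaussian. -/
def GaussDecay {F : Type*} [NormedAddCommGroup F] (f : ℝ → F) : Prop :=
  Continuous f ∧ ∃ c > 0, ∃ C, ∀ x, ‖f x‖ ≤ C * Real.exp (-(c * x ^ 2))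

section GaussDecay

variable {F : Type*} [NormedAddCommGroup F] {f g : ℝ → F}

theorem GaussDecay.nonneg_const (hf : GaussDecay f) :
    ∃ c > 0, ∃ C, 0 ≤ C ∧ ∀ x, ‖f x‖ ≤ C * Real.exp (-(c * x ^ 2)) := by
  obtain ⟨-, c, hc, C, h⟩ := hf
  refine ⟨c, hc, C, ?_, h⟩
  have := (norm_nonneg _).trans (h 0)
  simpa using this

/-- Domination is the mechanism behind most of the closure properties below. The target space may
change, which allows passing to norms, components and complexifications. -/
theorem GaussDecay.of_norm_le {G : Type*} [NormedAddCommGroup G] {g : ℝ → G} (hf : GaussDecay f)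
    (hg : Continuous g) (D : ℝ) (h : ∀ x, ‖g x‖ ≤ D * ‖f x‖) : GaussDecay g := by
  obtain ⟨c, hc, C, hC, hb⟩ := hf.nonneg_const
  refine ⟨hg, c, hc, |D| * C, fun x => (h x).trans ?_⟩
  calc D * ‖f x‖ ≤ |D| * ‖f x‖ := by gcongr; exact le_abs_self D
    _ ≤ |D| * (C * Real.exp (-(c * x ^ 2))) := by gcongr; exact hb x
    _ = _ := by ring

theorem GaussDecay.congr (hf : GaussDecay f) (h : ∀ x, g x = f x) : GaussDecay g := by
  rwa [show g = f from funext h]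

theorem GaussDecay.add (hf : GaussDecay f) (hg : GaussDecay g) : GaussDecay (fun x => f x + g x) := by
  obtain ⟨c, hc, C, hC, hb⟩ := hf.nonneg_const
  obtain ⟨d, hd, D, hD, hb'⟩ := hg.nonneg_const
  refine ⟨hf.1.add hg.1, min c d, lt_min hc hd, C + D, fun x => (norm_add_le _ _).trans ?_⟩
  have h1 : Real.exp (-(c * x ^ 2)) ≤ Real.exp (-(min c d * x ^ 2)) := by
    gcongr; exact min_le_left _ _
  have h2 : Real.exp (-(d * x ^ 2)) ≤ Real.exp (-(min c d * x ^ 2)) := by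
    gcongr; exact min_le_right _ _
  calc ‖f x‖ + ‖g x‖ ≤ C * Real.exp (-(c * x ^ 2)) + D * Real.exp (-(d * x ^ 2)) :=
        add_le_add (hb x) (hb' x)
    _ ≤ C * Real.exp (-(min c d * x ^ 2)) + D * Real.exp (-(min c d * x ^ 2)) := by gcongr
    _ = _ := by ring

theorem GaussDecay.const_smul {𝕜 : Type*} [NormedField 𝕜] [NormedSpace 𝕜 F] (hf : GaussDecay f)
    (a : 𝕜) : GaussDecay (fun x => a • f x) :=
  hf.of_norm_le (hf.1.const_smul a) ‖a‖ fun x => (norm_smul a (f x)).le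

theorem GaussDecay.const_mul {𝕜 : Type*} [NormedField 𝕜] {f : ℝ → 𝕜} (hf : GaussDecay f)
    (a : 𝕜) : GaussDecay (fun x => a * f x) :=
  hf.const_smul a

theorem GaussDecay.sub (hf : GaussDecay f) (hg : GaussDecay g) : GaussDecay (fun x => f x - g x) := by
  simpa [sub_eq_add_neg] using
    hf.add (hg.of_norm_le (g := fun x => -g x) hg.1.neg 1 (fun x => by simp))

theorem GaussDecay.bounded (hf : GaussDecay f) : ∃ C, ∀ x, ‖f x‖ ≤ C := by
  obtain ⟨c, hc, C, hC, hb⟩ := hf.nonneg_const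
  refine ⟨C, fun x => (hb x).trans ?_⟩
  have : Real.exp (-(c * x ^ 2)) ≤ 1 := Real.exp_le_one_iff.mpr (by nlinarith [sq_nonneg x])
  nlinarith

theorem GaussDecay.mul {𝕜 : Type*} [NormedField 𝕜] {f g : ℝ → 𝕜} (hf : GaussDecay f)
    (hg : GaussDecay g) : GaussDecay (fun x => f x * g x) := by
  obtain ⟨C, hC⟩ := hg.bounded
  refine hf.of_norm_le (hf.1.mul hg.1) C fun x => ?_
  rw [norm_mul, mul_comm]
  gcongr
  exact hC x

theorem GaussDecay.ofReal {f : ℝ → ℝ} (hf : GaussDecay f) : GaussDecay (fun x => (f x : ℂ)) :=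
  hf.of_norm_le (Complex.continuous_ofReal.comp hf.1) 1 fun x => by simp

/-- Exponential growth is absorbed by Gaussian decay. -/
theorem GaussDecay.exp_smul [NormedSpace ℝ F] (hf : GaussDecay f) (a : ℝ) :
    GaussDecay (fun x => Real.exp (a * |x|) • f x) := by
  obtain ⟨c, hc, C, hC, hb⟩ := hf.nonneg_const
  -- Half of the Gaussian rate is given up: a|x| ≤ a²/(2c) + c x²/2 by completing the square.
  refine ⟨Continuous.smul (by fun_prop) hf.1, c / 2, by positivity,
    Real.exp (a ^ 2 / (2 * c)) * C, fun x => ?_⟩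
  rw [norm_smul, Real.norm_of_nonneg (Real.exp_pos _).le]
  calc Real.exp (a * |x|) * ‖f x‖ ≤ Real.exp (a * |x|) * (C * Real.exp (-(c * x ^ 2))) := by
        gcongr; exact hb x
    _ = C * Real.exp (a * |x| + -(c * x ^ 2)) := by rw [Real.exp_add]; ring
    _ ≤ C * Real.exp (a ^ 2 / (2 * c) + -(c / 2 * x ^ 2)) := by
        refine mul_le_mul_of_nonneg_left (Real.exp_le_exp.mpr ?_) hC
        have h1 : a ^ 2 / (2 * c) + -(c / 2 * x ^ 2) - (a * |x| + -(c * x ^ 2)) =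
            (c * |x| - a) ^ 2 / (2 * c) := by
          field_simp
          rw [← sq_abs x]; ring
        have h2 : 0 ≤ (c * |x| - a) ^ 2 / (2 * c) := by positivity
        linarith
    _ = _ := by rw [Real.exp_add]; ring

/-- Powers are dominated by exponentials, |x|^j ≤ j! e^{|x|}, and these are already absorbed. -/
theorem GaussDecay.pow_smul [NormedSpace ℝ F] (hf : GaussDecay f) (j : ℕ) :
    GaussDecay (fun x => x ^ j • f x) := by
  refine (hf.exp_smul 1).of_norm_le (Continuous.smul (by fun_prop) hf.1) (j.factorial : ℝ)
    fun x => ?_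
  rw [norm_smul, norm_smul, norm_pow, Real.norm_eq_abs, Real.norm_of_nonneg (Real.exp_pos _).le,
    ← mul_assoc, one_mul]
  gcongr
  have := Real.pow_div_factorial_le_exp |x| (abs_nonneg x) j
  rwa [div_le_iff₀ (by positivity), mul_comm] at this

theorem GaussDecay.pow_mul {f : ℝ → ℝ} (hf : GaussDecay f) (j : ℕ) :
    GaussDecay (fun x => x ^ j * f x) :=
  hf.pow_smul j

theorem GaussDecay.integrable (hf : GaussDecay f) : Integrable f := by
  obtain ⟨c, hc, C, hC, hb⟩ := hf.nonneg_const
  refine ((integrable_exp_neg_mul_sq hc).const_mul C).mono' hf.1.aestronglyMeasurable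
    (Eventually.of_forall fun x => ?_)
  simpa [neg_mul] using hb x

theorem GaussDecay.memLp_two (hf : GaussDecay f) : MemLp f 2 := by
  rw [memLp_two_iff_integrable_sq_norm hf.1.aestronglyMeasurable]
  have h : GaussDecay (fun x => ‖f x‖) := hf.of_norm_le hf.1.norm 1 fun x => by simp
  simpa [pow_two] using (h.mul h).integrable

end GaussDecay

/-! ### Hermite polynomials and functions -/

section Hermite

open Polynomial

/-- The Appell property turns the defining recursion He_{n+1} = X He_n - He_n' into a three-term
recurrence free of derivatives. -/
theorem derivative_hermite_succ (n : ℕ) :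
    derivative (hermite (n + 1)) = ((n : ℤ[X]) + 1) * hermite n := by
  induction n with
  | zero => simp
  | succ n ih =>
    rw [hermite_succ (n + 1)]
    simp only [derivative_sub, derivative_mul, derivative_X, ih, derivative_add, derivative_natCast,
      derivative_one]
    rw [hermite_succ n]
    push_cast
    ring

/-- The three-term recurrence. -/
theorem hermite_add_two (n : ℕ) :
    hermite (n + 2) = X * hermite (n + 1) - ((n : ℤ[X]) + 1) * hermite n := by
  rw [hermite_succ, derivative_hermite_succ]

theorem aeval_hermite_add_two (n : ℕ) (y : ℝ) :
    aeval y (hermite (n + 2)) = y * aeval y (hermite (n + 1)) - (n + 1) * aeval y (hermite n) := by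
  rw [hermite_add_two]
  simp

end Hermite

/-! ### Ladder relations, Gaussian decay and orthonormality of the Hermite functions. -/

section Psi

variable {β : ℝ}

theorem psi_natCast (β : ℝ) (n : ℕ) (x : ℝ) :
    psi β (n : ℤ) x = (β / Real.pi) ^ (1 / 4 : ℝ) / √(n.factorial : ℝ) *
      Polynomial.aeval (√(2 * β) * x) (Polynomial.hermite n) * Real.exp (-(β * x ^ 2 / 2)) := rfl

theorem psi_of_neg (β : ℝ) {m : ℤ} (hm : m < 0) : psi β m = fun _ => 0 := by
  obtain ⟨k, rfl⟩ := Int.eq_negSucc_of_lt_zero hm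
  rfl

/-- The coefficient of `ψ_{m-1}` in `ψ_m'` and in `β x ψ_m`. -/
noncomputable def lad (β : ℝ) (m : ℤ) : ℝ := √(β * m / 2)

theorem lad_of_nonpos (hβ : 0 < β) {m : ℤ} (hm : m ≤ 0) : lad β m = 0 := by
  apply Real.sqrt_eq_zero_of_nonpos
  have : (m : ℝ) ≤ 0 := by exact_mod_cast hm
  nlinarith

theorem lad_sq (hβ : 0 < β) {m : ℤ} (hm : 0 ≤ m) : lad β m ^ 2 = β * m / 2 := by
  apply Real.sq_sqrt
  have : (0 : ℝ) ≤ m := by exact_mod_cast hm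
  positivity

theorem lad_pos (hβ : 0 < β) {m : ℤ} (hm : 0 < m) : 0 < lad β m := by
  apply Real.sqrt_pos.mpr
  have : (0 : ℝ) < m := by exact_mod_cast hm
  positivity

theorem lad_nonneg (β : ℝ) (m : ℤ) : 0 ≤ lad β m := Real.sqrt_nonneg _

/-- The square root in `lad` combines with the factorial normalization. Here and in
`lad_mul_psi_succ` this leaves a rational multiple of a common prefactor, so the ladder relations
reduce to identities between Hermite polynomials. -/
theorem lad_mul_psi_pred (hβ : 0 < β) (n : ℕ) (x : ℝ) :
    lad β (n + 1 : ℕ) * psi β (n : ℕ) x = √(2 * β) / 2 * ((n + 1) *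
      ((β / Real.pi) ^ (1 / 4 : ℝ) / √((n + 1).factorial : ℝ) *
        Polynomial.aeval (√(2 * β) * x) (Polynomial.hermite n) * Real.exp (-(β * x ^ 2 / 2)))) := by
  rw [psi_natCast, lad]
  have e1 : √(β * ((n + 1 : ℕ) : ℤ) / 2) = √(2 * β) / 2 * √(n + 1) := by
    rw [show β * (((n + 1 : ℕ) : ℤ) : ℝ) / 2 = 2 * β * (n + 1) / 2 ^ 2 by push_cast; ring,
      Real.sqrt_div' _ (by positivity), Real.sqrt_sq (by norm_num), Real.sqrt_mul (by positivity)]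
    ring
  have e2 : √((n + 1).factorial : ℝ) = √(n + 1) * √(n.factorial : ℝ) := by
    rw [Nat.factorial_succ]; push_cast; rw [Real.sqrt_mul (by positivity)]
  have h1 : 0 < √((n : ℝ) + 1) := by positivity
  have h2 : 0 < √(n.factorial : ℝ) := by positivity
  rw [e1, e2]
  have h3 : ((n : ℝ) + 1) = √(n + 1) * √(n + 1) := (Real.mul_self_sqrt (by positivity)).symm
  rw [show √(2 * β) / 2 * ((n + 1) * ((β / Real.pi) ^ (1 / 4 : ℝ) / (√(n + 1) * √(n.factorial : ℝ)) *
      Polynomial.aeval (√(2 * β) * x) (Polynomial.hermite n) * Real.exp (-(β * x ^ 2 / 2)))) =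
      √(2 * β) / 2 * ((√(n + 1) * √(n + 1)) * ((β / Real.pi) ^ (1 / 4 : ℝ) /
        (√(n + 1) * √(n.factorial : ℝ)) *
      Polynomial.aeval (√(2 * β) * x) (Polynomial.hermite n) * Real.exp (-(β * x ^ 2 / 2)))) by
    rw [← h3]]
  field_simp

theorem lad_mul_psi_succ (hβ : 0 < β) (n : ℕ) (x : ℝ) :
    lad β (n + 1 : ℕ) * psi β (n + 1 : ℕ) x = √(2 * β) / 2 *
      ((β / Real.pi) ^ (1 / 4 : ℝ) / √(n.factorial : ℝ) *
        Polynomial.aeval (√(2 * β) * x) (Polynomial.hermite (n + 1)) *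
          Real.exp (-(β * x ^ 2 / 2))) := by
  rw [psi_natCast, lad]
  have e1 : √(β * ((n + 1 : ℕ) : ℤ) / 2) = √(2 * β) / 2 * √(n + 1) := by
    rw [show β * (((n + 1 : ℕ) : ℤ) : ℝ) / 2 = 2 * β * (n + 1) / 2 ^ 2 by push_cast; ring,
      Real.sqrt_div' _ (by positivity), Real.sqrt_sq (by norm_num), Real.sqrt_mul (by positivity)]
    ring
  have e2 : √((n + 1).factorial : ℝ) = √(n + 1) * √(n.factorial : ℝ) := by
    rw [Nat.factorial_succ]; push_cast; rw [Real.sqrt_mul (by positivity)]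
  have h1 : 0 < √((n : ℝ) + 1) := by positivity
  have h2 : 0 < √(n.factorial : ℝ) := by positivity
  rw [e1, e2]
  field_simp

/-- The position operator in the Hermite basis. -/
theorem mul_psi (hβ : 0 < β) (m : ℤ) (x : ℝ) :
    β * x * psi β m x = lad β m * psi β (m - 1) x + lad β (m + 1) * psi β (m + 1) x := by
  have hs : √(2 * β) * √(2 * β) = 2 * β := Real.mul_self_sqrt (by positivity)
  obtain hm | hm := lt_or_ge m 0
  -- At m = -1 the neighbour ψ_0 is not zero, but its coefficient `lad β 0` is.
  · rw [psi_of_neg β hm, psi_of_neg β (by omega : m - 1 < 0), lad_of_nonpos hβ (by omega : m ≤ 0),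
      lad_of_nonpos hβ (by omega : m + 1 ≤ 0)]
    simp
  · obtain ⟨n, rfl⟩ := Int.eq_ofNat_of_zero_le hm
    have h2 := lad_mul_psi_succ hβ n x
    push_cast at h2
    rw [h2, psi_natCast]
    cases n with
    | zero =>
      rw [lad_of_nonpos hβ (by simp)]
      simp only [Polynomial.hermite_zero, zero_add, Polynomial.hermite_one, Polynomial.aeval_X]
      simp only [Nat.factorial_zero, map_one]
      linear_combination (-(β / Real.pi) ^ (1 / 4 : ℝ) / √((1 : ℕ) : ℝ) *
        Real.exp (-(β * x ^ 2 / 2)) * x / 2) * hs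
    | succ n =>
      have h1 := lad_mul_psi_pred hβ n x
      rw [show (((n + 1 : ℕ) : ℤ) - 1) = (n : ℕ) by push_cast; ring, h1, aeval_hermite_add_two]
      linear_combination (-(β / Real.pi) ^ (1 / 4 : ℝ) / √((n + 1).factorial : ℝ) *
        Polynomial.aeval (√(2 * β) * x) (Polynomial.hermite (n + 1)) *
        Real.exp (-(β * x ^ 2 / 2)) * x / 2) * hs

/-- Differentiation in the Hermite basis. -/
theorem hasDerivAt_psi (hβ : 0 < β) (m : ℤ) (x : ℝ) :
    HasDerivAt (psi β m) (lad β m * psi β (m - 1) x - lad β (m + 1) * psi β (m + 1) x) x := by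
  obtain hm | hm := lt_or_ge m 0
  · rw [psi_of_neg β hm, psi_of_neg β (by omega : m - 1 < 0), lad_of_nonpos hβ (by omega : m ≤ 0),
      lad_of_nonpos hβ (by omega : m + 1 ≤ 0)]
    simpa using hasDerivAt_const x (0 : ℝ)
  · obtain ⟨n, rfl⟩ := Int.eq_ofNat_of_zero_le hm
    have hx := mul_psi hβ n x
    have e1 : HasDerivAt (fun x : ℝ => √(2 * β) * x) (√(2 * β)) x := by
      simpa using (hasDerivAt_id x).const_mul (√(2 * β))
    have e2 : HasDerivAt (fun x : ℝ => Real.exp (-(β * x ^ 2 / 2)))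
        (Real.exp (-(β * x ^ 2 / 2)) * (-(β * x))) x := by
      have : HasDerivAt (fun x : ℝ => -(β * x ^ 2 / 2)) (-(β * x)) x := by
        refine (((hasDerivAt_pow 2 x).const_mul β).div_const 2).neg.congr_deriv ?_
        norm_num
        ring
      exact this.exp
    have e3 := (Polynomial.hermite n).hasDerivAt_aeval (𝕜 := ℝ) (√(2 * β) * x)
    have e4 := (((e3.comp x e1).const_mul ((β / Real.pi) ^ (1 / 4 : ℝ) / √(n.factorial : ℝ)))).mul e2
    have e5 : lad β n * psi β ((n : ℤ) - 1) x = √(2 * β) / 2 *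
      ((β / Real.pi) ^ (1 / 4 : ℝ) / √(n.factorial : ℝ) *
        Polynomial.aeval (√(2 * β) * x) (Polynomial.derivative (Polynomial.hermite n)) *
          Real.exp (-(β * x ^ 2 / 2))) := by
      cases n with
      | zero => rw [lad_of_nonpos hβ (by simp)]; simp
      | succ n =>
        have h1 := lad_mul_psi_pred hβ n x
        rw [show (((n + 1 : ℕ) : ℤ) - 1) = (n : ℕ) by push_cast; ring, h1, derivative_hermite_succ]
        simp only [map_mul, map_add, map_one, map_natCast]
        ring
    -- Eliminating ψ_{n+1} with the position operator leaves the derivative of the polynomial factor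
    -- and that of the Gaussian factor, separately.
    rw [show lad β n * psi β ((n : ℤ) - 1) x - lad β (n + 1) * psi β (n + 1) x =
      2 * (lad β n * psi β ((n : ℤ) - 1) x) - β * x * psi β n x by rw [hx]; ring, e5, psi_natCast]
    refine e4.congr_deriv ?_
    simp only [Function.comp]
    ring

theorem continuous_psi (hβ : 0 < β) (m : ℤ) : Continuous (psi β m) :=
  continuous_iff_continuousAt.mpr fun x => (hasDerivAt_psi hβ m x).continuousAt

theorem gaussDecay_zero {F : Type*} [NormedAddCommGroup F] : GaussDecay (fun _ : ℝ => (0 : F)) :=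
  ⟨continuous_const, 1, one_pos, 0, by simp⟩

theorem gaussDecay_gaussian (hβ : 0 < β) : GaussDecay (fun x : ℝ => Real.exp (-(β * x ^ 2 / 2))) :=
  ⟨by fun_prop, β / 2, by positivity, 1, fun x => by
    rw [Real.norm_of_nonneg (Real.exp_pos _).le, one_mul, show β / 2 * x ^ 2 = β * x ^ 2 / 2 by ring]⟩

theorem psi_zero_eq (β : ℝ) (x : ℝ) :
    psi β 0 x = (β / Real.pi) ^ (1 / 4 : ℝ) * Real.exp (-(β * x ^ 2 / 2)) := by
  have := psi_natCast β 0 x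
  simpa using this

/-- The position identity, solved for ψ_{n+2}, propagates the decay from ψ_0 and ψ_1, so no growth
estimate for the polynomials is needed. -/
theorem gaussDecay_psi (hβ : 0 < β) (m : ℤ) : GaussDecay (psi β m) := by
  obtain hm | hm := lt_or_ge m 0
  · rw [psi_of_neg β hm]; exact gaussDecay_zero
  · obtain ⟨n, rfl⟩ := Int.eq_ofNat_of_zero_le hm
    clear hm
    induction n using Nat.twoStepInduction with
    | zero =>
      have := (gaussDecay_gaussian hβ).const_mul ((β / Real.pi) ^ (1 / 4 : ℝ))
      exact this.congr (psi_zero_eq β)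
    | one =>
      have h0 := (gaussDecay_gaussian hβ).const_mul ((β / Real.pi) ^ (1 / 4 : ℝ) * √(2 * β))
      refine (h0.pow_mul 1).congr fun x => ?_
      rw [psi_natCast]
      simp
      ring
    | more n h0 h1 =>
      have hl : 0 < lad β ((n + 2 : ℕ) : ℤ) := lad_pos hβ (by positivity)
      have h2 := ((h1.pow_mul 1).const_mul (β / lad β ((n + 2 : ℕ) : ℤ))).sub
        (h0.const_mul (lad β ((n + 1 : ℕ) : ℤ) / lad β ((n + 2 : ℕ) : ℤ)))
      refine h2.congr fun x => ?_
      have := mul_psi hβ ((n + 1 : ℕ) : ℤ) x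
      rw [show ((n + 1 : ℕ) : ℤ) - 1 = (n : ℤ) by push_cast; ring,
        show ((n + 1 : ℕ) : ℤ) + 1 = ((n + 2 : ℕ) : ℤ) by push_cast; ring] at this
      field_simp
      linear_combination -this

/-- The creation operator is the formal adjoint of the annihilation operator. -/
theorem integral_mul_deriv_psi (hβ : 0 < β) (m n : ℤ) :
    ∫ x, lad β (m + 1) * psi β (m + 1) x * psi β n x = ∫ x, psi β m x * (lad β n * psi β (n - 1) x) := by
  have hd := fun i => gaussDecay_psi hβ i
  -- Twice the creation operator is βx - d/dx and twice the annihilation operator is βx + d/dx.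
  -- Multiplication by βx is symmetric, and integration by parts changes the sign of d/dx.
  have h := integral_mul_deriv_eq_deriv_mul_of_integrable (u := psi β m) (v := psi β n)
    (u' := fun x => lad β m * psi β (m - 1) x - lad β (m + 1) * psi β (m + 1) x)
    (v' := fun x => lad β n * psi β (n - 1) x - lad β (n + 1) * psi β (n + 1) x)
    (fun x _ => hasDerivAt_psi hβ m x) (fun x _ => hasDerivAt_psi hβ n x)
    ((hd m).mul (((hd (n - 1)).const_mul _).sub ((hd (n + 1)).const_mul _))).integrable
    ((((hd (m - 1)).const_mul _).sub ((hd (m + 1)).const_mul _)).mul (hd n)).integrable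
    ((hd m).mul (hd n)).integrable
  have i1 : Integrable (fun x => β * x * psi β m x * psi β n x) := by
    convert ((((hd m).pow_mul 1).mul (hd n)).const_mul β).integrable using 2
    ring
  have i2 : Integrable (fun x => psi β m x * (lad β n * psi β (n - 1) x
      - lad β (n + 1) * psi β (n + 1) x)) :=
    ((hd m).mul (((hd (n - 1)).const_mul _).sub ((hd (n + 1)).const_mul _))).integrable
  have i3 : Integrable (fun x => (lad β m * psi β (m - 1) x
      - lad β (m + 1) * psi β (m + 1) x) * psi β n x) :=
    ((((hd (m - 1)).const_mul _).sub ((hd (m + 1)).const_mul _)).mul (hd n)).integrable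
  have a1 : ∫ x, lad β (m + 1) * psi β (m + 1) x * psi β n x =
      2⁻¹ * (∫ x, β * x * psi β m x * psi β n x) - 2⁻¹ * ∫ x, (lad β m * psi β (m - 1) x
      - lad β (m + 1) * psi β (m + 1) x) * psi β n x := by
    rw [← integral_const_mul, ← integral_const_mul, ← integral_sub (i1.const_mul _) (i3.const_mul _)]
    refine integral_congr_ae (Eventually.of_forall fun x => ?_)
    simp only
    rw [mul_psi hβ m]; ring
  have a2 : ∫ x, psi β m x * (lad β n * psi β (n - 1) x) =
      2⁻¹ * (∫ x, β * x * psi β m x * psi β n x) + 2⁻¹ * ∫ x, psi β m x * (lad β n * psi β (n - 1) x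
      - lad β (n + 1) * psi β (n + 1) x) := by
    rw [← integral_const_mul, ← integral_const_mul, ← integral_add (i1.const_mul _) (i2.const_mul _)]
    refine integral_congr_ae (Eventually.of_forall fun x => ?_)
    simp only
    rw [show β * x * psi β m x * psi β n x = psi β m x * (β * x * psi β n x) by ring,
      mul_psi hβ n]; ring
  rw [a1, a2, h]
  ring

theorem integral_psi_zero_sq (hβ : 0 < β) : ∫ x, psi β 0 x * psi β 0 x = 1 := by
  have h (x : ℝ) : psi β 0 x * psi β 0 x = (β / Real.pi) ^ (1 / 2 : ℝ) * Real.exp (-β * x ^ 2) := by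
    rw [psi_zero_eq, mul_mul_mul_comm, ← Real.exp_add, ← Real.rpow_add (by positivity)]
    norm_num
    left; ring
  simp_rw [h]
  rw [integral_const_mul, integral_gaussian, ← Real.sqrt_eq_rpow, ← Real.sqrt_mul (by positivity)]
  rw [div_mul_div_comm, mul_comm, div_self (by positivity), Real.sqrt_one]

/-- The Hermite functions are orthonormal. -/
theorem integral_psi_mul_psi (hβ : 0 < β) (m n : ℤ) :
    ∫ x, psi β m x * psi β n x = if m = n ∧ 0 ≤ m then 1 else 0 := by
  obtain hm | hm := lt_or_ge m 0
  · simp [psi_of_neg β hm, not_le.mpr hm]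
  obtain hn | hn := lt_or_ge n 0
  · rw [if_neg (by omega)]; simp [psi_of_neg β hn]
  obtain ⟨m, rfl⟩ := Int.eq_ofNat_of_zero_le hm
  obtain ⟨n, rfl⟩ := Int.eq_ofNat_of_zero_le hn
  clear hm hn
  induction m generalizing n with
  | zero =>
    cases n with
    | zero => simpa using integral_psi_zero_sq hβ
    | succ n =>
      have h := integral_mul_deriv_psi hβ n ((0 : ℕ) : ℤ)
      rw [lad_of_nonpos hβ (show ((0 : ℕ) : ℤ) ≤ 0 by simp)] at h
      simp_rw [mul_assoc] at h
      rw [integral_const_mul] at h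
      have hl : lad β ((n : ℤ) + 1) ≠ 0 := (lad_pos hβ (by positivity)).ne'
      simp [hl] at h
      rw [if_neg (by simp; omega)]
      rw [← h]
      push_cast
      simp_rw [mul_comm]
  | succ m ih =>
    -- Adjointness lowers both indices by one, and the factor `lad β (m + 1)` can be cancelled
    -- because it is positive.
    have h := integral_mul_deriv_psi hβ m n
    simp_rw [mul_assoc, fun x => mul_left_comm (psi β (m : ℤ) x) (lad β n)] at h
    rw [integral_const_mul, integral_const_mul] at h
    have hl : lad β ((m : ℤ) + 1) ≠ 0 := (lad_pos hβ (by positivity)).ne'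
    cases n with
    | zero =>
      rw [lad_of_nonpos hβ (show ((0 : ℕ) : ℤ) ≤ 0 by simp)] at h
      simp only [zero_mul, mul_eq_zero, hl, false_or] at h
      rw [if_neg (by push_cast; omega)]
      push_cast
      exact h
    | succ n =>
      rw [show ((n + 1 : ℕ) : ℤ) - 1 = (n : ℕ) by push_cast; ring, ih n] at h
      by_cases hmn : m = n
      · subst hmn
        push_cast at h ⊢
        rw [if_pos (by simp)] at h
        rw [if_pos (by constructor <;> first | rfl | positivity)]
        rw [mul_one] at h
        exact mul_left_cancel₀ hl (by rw [h, mul_one])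
      · rw [if_neg (by simp [hmn])] at h
        rw [if_neg (by push_cast; omega)]
        push_cast at h ⊢
        simpa [hl] using h

end Psi

end EquatorialWaves

namespace EquatorialWaves

/-! ### A uniform bound for the Hermite functions -/

section HermiteBound

/-- The generating function of `He_n(y) / n!`. -/
noncomputable def hermiteGen (y : ℝ) (z : ℂ) : ℂ := Complex.exp (y * z - z ^ 2 / 2)

theorem hasDerivAt_hermiteGen (y : ℝ) (z : ℂ) :
    HasDerivAt (hermiteGen y) (hermiteGen y z * (y - z)) z := by
  have h : HasDerivAt (fun z : ℂ => (y : ℂ) * z - z ^ 2 / 2) (y - z) z := by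
    refine (((hasDerivAt_id z).const_mul (y : ℂ)).sub
      ((hasDerivAt_pow 2 z).div_const 2)).congr_deriv ?_
    norm_num
  exact h.cexp

theorem differentiable_hermiteGen (y : ℝ) : Differentiable ℂ (hermiteGen y) :=
  fun z => (hasDerivAt_hermiteGen y z).differentiableAt

/-- The contour integrals whose values are `2 π He_n(y) / n!`. -/
noncomputable def hermiteContour (y ρ : ℝ) (n : ℕ) : ℂ :=
  ∫ θ in (0 : ℝ)..2 * Real.pi, hermiteGen y (circleMap 0 ρ θ) * (circleMap 0 ρ θ)⁻¹ ^ n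

variable {y ρ : ℝ}

theorem continuous_contour_aux (hρ : 0 < ρ) (n : ℕ) : Continuous fun θ : ℝ =>
    hermiteGen y (circleMap 0 ρ θ) * (circleMap 0 ρ θ)⁻¹ ^ n := by
  have h1 : Continuous (circleMap 0 ρ) := continuous_circleMap 0 ρ
  exact ((differentiable_hermiteGen y).continuous.comp h1).mul
    ((h1.inv₀ fun θ => circleMap_ne_center hρ.ne').pow n)

theorem integral_circleMap_eq {f : ℂ → ℂ} (hf : Differentiable ℂ f) (ρ : ℝ) :
    ∫ θ in (0 : ℝ)..2 * Real.pi, f (circleMap 0 ρ θ) = 2 * Real.pi * f 0 := by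
  have h := DiffContOnCl.circleAverage (f := f) (c := 0) (R := ρ) hf.diffContOnCl
  rw [Real.circleAverage_def] at h
  rw [← h, Complex.real_smul]
  push_cast
  field_simp

theorem hermiteContour_zero : hermiteContour y ρ 0 = 2 * Real.pi := by
  have := integral_circleMap_eq (differentiable_hermiteGen y) ρ
  simpa [hermiteContour, hermiteGen] using this

theorem hasDerivAt_contour_aux (hρ : 0 < ρ) (n : ℕ) (θ : ℝ) :
    HasDerivAt (fun θ : ℝ => hermiteGen y (circleMap 0 ρ θ) * (circleMap 0 ρ θ)⁻¹ ^ (n + 1))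
      (Complex.I * (y * (hermiteGen y (circleMap 0 ρ θ) * (circleMap 0 ρ θ)⁻¹ ^ n) -
        hermiteGen y (circleMap 0 ρ θ) * (circleMap 0 ρ θ) * (circleMap 0 ρ θ)⁻¹ ^ n -
        (n + 1) * (hermiteGen y (circleMap 0 ρ θ) * (circleMap 0 ρ θ)⁻¹ ^ (n + 1)))) θ := by
  have hz : circleMap 0 ρ θ ≠ 0 := circleMap_ne_center hρ.ne'
  have h1 := hasDerivAt_circleMap 0 ρ θ
  have h2 := (hasDerivAt_hermiteGen y (circleMap 0 ρ θ)).comp θ h1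
  have h3 := (h1.fun_inv hz).fun_pow (n + 1)
  refine (h2.fun_mul h3).congr_deriv ?_
  simp only [Function.comp, Nat.add_sub_cancel, inv_pow]
  push_cast
  field_simp
  ring

/-- The total θ-derivative computed in `hasDerivAt_contour_aux` integrates to zero over a period.
The last integral is left unsimplified so that n = 0, where it is a mean value and not a contour
integral of the family, is included. -/
theorem contour_recurrence (hρ : 0 < ρ) (n : ℕ) :
    (n + 1) * hermiteContour y ρ (n + 1) = y * hermiteContour y ρ n -
      ∫ θ in (0 : ℝ)..2 * Real.pi,
        hermiteGen y (circleMap 0 ρ θ) * (circleMap 0 ρ θ) * (circleMap 0 ρ θ)⁻¹ ^ n := by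
  have hc := fun m => continuous_contour_aux (y := y) hρ m
  have hc' : Continuous fun θ : ℝ =>
      hermiteGen y (circleMap 0 ρ θ) * (circleMap 0 ρ θ) * (circleMap 0 ρ θ)⁻¹ ^ n := by
    refine ((hc n).mul (continuous_circleMap 0 ρ)).congr fun θ => ?_
    simp only [Pi.mul_apply]
    ring
  have h := intervalIntegral.integral_eq_sub_of_hasDerivAt (a := 0) (b := 2 * Real.pi)
    (fun θ _ => hasDerivAt_contour_aux (y := y) hρ n θ)
    (Continuous.intervalIntegrable (by
      exact continuous_const.mul (((continuous_const.mul (hc n)).sub hc').sub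
        (continuous_const.mul (hc (n + 1))))) _ _)
  have hp : circleMap 0 ρ (2 * Real.pi) = circleMap 0 ρ 0 := by
    simpa using periodic_circleMap 0 ρ 0
  rw [hp, sub_self, intervalIntegral.integral_const_mul, intervalIntegral.integral_sub,
    intervalIntegral.integral_sub, intervalIntegral.integral_const_mul,
    intervalIntegral.integral_const_mul] at h
  · have h' := (mul_eq_zero.mp h).resolve_left Complex.I_ne_zero
    unfold hermiteContour
    linear_combination -h'
  · exact (continuous_const.mul (hc n)).intervalIntegrable _ _
  · exact hc'.intervalIntegrable _ _
  · exact ((continuous_const.mul (hc n)).sub hc').intervalIntegrable _ _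
  · exact (continuous_const.mul (hc (n + 1))).intervalIntegrable _ _

/-- Both sides satisfy the three-term recurrence divided by n!, and the initial values come from the
mean value property of entire functions. -/
theorem hermiteContour_eq (hρ : 0 < ρ) (n : ℕ) :
    hermiteContour y ρ n =
      ((2 * Real.pi * (Polynomial.aeval y (Polynomial.hermite n) / n.factorial) : ℝ) : ℂ) := by
  induction n using Nat.twoStepInduction with
  | zero => simp [hermiteContour_zero]
  | one =>
    have h := contour_recurrence (y := y) hρ 0
    have h0 := integral_circleMap_eq ((differentiable_hermiteGen y).mul differentiable_id) ρ
    simp only [Pi.mul_apply, id, mul_zero] at h0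
    simp only [pow_zero, mul_one, h0, hermiteContour_zero] at h
    simp at h ⊢
    rw [h]; ring
  | more n h0 h1 =>
    have h := contour_recurrence (y := y) hρ (n + 1)
    have e : ∫ θ in (0 : ℝ)..2 * Real.pi, hermiteGen y (circleMap 0 ρ θ) * (circleMap 0 ρ θ) *
        (circleMap 0 ρ θ)⁻¹ ^ (n + 1) = hermiteContour y ρ n := by
      refine intervalIntegral.integral_congr fun θ _ => ?_
      have hz : circleMap 0 ρ θ ≠ 0 := circleMap_ne_center hρ.ne'
      simp only [pow_succ']
      field_simp
    rw [e, h0, h1] at h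
    have hn : ((n : ℂ) + 1 + 1) ≠ 0 := by exact_mod_cast Nat.succ_ne_zero (n + 1)
    refine mul_left_cancel₀ hn ?_
    push_cast at h ⊢
    rw [h]
    have hr := aeval_hermite_add_two n y
    rw [hr]
    simp only [Nat.factorial_succ]
    push_cast
    have hn1 : ((n : ℂ) + 1) ≠ 0 := by exact_mod_cast Nat.succ_ne_zero n
    have hf : ((n.factorial : ℕ) : ℂ) ≠ 0 := by exact_mod_cast n.factorial_ne_zero
    field_simp

/-- Completing the square isolates e^{y²/4}, exactly the growth that the Gaussian factor of a
Hermite function cancels. What remains concentrates where ρ cos θ is close to y/2. -/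
theorem norm_hermiteGen_circleMap (y ρ θ : ℝ) :
    ‖hermiteGen y (circleMap 0 ρ θ)‖ =
      Real.exp (y ^ 2 / 4 + ρ ^ 2 / 2) * Real.exp (-(y / 2 - ρ * Real.cos θ) ^ 2) := by
  rw [hermiteGen, Complex.norm_exp, ← Real.exp_add]
  congr 1
  have hre : (circleMap 0 ρ θ).re = ρ * Real.cos θ := by
    simp [circleMap, Complex.exp_ofReal_mul_I_re]
  have him : (circleMap 0 ρ θ).im = ρ * Real.sin θ := by
    simp [circleMap, Complex.exp_ofReal_mul_I_im]
  have h2 : (circleMap 0 ρ θ ^ 2 / 2).re = (ρ ^ 2 * Real.cos θ ^ 2 - ρ ^ 2 * Real.sin θ ^ 2) / 2 := by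
    rw [show (2 : ℂ) = ((2 : ℝ) : ℂ) by norm_num, Complex.div_ofReal_re, pow_two, Complex.mul_re,
      hre, him]
    ring
  rw [Complex.sub_re, h2, Complex.re_ofReal_mul, hre, Real.sin_sq]
  ring

/-- The difference is 2 sin((θ+φ)/2) sin((θ-φ)/2). On [0, π] the first sine is at least the second,
and the second is bounded below by Jordan's inequality. -/
theorem two_mul_sq_le_cos_sub_cos {φ θ : ℝ} (h0 : 0 ≤ φ) (h : φ ≤ θ) (hπ : θ ≤ Real.pi) :
    2 * ((θ - φ) / Real.pi) ^ 2 ≤ Real.cos φ - Real.cos θ := by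
  have hpi := Real.pi_pos
  have h1 : 2 / Real.pi * ((θ - φ) / 2) ≤ Real.sin ((θ - φ) / 2) :=
    Real.mul_le_sin (by linarith) (by linarith)
  have h2 : Real.sin ((θ - φ) / 2) ≤ Real.sin ((θ + φ) / 2) := by
    have e := Real.sin_sub_sin ((θ + φ) / 2) ((θ - φ) / 2)
    rw [show ((θ + φ) / 2 - (θ - φ) / 2) / 2 = φ / 2 by ring,
      show ((θ + φ) / 2 + (θ - φ) / 2) / 2 = θ / 2 by ring] at e
    have s1 : 0 ≤ Real.sin (φ / 2) := Real.sin_nonneg_of_nonneg_of_le_pi (by linarith) (by linarith)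
    have s2 : 0 ≤ Real.cos (θ / 2) :=
      Real.cos_nonneg_of_neg_pi_div_two_le_of_le (by linarith) (by linarith)
    have : 0 ≤ 2 * Real.sin (φ / 2) * Real.cos (θ / 2) := by positivity
    linarith
  have h3 : 0 ≤ (θ - φ) / Real.pi := div_nonneg (by linarith) hpi.le
  have e := Real.cos_sub_cos φ θ
  rw [show (φ - θ) / 2 = -((θ - φ) / 2) by ring, Real.sin_neg, add_comm φ θ] at e
  have h4 : (θ - φ) / Real.pi ≤ Real.sin ((θ - φ) / 2) := by
    convert h1 using 1
    field_simp
  have h5 : (θ - φ) / Real.pi * ((θ - φ) / Real.pi) ≤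
      Real.sin ((θ + φ) / 2) * Real.sin ((θ - φ) / 2) :=
    mul_le_mul (h4.trans h2) h4 h3 (h3.trans (h4.trans h2))
  rw [e, pow_two]
  linarith

theorem sq_cos_sub_cos_ge {φ θ : ℝ} (hφ : φ ∈ Set.Icc 0 Real.pi) (hθ : θ ∈ Set.Icc 0 Real.pi) :
    (2 * ((θ - φ) / Real.pi) ^ 2) ^ 2 ≤ (Real.cos φ - Real.cos θ) ^ 2 := by
  rcases le_total φ θ with h | h
  · exact pow_le_pow_left₀ (by positivity) (two_mul_sq_le_cos_sub_cos hφ.1 h hθ.2) 2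
  · have := pow_le_pow_left₀ (by positivity) (two_mul_sq_le_cos_sub_cos hθ.1 h hφ.2) 2
    rw [show (Real.cos φ - Real.cos θ) ^ 2 = (Real.cos θ - Real.cos φ) ^ 2 by ring,
      show ((θ - φ) / Real.pi) ^ 2 = ((φ - θ) / Real.pi) ^ 2 by ring]
    exact this

/-- The witness is the angle of the point of [-ρ, ρ] nearest to w: replacing w by this point can
only bring it closer to each ρ cos θ. -/
theorem exists_angle (hρ : 0 < ρ) (w : ℝ) : ∃ φ ∈ Set.Icc 0 Real.pi, ∀ θ,
    (ρ * (Real.cos φ - Real.cos θ)) ^ 2 ≤ (w - ρ * Real.cos θ) ^ 2 := by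
  rcases le_total w (-ρ) with h | h
  · refine ⟨Real.pi, ⟨Real.pi_pos.le, le_rfl⟩, fun θ => ?_⟩
    rw [Real.cos_pi]
    have := Real.neg_one_le_cos θ
    apply sq_le_sq.mpr
    rw [abs_of_nonpos (by nlinarith), abs_of_nonpos (by nlinarith)]
    nlinarith
  rcases le_total ρ w with h' | h'
  · refine ⟨0, ⟨le_rfl, Real.pi_pos.le⟩, fun θ => ?_⟩
    rw [Real.cos_zero]
    have := Real.cos_le_one θ
    apply sq_le_sq.mpr
    rw [abs_of_nonneg (by nlinarith), abs_of_nonneg (by nlinarith)]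
    nlinarith
  · refine ⟨Real.arccos (w / ρ), ⟨Real.arccos_nonneg _, Real.arccos_le_pi _⟩, fun θ => ?_⟩
    rw [Real.cos_arccos (by rw [le_div_iff₀ hρ]; linarith) (by rw [div_le_iff₀ hρ]; linarith)]
    apply le_of_eq
    field_simp

/-- With a = ρ(u/π)², this is e^{-4a²} ≤ 1/(1 + 4a²) ≤ 2/(1 + a). The quartic exponential is traded
for a Cauchy density, whose integral is elementary. -/
theorem exp_neg_quartic_le (hρ : 0 < ρ) (u : ℝ) :
    Real.exp (-(ρ * (2 * (u / Real.pi) ^ 2)) ^ 2) ≤ 2 * (1 + (√ρ / Real.pi * u) ^ 2)⁻¹ := by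
  set a := ρ * (u / Real.pi) ^ 2 with ha
  have ha0 : 0 ≤ a := by positivity
  have e1 : (√ρ / Real.pi * u) ^ 2 = a := by
    rw [ha, mul_pow, div_pow, Real.sq_sqrt hρ.le]; ring
  have e2 : -(ρ * (2 * (u / Real.pi) ^ 2)) ^ 2 = -(4 * a ^ 2) := by rw [ha]; ring
  rw [e1, e2, Real.exp_neg, ← div_eq_mul_inv, inv_eq_one_div, div_le_div_iff₀ (Real.exp_pos _)
    (by positivity)]
  have := Real.add_one_le_exp (4 * a ^ 2)
  nlinarith [sq_nonneg (a - 1)]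

/-- The gain ρ^{-1/2}, uniform in w, is dictated by the worst case w = ±ρ: there the cosine is
stationary, the exponent is quartic in the angle, and the mass lies in an interval of width
ρ^{-1/2}. -/
theorem integral_exp_cos_le (hρ : 0 < ρ) (w : ℝ) :
    ∫ θ in (0 : ℝ)..2 * Real.pi, Real.exp (-(w - ρ * Real.cos θ) ^ 2) ≤
      4 * Real.pi ^ 2 / √ρ := by
  obtain ⟨φ, hφ, h⟩ := exists_angle hρ w
  have hpi := Real.pi_pos
  set c := √ρ / Real.pi with hc
  have hcpos : 0 < c := by positivity
  let g : ℝ → ℝ := fun u => 2 * (1 + (c * u) ^ 2)⁻¹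
  have hg0 : ∀ u, 0 ≤ g u := fun u => by positivity
  have hgi : Integrable g := (integrable_inv_one_add_sq.comp_mul_left' hcpos.ne').const_mul 2
  have hgv : ∫ u, g u = 2 * Real.pi ^ 2 / √ρ := by
    simp only [g]
    rw [integral_const_mul, Measure.integral_comp_mul_left (fun u : ℝ => (1 + u ^ 2)⁻¹) c,
      integral_univ_inv_one_add_sq, smul_eq_mul, abs_of_pos (by positivity), hc]
    field_simp
  have key : ∀ θ ∈ Set.Icc 0 Real.pi, Real.exp (-(w - ρ * Real.cos θ) ^ 2) ≤ g (θ - φ) := by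
    intro θ hθ
    refine le_trans (Real.exp_le_exp.mpr (neg_le_neg ?_)) (exp_neg_quartic_le hρ (θ - φ))
    refine le_trans ?_ (h θ)
    rw [mul_pow, mul_pow ρ]
    exact mul_le_mul_of_nonneg_left (sq_cos_sub_cos_ge hφ hθ) (by positivity)
  -- The half circle [π, 2π] is reduced to [0, π] by the reflection θ ↦ 2π - θ, at the price of a
  -- second bump.
  have key2 : ∀ θ ∈ Set.Icc 0 (2 * Real.pi), Real.exp (-(w - ρ * Real.cos θ) ^ 2) ≤
      g (θ - φ) + g ((2 * Real.pi - φ) - θ) := by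
    intro θ hθ
    rcases le_total θ Real.pi with h1 | h1
    · exact (key θ ⟨hθ.1, h1⟩).trans (le_add_of_nonneg_right (hg0 _))
    · have := key (2 * Real.pi - θ) ⟨by linarith [hθ.2], by linarith⟩
      rw [Real.cos_two_pi_sub] at this
      refine this.trans ?_
      rw [show 2 * Real.pi - θ - φ = (2 * Real.pi - φ) - θ by ring]
      exact le_add_of_nonneg_left (hg0 _)
  have i1 : Integrable fun θ => g (θ - φ) := hgi.comp_sub_right φ
  have i2 : Integrable fun θ => g ((2 * Real.pi - φ) - θ) := hgi.comp_sub_left _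
  calc ∫ θ in (0 : ℝ)..2 * Real.pi, Real.exp (-(w - ρ * Real.cos θ) ^ 2)
      ≤ ∫ θ in (0 : ℝ)..2 * Real.pi, (g (θ - φ) + g ((2 * Real.pi - φ) - θ)) :=
        intervalIntegral.integral_mono_on (by positivity)
          (Continuous.intervalIntegrable (by fun_prop) _ _)
          ((i1.add i2).intervalIntegrable) key2
    _ ≤ ∫ θ, (g (θ - φ) + g ((2 * Real.pi - φ) - θ)) := by
        rw [intervalIntegral.integral_of_le (by positivity)]
        exact setIntegral_le_integral (i1.add i2)
          (Eventually.of_forall fun θ => add_nonneg (hg0 _) (hg0 _))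
    _ = _ := by
        rw [integral_add i1 i2, integral_sub_right_eq_self, integral_sub_left_eq_self, hgv]
        ring

theorem abs_hermite_mul_exp_le (hρ : 0 < ρ) (n : ℕ) (y : ℝ) :
    |Polynomial.aeval y (Polynomial.hermite n)| * Real.exp (-(y ^ 2 / 4)) ≤
      n.factorial * (2 * Real.pi / √ρ * Real.exp (ρ ^ 2 / 2) / ρ ^ n) := by
  have h := hermiteContour_eq (y := y) hρ n
  have hpi := Real.pi_pos
  have h1 : ‖hermiteContour y ρ n‖ ≤ ∫ θ in (0 : ℝ)..2 * Real.pi,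
      Real.exp (y ^ 2 / 4 + ρ ^ 2 / 2) / ρ ^ n * Real.exp (-(y / 2 - ρ * Real.cos θ) ^ 2) := by
    refine intervalIntegral.norm_integral_le_of_norm_le (by positivity) (Eventually.of_forall
      fun θ _ => ?_) (Continuous.intervalIntegrable (by fun_prop) _ _)
    rw [norm_mul, norm_hermiteGen_circleMap, norm_pow, norm_inv, norm_circleMap_zero,
      abs_of_pos hρ, inv_pow]
    apply le_of_eq
    ring
  rw [intervalIntegral.integral_const_mul] at h1
  have h2 := h1.trans (mul_le_mul_of_nonneg_left (integral_exp_cos_le hρ (y / 2)) (by positivity))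
  rw [h, Complex.norm_real, Real.norm_eq_abs, abs_mul, abs_div, abs_of_pos (by positivity),
    Nat.abs_cast, Real.exp_add] at h2
  have hf : (0 : ℝ) < n.factorial := by positivity
  rw [Real.exp_neg, ← div_eq_mul_inv, div_le_iff₀ (Real.exp_pos _)]
  have h3 := mul_le_mul_of_nonneg_left h2 (show 0 ≤ (n.factorial : ℝ) / (2 * Real.pi) by positivity)
  calc _ = (n.factorial : ℝ) / (2 * Real.pi) * (2 * Real.pi *
        (|Polynomial.aeval y (Polynomial.hermite n)| / n.factorial)) := by field_simp
    _ ≤ _ := h3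
    _ = _ := by field_simp; ring

/-- The Stirling sequence n!/(√(2n) (n/e)^n) decreases from its first value e/√2. -/
theorem factorial_le (n : ℕ) (hn : n ≠ 0) :
    (n.factorial : ℝ) ≤ Real.exp 1 * √n * (n / Real.exp 1) ^ n := by
  obtain ⟨m, rfl⟩ := Nat.exists_eq_succ_of_ne_zero hn
  have h := Stirling.stirlingSeq'_antitone (Nat.zero_le m)
  simp only [Function.comp, Nat.succ_eq_add_one, zero_add, Stirling.stirlingSeq_one] at h
  rw [Stirling.stirlingSeq, div_le_iff₀ (by positivity)] at h
  refine h.trans (le_of_eq ?_)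
  rw [Nat.succ_eq_add_one, Real.sqrt_mul (by norm_num)]
  have : 0 < √(2 : ℝ) := by positivity
  field_simp

end HermiteBound

/-- The Hermite functions are uniformly bounded. -/
theorem exists_psi_bound {β : ℝ} (hβ : 0 < β) : ∃ C, 0 < C ∧ ∀ (m : ℤ) (x : ℝ), |psi β m x| ≤ C := by
  have hpi := Real.pi_pos
  set A := (β / Real.pi) ^ (1 / 4 : ℝ) with hA
  have hApos : 0 < A := by positivity
  refine ⟨A * (2 * Real.pi * Real.exp 1), by positivity, fun m x => ?_⟩
  obtain hm | hm := lt_or_ge m 0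
  · rw [psi_of_neg β hm, abs_zero]; positivity
  obtain ⟨n, rfl⟩ := Int.eq_ofNat_of_zero_le hm
  rw [psi_natCast, ← hA]
  rcases Nat.eq_zero_or_pos n with rfl | hn
  · simp only [Nat.factorial_zero, Nat.cast_one, Real.sqrt_one, div_one, Polynomial.hermite_zero,
      map_one, mul_one]
    rw [abs_of_pos (by positivity)]
    have h1 : Real.exp (-(β * x ^ 2 / 2)) ≤ 1 := Real.exp_le_one_iff.mpr (by nlinarith [sq_nonneg x])
    have h2 : 1 ≤ Real.exp 1 := Real.one_le_exp (by norm_num)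
    have h3 : 1 ≤ 2 * Real.pi * Real.exp 1 := by nlinarith [Real.pi_gt_three]
    gcongr
    exact h1.trans h3
  · have hn' : (0 : ℝ) < n := by exact_mod_cast hn
    -- The radius √n minimizes e^{ρ²/2}/ρ^n. The contour estimate then gains n^{-1/4}, which cancels
    -- the n^{1/4} in Stirling's bound for √(n!).
    have h := abs_hermite_mul_exp_le (ρ := √n) (by positivity) n (√(2 * β) * x)
    rw [show (√(2 * β) * x) ^ 2 / 4 = β * x ^ 2 / 2 by
      rw [mul_pow, Real.sq_sqrt (by positivity)]; ring, Real.sq_sqrt hn'.le] at h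
    have hfac := factorial_le n hn.ne'
    have hf : (0 : ℝ) < n.factorial := by positivity
    have e3 : √(n.factorial : ℝ) * (1 / √√n * Real.exp (n / 2) / √n ^ n) ≤ Real.exp 1 := by
      have h2 : 1 ≤ Real.exp 1 := Real.one_le_exp (by norm_num)
      refine (le_abs_self _).trans (abs_le_of_sq_le_sq ?_ (by positivity))
      rw [mul_pow, Real.sq_sqrt hf.le, div_pow, mul_pow, div_pow, Real.sq_sqrt (by positivity),
        one_pow, ← Real.exp_nat_mul, ← pow_mul, mul_comm n 2, pow_mul, Real.sq_sqrt hn'.le]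
      calc (n.factorial : ℝ) * (1 / √n * Real.exp ((2 : ℕ) * (n / 2)) / (n : ℝ) ^ n)
          ≤ (Real.exp 1 * √n * (n / Real.exp 1) ^ n) *
            (1 / √n * Real.exp ((2 : ℕ) * (n / 2)) / (n : ℝ) ^ n) := by gcongr
        _ = Real.exp 1 := by
          rw [show ((2 : ℕ) : ℝ) * (n / 2) = n * 1 by push_cast; ring, Real.exp_nat_mul, div_pow]
          field_simp
        _ ≤ Real.exp 1 ^ 2 := by nlinarith
    rw [abs_mul, abs_mul, abs_of_pos (show 0 < A / √(n.factorial : ℝ) by positivity),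
      abs_of_pos (Real.exp_pos _), mul_assoc]
    calc A / √(n.factorial : ℝ) * (|Polynomial.aeval (√(2 * β) * x) (Polynomial.hermite n)| *
          Real.exp (-(β * x ^ 2 / 2)))
        ≤ A / √(n.factorial : ℝ) * (n.factorial * (2 * Real.pi / √√n * Real.exp (n / 2) / √n ^ n)) := by
          gcongr
      _ = A * (2 * Real.pi * (√(n.factorial : ℝ) * (1 / √√n * Real.exp (n / 2) / √n ^ n))) := by
          have hs : (n.factorial : ℝ) = √(n.factorial : ℝ) * √(n.factorial : ℝ) :=
            (Real.mul_self_sqrt hf.le).symm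
          have hs0 : 0 < √(n.factorial : ℝ) := by positivity
          rw [show A / √(n.factorial : ℝ) * (n.factorial * (2 * Real.pi / √√n * Real.exp (n / 2) / √n ^ n))
            = A / √(n.factorial : ℝ) * ((√(n.factorial : ℝ) * √(n.factorial : ℝ)) *
              (2 * Real.pi / √√n * Real.exp (n / 2) / √n ^ n)) by rw [← hs]]
          field_simp
      _ ≤ _ := by gcongr

end EquatorialWaves

namespace EquatorialWaves

/-! ### Derivatives of the Hermite functions -/

section Deriv

variable {β : ℝ}

/-- The iterated derivatives of the Hermite functions. -/
noncomputable def psiD (β : ℝ) : ℕ → ℤ → ℝ → ℝ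
  | 0, m, x => psi β m x
  | a + 1, m, x => lad β m * psiD β a (m - 1) x - lad β (m + 1) * psiD β a (m + 1) x

theorem hasDerivAt_psiD (hβ : 0 < β) (a : ℕ) (m : ℤ) (x : ℝ) :
    HasDerivAt (psiD β a m) (psiD β (a + 1) m x) x := by
  induction a generalizing m with
  | zero => exact hasDerivAt_psi hβ m x
  | succ a ih => exact ((ih (m - 1)).const_mul (lad β m)).sub ((ih (m + 1)).const_mul (lad β (m + 1)))

theorem lad_le (hβ : 0 < β) (m : ℤ) : lad β m ≤ √β * √(1 + |(m : ℝ)|) := by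
  rw [← Real.sqrt_mul hβ.le, lad]
  apply Real.sqrt_le_sqrt
  have := le_abs_self (m : ℝ)
  have := abs_nonneg (m : ℝ)
  nlinarith

theorem lad_succ_le (hβ : 0 < β) (m : ℤ) : lad β (m + 1) ≤ √β * √(1 + |(m : ℝ)|) := by
  rw [← Real.sqrt_mul hβ.le, lad]
  apply Real.sqrt_le_sqrt
  have := le_abs_self (m : ℝ)
  have := abs_nonneg (m : ℝ)
  push_cast
  nlinarith

theorem sqrt_one_add_abs_add_le {m n : ℤ} (h : |n| ≤ |m| + 1) :
    √(1 + |(n : ℝ)|) ≤ √2 * √(1 + |(m : ℝ)|) := by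
  rw [← Real.sqrt_mul (by norm_num)]
  apply Real.sqrt_le_sqrt
  have h' : |(n : ℝ)| ≤ |(m : ℝ)| + 1 := by exact_mod_cast h
  have := abs_nonneg (m : ℝ)
  linarith

theorem abs_sub_one_le (m : ℤ) : |m - 1| ≤ |m| + 1 := by
  simpa using abs_sub m 1

theorem abs_add_one_le (m : ℤ) : |m + 1| ≤ |m| + 1 := by
  simpa using abs_add_le m 1

/-- Uniform bounds for the derivatives of the Hermite functions. -/
theorem exists_psiD_bound (hβ : 0 < β) (a : ℕ) :
    ∃ C, 0 < C ∧ ∀ (m : ℤ) (x : ℝ), |psiD β a m x| ≤ C * √(1 + |(m : ℝ)|) ^ a := by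
  induction a with
  | zero => simpa [psiD] using exists_psi_bound hβ
  | succ a ih =>
    obtain ⟨C, hC, h⟩ := ih
    refine ⟨2 * (√β * (C * √2 ^ a)), by positivity, fun m x => ?_⟩
    have key (n : ℤ) (hn : |n| ≤ |m| + 1) : |psiD β a n x| ≤ C * (√2 * √(1 + |(m : ℝ)|)) ^ a :=
      (h n x).trans (by gcongr; exact sqrt_one_add_abs_add_le hn)
    calc |psiD β (a + 1) m x|
        ≤ lad β m * |psiD β a (m - 1) x| + lad β (m + 1) * |psiD β a (m + 1) x| := by
          rw [psiD]
          refine (abs_sub _ _).trans ?_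
          rw [abs_mul, abs_mul, abs_of_nonneg (lad_nonneg β m), abs_of_nonneg (lad_nonneg β (m + 1))]
      _ ≤ (√β * √(1 + |(m : ℝ)|)) * (C * (√2 * √(1 + |(m : ℝ)|)) ^ a) +
          (√β * √(1 + |(m : ℝ)|)) * (C * (√2 * √(1 + |(m : ℝ)|)) ^ a) := by
          gcongr
          · exact lad_le hβ m
          · exact key _ (abs_sub_one_le m)
          · exact lad_succ_le hβ m
          · exact key _ (abs_add_one_le m)
      _ = _ := by rw [mul_pow, pow_succ]; ring

end Deriv

/-! ### Fourier transform of the Hermite functions -/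

section Fourier

variable {β : ℝ}

theorem norm_exp_neg_I_mul (ξ x : ℝ) : ‖Complex.exp (-(Complex.I * ξ * x))‖ = 1 := by
  rw [show -(Complex.I * ξ * x) = ((-(ξ * x) : ℝ) : ℂ) * Complex.I by push_cast; ring]
  exact Complex.norm_exp_ofReal_mul_I _

theorem GaussDecay.exp_mul {f : ℝ → ℂ} (hf : GaussDecay f) (ξ : ℝ) :
    GaussDecay (fun x : ℝ => Complex.exp (-(Complex.I * ξ * x)) * f x) :=
  hf.of_norm_le ((by fun_prop : Continuous fun x : ℝ => Complex.exp (-(Complex.I * ξ * x))).mul hf.1)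
    1 fun x => by rw [norm_mul, norm_exp_neg_I_mul]

/-- The Fourier transform of an integrable function, in the normalization of the statement. -/
noncomputable def ft (f : ℝ → ℂ) (ξ : ℝ) : ℂ := ∫ x : ℝ, Complex.exp (-(Complex.I * ξ * x)) * f x

theorem hasDerivAt_ft {f : ℝ → ℂ} (hf : GaussDecay f) (ξ : ℝ) :
    HasDerivAt (ft f) (-Complex.I * ft (fun x => x * f x) ξ) ξ := by
  have hx : GaussDecay (fun x : ℝ => (x : ℂ) * f x) := by
    refine (hf.pow_smul 1).congr fun x => ?_
    simp
  have h := hasDerivAt_integral_of_dominated_loc_of_deriv_le (μ := volume) (𝕜 := ℝ)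
    (F := fun (ξ : ℝ) (x : ℝ) => Complex.exp (-(Complex.I * ξ * x)) * f x)
    (F' := fun (ξ : ℝ) (x : ℝ) => Complex.exp (-(Complex.I * ξ * x)) * (-(Complex.I * x)) * f x)
    (x₀ := ξ) (s := Set.univ) (bound := fun x : ℝ => ‖(x : ℂ) * f x‖) univ_mem
    (Eventually.of_forall fun ξ => (hf.exp_mul ξ).1.aestronglyMeasurable)
    (hf.exp_mul ξ).integrable
    (Continuous.aestronglyMeasurable (Continuous.mul (by fun_prop) hf.1))
    (Eventually.of_forall fun x ξ _ => by
      rw [norm_mul, norm_mul, norm_exp_neg_I_mul, norm_neg, norm_mul, norm_mul, Complex.norm_I]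
      simp)
    hx.integrable.norm
    (Eventually.of_forall fun x ξ _ => by
      have h1 : HasDerivAt (fun ξ : ℝ => -(Complex.I * ξ * x)) (-(Complex.I * x)) ξ := by
        have := ((((hasDerivAt_id ξ).ofReal_comp).const_mul Complex.I).mul_const (x : ℂ)).fun_neg
        simpa using this
      exact h1.cexp.mul_const (f x))
  refine h.2.congr_deriv ?_
  rw [ft, ← integral_const_mul]
  refine integral_congr_ae (Eventually.of_forall fun x => ?_)
  simp only
  ring

theorem ft_deriv {f f' : ℝ → ℂ} (hf : GaussDecay f) (hf' : GaussDecay f')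
    (h : ∀ x, HasDerivAt f (f' x) x) (ξ : ℝ) : ft f' ξ = Complex.I * ξ * ft f ξ := by
  have h1 (x : ℝ) : HasDerivAt (fun x : ℝ => Complex.exp (-(Complex.I * ξ * x)))
      (Complex.exp (-(Complex.I * ξ * x)) * (-(Complex.I * ξ))) x := by
    have h1 : HasDerivAt (fun x : ℝ => -(Complex.I * ξ * x)) (-(Complex.I * ξ)) x := by
      have := (((hasDerivAt_id x).ofReal_comp).const_mul (Complex.I * ξ)).fun_neg
      simpa using this
    exact h1.cexp
  have h2 := integral_mul_deriv_eq_deriv_mul_of_integrable (fun x _ => h1 x) (fun x _ => h x)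
    (hf'.exp_mul ξ).integrable
    (by
      refine ((hf.exp_mul ξ).const_mul (-(Complex.I * ξ))).integrable.congr
        (Eventually.of_forall fun x => ?_)
      simp only [Pi.mul_apply]; ring)
    (hf.exp_mul ξ).integrable
  rw [ft, h2, ft, ← integral_const_mul, ← integral_neg]
  refine integral_congr_ae (Eventually.of_forall fun x => ?_)
  simp only
  ring

/-- The Hermite functions are eigenfunctions of the Fourier transform. -/
theorem ft_psi (hβ : 0 < β) (n : ℕ) (ξ : ℝ) :
    ft (fun x => (psi β n x : ℂ)) ξ =
      (-Complex.I) ^ n * ((√(2 * Real.pi / β) * psi β n (ξ / β) : ℝ) : ℂ) := by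
  induction n generalizing ξ with
  | zero =>
    have h := fourierIntegral_gaussian (b := ((β / 2 : ℝ) : ℂ)) (by simpa using hβ) ((-ξ : ℝ) : ℂ)
    have e : ft (fun x => (psi β (0 : ℕ) x : ℂ)) ξ = ((β / Real.pi) ^ (1 / 4 : ℝ) : ℝ) *
        ∫ x : ℝ, Complex.exp (Complex.I * ((-ξ : ℝ) : ℂ) * x) *
          Complex.exp (-((β / 2 : ℝ) : ℂ) * x ^ 2) := by
      rw [ft, ← integral_const_mul]
      refine integral_congr_ae (Eventually.of_forall fun x => ?_)
      simp only [Nat.cast_zero, psi_zero_eq]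
      push_cast
      rw [show -(Complex.I * ξ * x) = Complex.I * (-ξ) * x by ring,
        show -((β : ℂ) * x ^ 2 / 2) = -(β / 2) * x ^ 2 by ring]
      ring
    rw [e, h, Nat.cast_zero, psi_zero_eq, pow_zero, one_mul]
    have e2 : ((Real.pi : ℂ) / ((β / 2 : ℝ) : ℂ)) ^ (1 / 2 : ℂ) = ((√(2 * Real.pi / β) : ℝ) : ℂ) := by
      rw [Real.sqrt_eq_rpow, Complex.ofReal_cpow (by positivity)]
      push_cast
      congr 1
      field_simp
    have e3 : Complex.exp (-((-ξ : ℝ) : ℂ) ^ 2 / (4 * ((β / 2 : ℝ) : ℂ))) =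
        ((Real.exp (-(β * (ξ / β) ^ 2 / 2)) : ℝ) : ℂ) := by
      push_cast
      congr 1
      have : (β : ℂ) ≠ 0 := by exact_mod_cast hβ.ne'
      field_simp
      ring
    rw [e2, e3]
    push_cast
    ring
  | succ n ih =>
    set c : ℂ := (-Complex.I) ^ n * (√(2 * Real.pi / β) : ℝ) with hc
    have hD : GaussDecay (fun x => (psi β n x : ℂ)) := (gaussDecay_psi hβ n).ofReal
    have hD1 : GaussDecay (fun x => (psi β ((n + 1 : ℕ) : ℤ) x : ℂ)) := (gaussDecay_psi hβ _).ofReal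
    have hD' : GaussDecay (fun x => ((lad β n * psi β ((n : ℤ) - 1) x -
        lad β (n + 1) * psi β (n + 1) x : ℝ) : ℂ)) :=
      (((gaussDecay_psi hβ _).const_mul _).sub ((gaussDecay_psi hβ _).const_mul _)).ofReal
    have h1 := hasDerivAt_ft hD ξ
    have h2 : HasDerivAt (ft fun x => (psi β n x : ℂ)) (c * ((lad β n * psi β ((n : ℤ) - 1) (ξ / β) -
        lad β (n + 1) * psi β (n + 1) (ξ / β) : ℝ) / β)) ξ := by
      have e : ft (fun x => (psi β n x : ℂ)) = fun ξ => c * ((psi β n (ξ / β) : ℝ) : ℂ) := by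
        funext η
        rw [ih η, hc]; push_cast; ring
      rw [e]
      have h3 := (hasDerivAt_psi hβ n (ξ / β)).scomp ξ ((hasDerivAt_id ξ).div_const β)
      refine (h3.ofReal_comp.const_mul c).congr_deriv ?_
      simp only [smul_eq_mul]
      push_cast
      ring
    -- The derivative of the transform of ψ_n is computed in two ways, by differentiating under the
    -- integral and from the induction hypothesis. This identifies the transform of xψ_n.
    have h3 := h1.unique h2
    have h4 := ft_deriv hD hD' (fun x => (hasDerivAt_psi hβ n x).ofReal_comp) ξ
    have hl : (lad β (n + 1) : ℂ) ≠ 0 := by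
      exact_mod_cast (lad_pos hβ (by positivity)).ne'
    have hx : GaussDecay (fun x : ℝ => (x : ℂ) * psi β n x) := by
      refine (hD.pow_smul 1).congr fun x => ?_
      simp
    -- This is the transform of the creation identity 2 lad_{n+1} ψ_{n+1} = βxψ_n - ψ_n'.
    have h5 : 2 * lad β (n + 1) * ft (fun x => (psi β ((n + 1 : ℕ) : ℤ) x : ℂ)) ξ =
        β * ft (fun x => x * (psi β n x : ℂ)) ξ - ft (fun x => ((lad β n * psi β ((n : ℤ) - 1) x -
        lad β (n + 1) * psi β (n + 1) x : ℝ) : ℂ)) ξ := by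
      simp only [ft]
      rw [← integral_const_mul, ← integral_const_mul, ← integral_sub
        ((hx.exp_mul ξ).const_mul _).integrable (hD'.exp_mul ξ).integrable]
      refine integral_congr_ae (Eventually.of_forall fun x => ?_)
      have := congrArg (fun t : ℝ => (t : ℂ)) (mul_psi hβ n x)
      simp only at this ⊢
      push_cast at this ⊢
      linear_combination (-Complex.exp (-(Complex.I * ξ * x))) * this
    have h6 := congrArg (fun t : ℝ => (t : ℂ)) (mul_psi hβ n (ξ / β))
    have hβ' : (β : ℂ) ≠ 0 := by exact_mod_cast hβ.ne'
    refine mul_left_cancel₀ (mul_ne_zero two_ne_zero hl) ?_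
    rw [h5, h4, ih ξ]
    have h7 : ft (fun x => x * (psi β n x : ℂ)) ξ = Complex.I * (c * ((lad β n *
        psi β ((n : ℤ) - 1) (ξ / β) - lad β (n + 1) * psi β (n + 1) (ξ / β) : ℝ) / β)) := by
      rw [← h3]; ring_nf; simp
    rw [h7, pow_succ]
    push_cast at h6 ⊢
    have h8 : (ξ : ℂ) = β * (ξ / β) := by field_simp
    rw [hc]
    generalize ((-Complex.I) ^ n) = u
    have h9 : (β : ℂ) * (Complex.I * (u * (√(2 * Real.pi / β) : ℝ) * ((lad β n *
        psi β ((n : ℤ) - 1) (ξ / β) - lad β (n + 1) * psi β (n + 1) (ξ / β)) / β))) =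
        Complex.I * (u * (√(2 * Real.pi / β) : ℝ) * ((lad β n *
        psi β ((n : ℤ) - 1) (ξ / β) - lad β (n + 1) * psi β (n + 1) (ξ / β)))) := by
      field_simp
    rw [h9]
    have h10 : (ξ : ℂ) * (psi β n (ξ / β) : ℂ) =
        lad β n * psi β ((n : ℤ) - 1) (ξ / β) + lad β (n + 1) * psi β (n + 1) (ξ / β) := by
      rw [← h6]; field_simp
    linear_combination (-Complex.I * u * (√(2 * Real.pi / β) : ℝ)) * h10

theorem norm_sq_ft_psi (hβ : 0 < β) (m : ℤ) (ξ : ℝ) :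
    ‖ft (fun x => (psi β m x : ℂ)) ξ‖ ^ 2 = 2 * Real.pi / β * psi β m (ξ / β) ^ 2 := by
  obtain hm | hm := lt_or_ge m 0
  · simp [psi_of_neg β hm, ft]
  · obtain ⟨n, rfl⟩ := Int.eq_ofNat_of_zero_le hm
    have hpi := Real.pi_pos
    rw [ft_psi hβ, norm_mul, norm_pow, norm_neg, Complex.norm_I, one_pow, one_mul, Complex.norm_real,
      Real.norm_eq_abs, sq_abs, mul_pow, Real.sq_sqrt (by positivity)]

end Fourier

/-! ### Moments of the Hermite functions -/

section Moments

variable {β : ℝ}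

theorem integrable_moment (hβ : 0 < β) (j : ℕ) (m : ℤ) :
    Integrable fun x => (x ^ j * psi β m x) ^ 2 := by
  have h := (gaussDecay_psi hβ m).pow_mul j
  simpa [pow_two] using (h.mul h).integrable

/-- Each factor x replaces ψ_m by its two neighbours with coefficients of size √(1 + |m|). The shift
of the index is paid for by 1 + |m ± 1| ≤ 2(1 + |m|), whence the powers of 2. -/
theorem exists_moment_bound (hβ : 0 < β) (j : ℕ) :
    ∃ C, 0 < C ∧ ∀ m : ℤ, ∫ x, (x ^ j * psi β m x) ^ 2 ≤ C * (1 + |(m : ℝ)|) ^ j := by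
  induction j with
  | zero =>
    refine ⟨1, one_pos, fun m => ?_⟩
    simp only [pow_zero, one_mul, pow_two, integral_psi_mul_psi hβ]
    split_ifs <;> simp
  | succ j ih =>
    obtain ⟨C, hC, h⟩ := ih
    refine ⟨4 / β * (C * 2 ^ j), by positivity, fun m => ?_⟩
    have habs := abs_nonneg (m : ℝ)
    have l1 : lad β m ^ 2 ≤ β * (1 + |(m : ℝ)|) := by
      calc lad β m ^ 2 ≤ (√β * √(1 + |(m : ℝ)|)) ^ 2 :=
            pow_le_pow_left₀ (lad_nonneg _ _) (lad_le hβ m) 2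
        _ = _ := by rw [mul_pow, Real.sq_sqrt hβ.le, Real.sq_sqrt (by positivity)]
    have l2 : lad β (m + 1) ^ 2 ≤ β * (1 + |(m : ℝ)|) := by
      calc lad β (m + 1) ^ 2 ≤ (√β * √(1 + |(m : ℝ)|)) ^ 2 :=
            pow_le_pow_left₀ (lad_nonneg _ _) (lad_succ_le hβ m) 2
        _ = _ := by rw [mul_pow, Real.sq_sqrt hβ.le, Real.sq_sqrt (by positivity)]
    have key (n : ℤ) (hn : |n| ≤ |m| + 1) :
        ∫ x, (x ^ j * psi β n x) ^ 2 ≤ C * (2 ^ j * (1 + |(m : ℝ)|) ^ j) := by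
      have h' : |(n : ℝ)| ≤ |(m : ℝ)| + 1 := by exact_mod_cast hn
      refine (h n).trans ?_
      rw [← mul_pow]
      gcongr
      linarith
    have hi := fun n => integrable_moment hβ j n
    have pw (x : ℝ) : (x ^ (j + 1) * psi β m x) ^ 2 ≤ 2 / β * (1 + |(m : ℝ)|) *
        ((x ^ j * psi β (m - 1) x) ^ 2 + (x ^ j * psi β (m + 1) x) ^ 2) := by
      have hm := mul_psi hβ m x
      have e : (x ^ (j + 1) * psi β m x) ^ 2 = (1 / β ^ 2) *
          (lad β m * (x ^ j * psi β (m - 1) x) + lad β (m + 1) * (x ^ j * psi β (m + 1) x)) ^ 2 := by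
        rw [show lad β m * (x ^ j * psi β (m - 1) x) + lad β (m + 1) * (x ^ j * psi β (m + 1) x) =
          x ^ j * (β * x * psi β m x) by rw [hm]; ring]
        field_simp
        ring
      rw [e]
      calc _ ≤ (1 / β ^ 2) * (2 * ((lad β m * (x ^ j * psi β (m - 1) x)) ^ 2 +
            (lad β (m + 1) * (x ^ j * psi β (m + 1) x)) ^ 2)) := by gcongr; exact add_sq_le
        _ = (1 / β ^ 2) * (2 * (lad β m ^ 2 * (x ^ j * psi β (m - 1) x) ^ 2 +
            lad β (m + 1) ^ 2 * (x ^ j * psi β (m + 1) x) ^ 2)) := by ring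
        _ ≤ (1 / β ^ 2) * (2 * (β * (1 + |(m : ℝ)|) * (x ^ j * psi β (m - 1) x) ^ 2 +
            β * (1 + |(m : ℝ)|) * (x ^ j * psi β (m + 1) x) ^ 2)) := by gcongr
        _ = _ := by field_simp
    calc ∫ x, (x ^ (j + 1) * psi β m x) ^ 2 ≤ ∫ x, 2 / β * (1 + |(m : ℝ)|) *
          ((x ^ j * psi β (m - 1) x) ^ 2 + (x ^ j * psi β (m + 1) x) ^ 2) :=
          integral_mono (integrable_moment hβ _ m) (((hi _).add (hi _)).const_mul _) pw
      _ = 2 / β * (1 + |(m : ℝ)|) * ((∫ x, (x ^ j * psi β (m - 1) x) ^ 2) +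
          ∫ x, (x ^ j * psi β (m + 1) x) ^ 2) := by
          rw [integral_const_mul, integral_add (hi _) (hi _)]
      _ ≤ 2 / β * (1 + |(m : ℝ)|) * (C * (2 ^ j * (1 + |(m : ℝ)|) ^ j) +
          C * (2 ^ j * (1 + |(m : ℝ)|) ^ j)) := by
          gcongr
          · exact key _ (abs_sub_one_le m)
          · exact key _ (abs_add_one_le m)
      _ = _ := by rw [pow_succ (1 + |(m : ℝ)|) j]; ring

theorem integral_add_add {α : Type*} [MeasurableSpace α] {μ : Measure α} {f g h : α → ℝ}
    (hf : Integrable f μ) (hg : Integrable g μ) (hh : Integrable h μ) :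
    ∫ x, (f x + g x + h x) ∂μ = ∫ x, f x ∂μ + ∫ x, g x ∂μ + ∫ x, h x ∂μ := by
  rw [integral_add (f := fun x => f x + g x) (hf.add hg) hh, integral_add hf hg]

/-- An exact value, not merely an upper bound: the lower bounds of every real order s rest on it. -/
theorem integral_sq_mul_psi_sq (hβ : 0 < β) {m : ℤ} (hm : 0 ≤ m) :
    ∫ x, (β * x * psi β m x) ^ 2 = β * (m + 1 / 2) := by
  have hd := fun i => gaussDecay_psi hβ i
  have h (x : ℝ) : (β * x * psi β m x) ^ 2 = lad β m ^ 2 * (psi β (m - 1) x * psi β (m - 1) x) +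
      2 * lad β m * lad β (m + 1) * (psi β (m - 1) x * psi β (m + 1) x) +
      lad β (m + 1) ^ 2 * (psi β (m + 1) x * psi β (m + 1) x) := by
    rw [mul_psi hβ]; ring
  have hi := fun i j => ((hd i).mul (hd j)).integrable
  simp_rw [h]
  rw [integral_add_add ((hi _ _).const_mul _) ((hi _ _).const_mul _) ((hi _ _).const_mul _),
    integral_const_mul,
    integral_const_mul, integral_const_mul, integral_psi_mul_psi hβ, integral_psi_mul_psi hβ,
    integral_psi_mul_psi hβ, if_neg (by omega : ¬(m - 1 = m + 1 ∧ 0 ≤ m - 1)),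
    if_pos (by omega : m + 1 = m + 1 ∧ 0 ≤ m + 1), lad_sq hβ hm, lad_sq hβ (by omega)]
  rcases hm.eq_or_lt with rfl | hm'
  · simp; ring
  · rw [if_pos (by omega)]
    push_cast
    ring

/-- The weight of the Sobolev norms in the Fourier variables, rescaled. -/
noncomputable def wt (β κ x : ℝ) : ℝ := 1 + β ^ 2 * x ^ 2 + κ

theorem wt_pos {κ : ℝ} (hκ : 0 ≤ κ) (x : ℝ) : 0 < wt β κ x := by
  unfold wt; positivity

theorem wt_pow_le {κ : ℝ} (hκ : 0 ≤ κ) (j : ℕ) (x : ℝ) :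
    wt β κ x ^ j ≤ 2 ^ j * ((1 + κ) ^ j + β ^ (2 * j) * (x ^ j) ^ 2) := by
  have h : wt β κ x ≤ 2 * max (1 + κ) (β ^ 2 * x ^ 2) := by
    rw [wt, two_mul]
    linarith [le_max_left (1 + κ) (β ^ 2 * x ^ 2), le_max_right (1 + κ) (β ^ 2 * x ^ 2)]
  calc wt β κ x ^ j ≤ (2 * max (1 + κ) (β ^ 2 * x ^ 2)) ^ j :=
        pow_le_pow_left₀ (wt_pos hκ x).le h j
    _ = 2 ^ j * max (1 + κ) (β ^ 2 * x ^ 2) ^ j := mul_pow _ _ _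
    _ ≤ 2 ^ j * ((1 + κ) ^ j + (β ^ 2 * x ^ 2) ^ j) := by
        gcongr
        rcases max_cases (1 + κ) (β ^ 2 * x ^ 2) with h | h <;> rw [h.1]
        · exact le_add_of_nonneg_right (by positivity)
        · exact le_add_of_nonneg_left (by positivity)
    _ = _ := by rw [mul_pow, ← pow_mul, ← pow_mul, ← pow_mul, mul_comm 2 j]

theorem continuous_wt (β κ : ℝ) : Continuous (wt β κ) := by
  unfold wt; fun_prop

theorem integrable_wt_rpow (hβ : 0 < β) {κ s : ℝ} (hκ : 0 ≤ κ) (hs : 0 ≤ s) (m : ℤ) :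
    Integrable fun x => wt β κ x ^ s * psi β m x ^ 2 := by
  have hi (j : ℕ) : Integrable fun x => 2 ^ j * ((1 + κ) ^ j * psi β m x ^ 2 +
      β ^ (2 * j) * (x ^ j * psi β m x) ^ 2) := by
    have h0 := integrable_moment hβ 0 m
    simp only [pow_zero, one_mul] at h0
    exact ((h0.const_mul _).add ((integrable_moment hβ j m).const_mul _)).const_mul _
  refine (hi ⌈s⌉₊).mono' (Continuous.aestronglyMeasurable ?_) (Eventually.of_forall fun x => ?_)
  · exact ((continuous_wt β κ).rpow_const fun x => Or.inr hs).mul ((continuous_psi hβ m).pow 2)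
  · have h1 : 1 ≤ wt β κ x := by unfold wt; nlinarith [sq_nonneg (β * x)]
    rw [Real.norm_of_nonneg (by have := wt_pos (β := β) hκ x; positivity)]
    calc wt β κ x ^ s * psi β m x ^ 2 ≤ wt β κ x ^ ⌈s⌉₊ * psi β m x ^ 2 := by
          gcongr
          rw [← Real.rpow_natCast]
          exact Real.rpow_le_rpow_of_exponent_le h1 (Nat.le_ceil s)
      _ ≤ (2 ^ ⌈s⌉₊ * ((1 + κ) ^ ⌈s⌉₊ + β ^ (2 * ⌈s⌉₊) * (x ^ ⌈s⌉₊) ^ 2)) * psi β m x ^ 2 := by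
          gcongr
          exact wt_pow_le hκ _ x
      _ = _ := by ring

theorem exists_wt_pow_bound (hβ : 0 < β) (j : ℕ) : ∃ K, 1 ≤ K ∧ ∀ (m : ℤ) (κ : ℝ), 0 ≤ m → 0 ≤ κ →
    ∫ x, wt β κ x ^ j * psi β m x ^ 2 ≤ K * (1 + κ + m) ^ j := by
  obtain ⟨C, hC, h⟩ := exists_moment_bound hβ j
  refine ⟨2 ^ j * (1 + β ^ (2 * j) * C), ?_, fun m κ hm hκ => ?_⟩
  · have : (1 : ℝ) ≤ 2 ^ j := one_le_pow₀ (by norm_num)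
    have : 0 ≤ β ^ (2 * j) * C := by positivity
    nlinarith
  have hm' : (0 : ℝ) ≤ m := by exact_mod_cast hm
  have i0 := integrable_moment hβ 0 m
  simp only [pow_zero, one_mul] at i0
  have ij := integrable_moment hβ j m
  have hw := integrable_wt_rpow hβ hκ (Nat.cast_nonneg j) m
  simp only [Real.rpow_natCast] at hw
  have n0 : ∫ x, psi β m x ^ 2 = 1 := by
    simp_rw [pow_two]
    rw [integral_psi_mul_psi hβ, if_pos ⟨rfl, hm⟩]
  calc ∫ x, wt β κ x ^ j * psi β m x ^ 2 ≤ ∫ x, 2 ^ j * ((1 + κ) ^ j * psi β m x ^ 2 +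
        β ^ (2 * j) * (x ^ j * psi β m x) ^ 2) := by
        refine integral_mono hw (((i0.const_mul _).add (ij.const_mul _)).const_mul _) fun x => ?_
        have := mul_le_mul_of_nonneg_right (wt_pow_le (β := β) hκ j x) (sq_nonneg (psi β m x))
        refine this.trans (le_of_eq ?_)
        ring
    _ = 2 ^ j * ((1 + κ) ^ j + β ^ (2 * j) * ∫ x, (x ^ j * psi β m x) ^ 2) := by
        rw [integral_const_mul, integral_add (i0.const_mul _) (ij.const_mul _), integral_const_mul,
          integral_const_mul, n0, mul_one]
    _ ≤ 2 ^ j * ((1 + κ + m) ^ j + β ^ (2 * j) * (C * (1 + κ + m) ^ j)) := by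
        have hj : (∫ x, (x ^ j * psi β m x) ^ 2) ≤ C * (1 + κ + m) ^ j := by
          refine (h m).trans ?_
          rw [abs_of_nonneg hm']
          gcongr
          linarith
        have hj' : (1 + κ) ^ j ≤ (1 + κ + m) ^ j := 
          pow_le_pow_left₀ (by positivity) (by linarith) j
        refine mul_le_mul_of_nonneg_left (add_le_add hj' ?_) (by positivity)
        exact mul_le_mul_of_nonneg_left hj (by positivity)
    _ = _ := by ring

/-- Two-sided bounds for the moments of real order of the Hermite functions. -/
theorem exists_wt_rpow_bounds (hβ : 0 < β) {s : ℝ} (hs : 0 ≤ s) :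
    ∃ C, 0 < C ∧ ∀ (m : ℤ) (κ : ℝ), 0 ≤ m → 0 ≤ κ →
      C⁻¹ * (1 + κ + m) ^ s ≤ ∫ x, wt β κ x ^ s * psi β m x ^ 2 ∧
      ∫ x, wt β κ x ^ s * psi β m x ^ 2 ≤ C * (1 + κ + m) ^ s := by
  obtain ⟨K, hK, hKb⟩ := exists_wt_pow_bound hβ ⌈s⌉₊
  obtain ⟨K', hK', hKb'⟩ := exists_wt_pow_bound hβ 2
  have key : ∃ D, 0 < D ∧ ∀ (m : ℤ) (κ : ℝ), 0 ≤ m → 0 ≤ κ →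
      (1 + κ + m) ^ s ≤ D * ∫ x, wt β κ x ^ s * psi β m x ^ 2 := by
    set c := min 1 β with hc
    have hc0 : 0 < c := lt_min one_pos hβ
    set E := 4 * K' / c * (4 / c) ^ s with hE
    have hE0 : 0 < E := by positivity
    refine ⟨2 * E / c, by positivity, fun m κ hm hκ => ?_⟩
    have hm' : (0 : ℝ) ≤ m := by exact_mod_cast hm
    set N := 1 + κ + (m : ℝ) with hN
    have hN0 : 0 < N := by positivity
    have n0 : ∫ x, psi β m x ^ 2 = 1 := by
      simp_rw [pow_two]
      rw [integral_psi_mul_psi hβ, if_pos ⟨rfl, hm⟩]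
    have i0 := integrable_moment hβ 0 m
    simp only [pow_zero, one_mul] at i0
    have i1 := integrable_wt_rpow hβ hκ zero_le_one m
    simp only [Real.rpow_one] at i1
    have i2 := integrable_wt_rpow hβ hκ (Nat.cast_nonneg 2) m
    simp only [Real.rpow_natCast] at i2
    have is := integrable_wt_rpow hβ hκ hs m
    have lower : c * N ≤ ∫ x, wt β κ x * psi β m x ^ 2 := by
      have e (x : ℝ) : wt β κ x * psi β m x ^ 2 = (1 + κ) * psi β m x ^ 2 + (β * x * psi β m x) ^ 2 := by
        unfold wt; ring
      have i3 : Integrable fun x => (β * x * psi β m x) ^ 2 := by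
        have := (integrable_moment hβ 1 m).const_mul (β ^ 2)
        refine this.congr (Eventually.of_forall fun x => ?_)
        simp only
        ring
      simp_rw [e]
      rw [integral_add (i0.const_mul _) i3, integral_const_mul, n0,
        integral_sq_mul_psi_sq hβ hm, hN]
      have h1 : c ≤ 1 := min_le_left _ _
      have h2 : c ≤ β := min_le_right _ _
      nlinarith
    -- Interpolation by hand: the three terms dominate t for small, large and intermediate t
    -- respectively. With t = wt/N, integration against ψ_m² gives cN on the left by `lower` and at
    -- most cN/4 from each of the first two terms on the right. Thus cN/2 is left for the moment of
    -- order s.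
    have pw (t : ℝ) (ht : 0 < t) : t ≤ c / 4 + c / (4 * K') * t ^ 2 + E * t ^ s := by
      have hts : 0 ≤ E * t ^ s := by positivity
      have ht2 : 0 ≤ c / (4 * K') * t ^ 2 := by positivity
      rcases le_total t (c / 4) with h | h
      · linarith
      rcases le_total t (4 * K' / c) with h' | h'
      · have h1 : 1 ≤ (4 / c) ^ s * t ^ s := by
          rw [← Real.mul_rpow (by positivity) ht.le]
          apply Real.one_le_rpow _ hs
          rw [div_mul_eq_mul_div, le_div_iff₀ hc0]
          linarith
        have h2 : t ≤ E * t ^ s := by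
          calc t ≤ 4 * K' / c * 1 := by simpa using h'
            _ ≤ 4 * K' / c * ((4 / c) ^ s * t ^ s) := by gcongr
            _ = _ := by rw [hE]; ring
        linarith
      · have h1 : t ≤ c / (4 * K') * t ^ 2 := by
          have : 1 ≤ c / (4 * K') * t := by
            rw [div_mul_eq_mul_div, le_div_iff₀ (by positivity)]
            rw [div_le_iff₀ hc0] at h'
            linarith
          nlinarith
        linarith
    have pw2 (x : ℝ) : wt β κ x * psi β m x ^ 2 ≤ c / 4 * N * psi β m x ^ 2 +
        c / (4 * K') / N * (wt β κ x ^ 2 * psi β m x ^ 2) +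
        E * N / N ^ s * (wt β κ x ^ s * psi β m x ^ 2) := by
      have hw := wt_pos (β := β) hκ x
      have h := pw (wt β κ x / N) (by positivity)
      rw [Real.div_rpow hw.le hN0.le] at h
      have h' := mul_le_mul_of_nonneg_right (mul_le_mul_of_nonneg_left h hN0.le)
        (sq_nonneg (psi β m x))
      have hNs : 0 < N ^ s := by positivity
      calc _ = N * (wt β κ x / N) * psi β m x ^ 2 := by field_simp
        _ ≤ _ := h'
        _ = _ := by field_simp
    have int := integral_mono i1 (((i0.const_mul (c / 4 * N)).add
      (i2.const_mul (c / (4 * K') / N))).add (is.const_mul (E * N / N ^ s))) pw2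
    simp only [Pi.add_apply] at int
    rw [integral_add_add (i0.const_mul _) (i2.const_mul _) (is.const_mul _), integral_const_mul,
      integral_const_mul,
      integral_const_mul, n0] at int
    have u2 := hKb' m κ hm hκ
    rw [← hN] at u2
    have u3 : c / (4 * K') / N * ∫ x, wt β κ x ^ 2 * psi β m x ^ 2 ≤ c / 4 * N := by
      calc _ ≤ c / (4 * K') / N * (K' * N ^ 2) := by gcongr
        _ = _ := by field_simp
    have u4 : c / 2 * N ≤ E * N / N ^ s * ∫ x, wt β κ x ^ s * psi β m x ^ 2 := by linarith
    have hNs : 0 < N ^ s := by positivity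
    have u5 := mul_le_mul_of_nonneg_left u4 (show 0 ≤ 2 * N ^ s / (c * N) by positivity)
    calc N ^ s = 2 * N ^ s / (c * N) * (c / 2 * N) := by field_simp
      _ ≤ _ := u5
      _ = _ := by field_simp
  obtain ⟨D, hD, hDb⟩ := key
  refine ⟨max D (1 + K), lt_max_of_lt_left hD, fun m κ hm hκ => ⟨?_, ?_⟩⟩
  · have hm' : (0 : ℝ) ≤ m := by exact_mod_cast hm
    have h0 : 0 ≤ ∫ x, wt β κ x ^ s * psi β m x ^ 2 :=
      integral_nonneg fun x => by have := wt_pos (β := β) hκ x; positivity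
    rw [inv_mul_le_iff₀ (lt_max_of_lt_left hD)]
    refine (hDb m κ hm hκ).trans ?_
    gcongr
    exact le_max_left _ _
  · have hm' : (0 : ℝ) ≤ m := by exact_mod_cast hm
    set N := 1 + κ + (m : ℝ) with hN
    have hN0 : 0 < N := by positivity
    have n0 : ∫ x, psi β m x ^ 2 = 1 := by
      simp_rw [pow_two]
      rw [integral_psi_mul_psi hβ, if_pos ⟨rfl, hm⟩]
    have i0 := integrable_moment hβ 0 m
    simp only [pow_zero, one_mul] at i0
    have ij := integrable_wt_rpow hβ hκ (Nat.cast_nonneg ⌈s⌉₊) m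
    simp only [Real.rpow_natCast] at ij
    have is := integrable_wt_rpow hβ hκ hs m
    -- The real exponent lies between 0 and an integer. Applying this to wt/N makes the resulting
    -- bound homogeneous in N.
    have pw (t : ℝ) (ht : 0 < t) : t ^ s ≤ 1 + t ^ ⌈s⌉₊ := by
      rcases le_total t 1 with h | h
      · have := Real.rpow_le_one ht.le h hs
        have : 0 ≤ t ^ ⌈s⌉₊ := by positivity
        linarith
      · have := Real.rpow_le_rpow_of_exponent_le h (Nat.le_ceil s)
        rw [Real.rpow_natCast] at this
        linarith
    have pw2 (x : ℝ) : wt β κ x ^ s * psi β m x ^ 2 ≤ N ^ s * psi β m x ^ 2 +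
        N ^ s / N ^ ⌈s⌉₊ * (wt β κ x ^ ⌈s⌉₊ * psi β m x ^ 2) := by
      have hw := wt_pos (β := β) hκ x
      have h := pw (wt β κ x / N) (by positivity)
      rw [Real.div_rpow hw.le hN0.le, div_pow] at h
      have hNs : 0 < N ^ s := by positivity
      have h' := mul_le_mul_of_nonneg_right (mul_le_mul_of_nonneg_left h hNs.le)
        (sq_nonneg (psi β m x))
      calc _ = N ^ s * (wt β κ x ^ s / N ^ s) * psi β m x ^ 2 := by field_simp
        _ ≤ _ := h'
        _ = _ := by ring
    have int := integral_mono is ((i0.const_mul (N ^ s)).add (ij.const_mul (N ^ s / N ^ ⌈s⌉₊))) pw2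
    simp only [Pi.add_apply] at int
    rw [integral_add (i0.const_mul _) (ij.const_mul _), integral_const_mul, integral_const_mul,
      n0] at int
    have u := hKb m κ hm hκ
    rw [← hN] at u
    calc _ ≤ _ := int
      _ ≤ N ^ s * 1 + N ^ s / N ^ ⌈s⌉₊ * (K * N ^ ⌈s⌉₊) := by gcongr
      _ = (1 + K) * N ^ s := by field_simp
      _ ≤ _ := by gcongr; exact le_max_right _ _

end Moments

end EquatorialWaves

namespace EquatorialWaves

/-! ### Completeness of the Hermite functions and of their products with the characters -/

section Completeness

open scoped FourierTransform SchwartzMap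

/-- The Fourier transform is injective on integrable functions. -/
theorem ae_eq_zero_of_ft_eq_zero {f : ℝ → ℂ} (hf : Integrable f) (h : ∀ ξ, ft f ξ = 0) :
    f =ᵐ[volume] 0 := by
  have hF : (𝓕 f : ℝ → ℂ) = 0 := by
    funext w
    rw [Real.fourier_real_eq_integral_exp_smul, Pi.zero_apply, ← h (2 * Real.pi * w), ft]
    refine integral_congr_ae (Eventually.of_forall fun x => ?_)
    simp only [smul_eq_mul]
    congr 2
    push_cast
    ring
  refine ae_eq_zero_of_integral_contDiff_smul_eq_zero hf.locallyIntegrable fun g hg hc => ?_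
  have hg₁ : HasCompactSupport (Complex.ofRealCLM ∘ g) := hc.comp_left rfl
  have hg₂ : ContDiff ℝ ∞ (Complex.ofRealCLM ∘ g) := by fun_prop
  -- The test function is the Fourier transform of the Schwartz function 𝓕⁻G. The transform can then
  -- be moved onto f, where it vanishes.
  let G : 𝓢(ℝ, ℂ) := hg₁.toSchwartzMap hg₂
  have hG : (𝓕 (𝓕⁻ G) : 𝓢(ℝ, ℂ)) = G := FourierTransform.fourier_fourierInv_eq G
  have key := VectorFourier.integral_fourierIntegral_smul_eq_flip (μ := volume) (ν := volume)
    (L := innerₗ ℝ) (f := (𝓕⁻ G : 𝓢(ℝ, ℂ))) (g := f) Real.continuous_fourierChar continuous_inner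
    (SchwartzMap.integrable _) hf
  rw [flip_innerₗ] at key
  have e1 : VectorFourier.fourierIntegral Real.fourierChar volume (innerₗ ℝ) f = 0 := hF
  have e2 : VectorFourier.fourierIntegral Real.fourierChar volume (innerₗ ℝ) (𝓕⁻ G : 𝓢(ℝ, ℂ)) =
      (G : ℝ → ℂ) := by
    rw [← hG, SchwartzMap.fourier_coe]
    rw [hG]
    rfl
  rw [e1, e2] at key
  simp only [Pi.zero_apply, smul_zero, integral_zero] at key
  rw [← key]
  refine integral_congr_ae (Eventually.of_forall fun x => ?_)
  simp [G]

variable {β : ℝ}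

/-- Multiplication by x preserves the span of the Hermite functions. Integer indices spare a case
distinction at ψ_0. -/
theorem integral_pow_mul_psi_mul_eq_zero (hβ : 0 < β) {f : ℝ → ℂ}
    (hf : ∀ g : ℝ → ℝ, GaussDecay g → Integrable fun x => (g x : ℂ) * f x)
    (h : ∀ n : ℕ, ∫ x, (psi β n x : ℂ) * f x = 0) (j : ℕ) (m : ℤ) :
    ∫ x, ((x ^ j * psi β m x : ℝ) : ℂ) * f x = 0 := by
  induction j generalizing m with
  | zero =>
    obtain hm | hm := lt_or_ge m 0
    · simp [psi_of_neg β hm]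
    · obtain ⟨n, rfl⟩ := Int.eq_ofNat_of_zero_le hm
      simpa using h n
  | succ j ih =>
    have e (x : ℝ) : ((x ^ (j + 1) * psi β m x : ℝ) : ℂ) * f x =
        (lad β m / β : ℝ) * (((x ^ j * psi β (m - 1) x : ℝ) : ℂ) * f x) +
        (lad β (m + 1) / β : ℝ) * (((x ^ j * psi β (m + 1) x : ℝ) : ℂ) * f x) := by
      have : x ^ (j + 1) * psi β m x = lad β m / β * (x ^ j * psi β (m - 1) x) +
          lad β (m + 1) / β * (x ^ j * psi β (m + 1) x) := by
        have := mul_psi hβ m x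
        field_simp
        linear_combination x ^ j * this
      rw [this]; push_cast; ring
    have hi := fun n => hf _ ((gaussDecay_psi hβ n).pow_mul j)
    simp_rw [e]
    rw [integral_add ((hi _).const_mul _) ((hi _).const_mul _), integral_const_mul,
      integral_const_mul, ih, ih]
    simp

/-- The Hermite functions are total. -/
theorem ae_eq_zero_of_integral_psi_mul (hβ : 0 < β) {f : ℝ → ℂ}
    (hf : ∀ g : ℝ → ℝ, GaussDecay g → Integrable fun x => (g x : ℂ) * f x)
    (h : ∀ n : ℕ, ∫ x, (psi β n x : ℂ) * f x = 0) : f =ᵐ[volume] 0 := by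
  have hd := gaussDecay_psi hβ 0
  have hF := hf _ hd
  have h0 : (fun x => (psi β 0 x : ℂ) * f x) =ᵐ[volume] 0 := by
    refine ae_eq_zero_of_ft_eq_zero hF fun ξ => ?_
    -- The character is expanded in powers of x, so that the transform becomes a series of moments.
    -- The dominating function e^{|ξ||x|} |ψ_0 f| is integrable because e^{|ξ||x|} ψ_0 still has
    -- Gaussian decay.
    have hs := hasSum_integral_of_dominated_convergence (μ := volume)
      (F := fun (j : ℕ) (x : ℝ) => (-(Complex.I * ξ * x)) ^ j / (j.factorial : ℂ) *
        ((psi β 0 x : ℂ) * f x))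
      (f := fun x : ℝ => Complex.exp (-(Complex.I * ξ * x)) * ((psi β 0 x : ℂ) * f x))
      (fun (j : ℕ) (x : ℝ) => (|ξ| * |x|) ^ j / j.factorial * ‖(psi β 0 x : ℂ) * f x‖)
      (fun j => (Continuous.aestronglyMeasurable (by fun_prop)).mul hF.aestronglyMeasurable)
      (fun j => Eventually.of_forall fun x => by
        rw [norm_mul, norm_div, norm_pow, norm_neg, norm_mul, norm_mul, Complex.norm_I, one_mul,
          Complex.norm_real, Complex.norm_real, Complex.norm_natCast]
        rfl)
      (Eventually.of_forall fun x => (Real.summable_pow_div_factorial _).mul_right _)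
      (by
        have hi := (hf _ (hd.exp_smul |ξ|)).norm
        refine hi.congr (Eventually.of_forall fun x => ?_)
        simp only [tsum_mul_right]
        rw [← (NormedSpace.expSeries_div_hasSum_exp (𝔸 := ℝ) (|ξ| * |x|)).tsum_eq.symm,
          ← Real.exp_eq_exp_ℝ]
        simp only [smul_eq_mul, Complex.ofReal_mul, norm_mul, Complex.norm_real,
          Real.norm_of_nonneg (Real.exp_pos _).le]
        ring)
      (Eventually.of_forall fun x => by
        have := NormedSpace.expSeries_div_hasSum_exp (𝔸 := ℂ) (-(Complex.I * ξ * x))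
        rw [← Complex.exp_eq_exp_ℂ] at this
        exact this.mul_right _)
    have hz (j : ℕ) : ∫ x : ℝ, (-(Complex.I * ξ * x)) ^ j / (j.factorial : ℂ) *
        ((psi β 0 x : ℂ) * f x) = 0 := by
      have e (x : ℝ) : (-(Complex.I * ξ * x)) ^ j / (j.factorial : ℂ) * ((psi β 0 x : ℂ) * f x) =
          (-(Complex.I * ξ)) ^ j / (j.factorial : ℂ) * (((x ^ j * psi β 0 x : ℝ) : ℂ) * f x) := by
        rw [show -(Complex.I * ξ * x) = -(Complex.I * ξ) * x by ring, mul_pow]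
        push_cast
        ring
      simp_rw [e]
      rw [integral_const_mul, integral_pow_mul_psi_mul_eq_zero hβ hf h, mul_zero]
    simp_rw [hz] at hs
    exact hs.unique hasSum_zero
  filter_upwards [h0] with x hx
  have hp : psi β 0 x ≠ 0 := by
    have hpi := Real.pi_pos
    rw [psi_zero_eq]; positivity
  have hx' : (psi β 0 x : ℂ) * f x = 0 := hx
  exact (mul_eq_zero.mp hx').resolve_left (by exact_mod_cast hp)

/-- The characters of the circle are total. -/
theorem ae_eq_zero_of_integral_fourier_mul {g : Torus → ℂ} (hg : MemLp g 2)
    (h : ∀ k : ℤ, ∫ x, fourier (-k) x * g x = 0) : g =ᵐ[volume] 0 := by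
  have hg' : MemLp g 2 (AddCircle.haarAddCircle (T := 2 * Real.pi)) :=
    memLp_haarAddCircle_iff.mpr hg
  have h0 : fourierBasis.repr (hg'.toLp g) = 0 := by
    ext k
    rw [fourierBasis_repr, fourierCoeff_congr_ae hg'.coeFn_toLp, fourierCoeff,
      AddCircle.integral_haarAddCircle]
    simp only [smul_eq_mul]
    rw [h k]
    simp
  have h1 : hg'.toLp g = 0 := by simpa using h0
  have h2 : g =ᵐ[AddCircle.haarAddCircle (T := 2 * Real.pi)] 0 := by
    have h2 := hg'.coeFn_toLp
    rw [h1] at h2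
    exact h2.symm.trans (Lp.coeFn_zero _ _ _)
  rw [AddCircle.volume_eq_smul_haarAddCircle]
  exact Measure.ae_smul_measure h2 _

theorem integrable_of_memLp_prod {g : ℝ → ℂ} (hg : GaussDecay g) (k : ℤ) :
    MemLp (fun x : Dom => g x.1 * fourier k x.2) 2 := by
  have hc : Continuous fun x : Dom => g x.1 * fourier k x.2 :=
    (hg.1.comp continuous_fst).mul ((map_continuous (fourier k)).comp continuous_snd)
  rw [memLp_two_iff_integrable_sq_norm hc.aestronglyMeasurable]
  have h1 : Integrable fun x : ℝ => ‖g x‖ ^ 2 :=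
    (memLp_two_iff_integrable_sq_norm hg.1.aestronglyMeasurable).mp hg.memLp_two
  have h2 : Integrable (fun _ : Torus => (1 : ℝ)) := integrable_const _
  refine (h1.mul_prod h2).congr (Eventually.of_forall fun x => ?_)
  simp only [norm_mul, mul_one, fourier_apply, Circle.norm_coe]

/-- The products of Hermite functions and characters are total in `L²(ℝ × 𝕋)`. -/
theorem ae_eq_zero_of_integral_psi_fourier_mul (hβ : 0 < β) {f : Dom → ℂ} (hf : MemLp f 2)
    (h : ∀ (n : ℕ) (k : ℤ), ∫ x : Dom, psi β n x.1 * fourier (-k) x.2 * f x = 0) :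
    f =ᵐ[volume] 0 := by
  have hI (g : ℝ → ℝ) (hg : GaussDecay g) (k : ℤ) :
      Integrable (fun x : Dom => (g x.1 : ℂ) * fourier (-k) x.2 * f x)
        ((volume : Measure ℝ).prod (volume : Measure Torus)) :=
    (integrable_of_memLp_prod hg.ofReal (-k)).integrable_mul hf
  have hk (k : ℤ) : ∀ᵐ x₁ : ℝ, ∫ x₂ : Torus, fourier (-k) x₂ * f (x₁, x₂) = 0 := by
    -- Totality in x₁ only requires integrability against functions of Gaussian decay. For the
    -- partial Fourier coefficients of f this is immediate from Fubini.
    refine ae_eq_zero_of_integral_psi_mul hβ (f := fun x₁ => ∫ x₂ : Torus,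
      fourier (-k) x₂ * f (x₁, x₂)) (fun g hg => ?_) fun n => ?_
    · refine (hI g hg k).integral_prod_left.congr (Eventually.of_forall fun x₁ => ?_)
      simp only [mul_assoc]
      rw [integral_const_mul]
    · rw [← h n k]
      have := integral_prod _ (hI _ (gaussDecay_psi hβ n) k)
      refine Eq.trans ?_ this.symm
      refine integral_congr_ae (Eventually.of_forall fun x₁ => ?_)
      simp only [mul_assoc]
      rw [integral_const_mul]
  have hfm : AEStronglyMeasurable f ((volume : Measure ℝ).prod (volume : Measure Torus)) := hf.1
  have hsq : Integrable (fun x => ‖f x‖ ^ 2) ((volume : Measure ℝ).prod (volume : Measure Torus)) :=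
    (memLp_two_iff_integrable_sq_norm hf.1).mp hf
  have h3 : ∀ᵐ x₁ : ℝ, ∀ᵐ x₂ : Torus, f (x₁, x₂) = 0 := by
    filter_upwards [ae_all_iff.mpr hk, hfm.prodMk_left, hsq.prod_right_ae] with x₁ h1 h2 h3
    exact ae_eq_zero_of_integral_fourier_mul ((memLp_two_iff_integrable_sq_norm h2).mpr h3) h1
  have h4 : ∫ x : Dom, ‖f x‖ ^ 2 = 0 := by
    refine (integral_prod _ hsq).trans (integral_eq_zero_of_ae ?_)
    filter_upwards [h3] with x₁ h1
    refine integral_eq_zero_of_ae ?_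
    filter_upwards [h1] with x₂ h2
    simp [h2]
  have h5 := (integral_eq_zero_iff_of_nonneg (fun x => by positivity) hsq).mp h4
  filter_upwards [h5] with x hx
  simpa using hx

end Completeness

end EquatorialWaves

namespace EquatorialWaves

/-! ### The dispersion relation -/

section Dispersion

variable {β : ℝ}

theorem eval_dispersionPoly (β : ℝ) (n : ℕ) (k : ℤ) (x : ℝ) : (dispersionPoly β n k).eval x =
    x ^ 3 - ((k : ℝ) ^ 2 + β * (2 * n + 1)) * x - β * k := by
  simp [dispersionPoly]

theorem natDegree_dispersionPoly (β : ℝ) (n : ℕ) (k : ℤ) : (dispersionPoly β n k).natDegree = 3 := by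
  unfold dispersionPoly
  compute_degree!

/-- The positive critical point of the dispersion polynomial. -/
noncomputable def critPt (β : ℝ) (n : ℕ) (k : ℤ) : ℝ := √(((k : ℝ) ^ 2 + β * (2 * n + 1)) / 3)

theorem critPt_pos (hβ : 0 < β) (n : ℕ) (k : ℤ) : 0 < critPt β n k := by
  unfold critPt; positivity

theorem critPt_sq (hβ : 0 < β) (n : ℕ) (k : ℤ) :
    3 * critPt β n k ^ 2 = (k : ℝ) ^ 2 + β * (2 * n + 1) := by
  rw [critPt, Real.sq_sqrt (by positivity)]; ring

/-- With r = `critPt β n k`, the cubic takes the values ±2r³ - βk at ∓r, so this says that they have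
opposite signs. It fails for n = 0 and 2k² = β, where the cubic has a double root. For n ≥ 1, 3r² ≥
k² + 3β, and cubing this suffices. -/
theorem abs_lt_critPt_cube (hβ : 0 < β) {n : ℕ} (hn : n ≠ 0) (k : ℤ) :
    |β * k| < 2 * critPt β n k ^ 3 := by
  have hr := critPt_pos hβ n k
  have h := critPt_sq hβ n k
  set r := critPt β n k
  have hn1 : (1 : ℝ) ≤ n := by exact_mod_cast Nat.one_le_iff_ne_zero.mpr hn
  have h1 : (k : ℝ) ^ 2 + 3 * β ≤ 3 * r ^ 2 := by rw [h]; nlinarith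
  have h2 : ((k : ℝ) ^ 2 + 3 * β) ^ 3 ≤ (3 * r ^ 2) ^ 3 := pow_le_pow_left₀ (by positivity) h1 3
  apply abs_lt_of_sq_lt_sq _ (by positivity)
  have h3 : 0 < β ^ 3 := by positivity
  have h4 : 0 ≤ (k : ℝ) ^ 6 := by positivity
  have h5 : 0 ≤ (k : ℝ) ^ 4 * β := by positivity
  have h6 : 0 ≤ (k : ℝ) ^ 2 * β ^ 2 := by positivity
  nlinarith

/-- Sign changes on [-2r, -r], [-r, r] and [r, 2r], where ±r are the critical points, yield three
distinct roots. The degree leaves room for no more, so they exhaust the multiset of roots. -/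
theorem exists_roots (hβ : 0 < β) {n : ℕ} (hn : n ≠ 0) (k : ℤ) : ∃ x₁ x₂ x₃ : ℝ,
    x₁ < -critPt β n k ∧ -critPt β n k < x₂ ∧ x₂ < critPt β n k ∧ critPt β n k < x₃ ∧
    (dispersionPoly β n k).roots.sort = [x₁, x₂, x₃] := by
  have hr := critPt_pos hβ n k
  have h := critPt_sq hβ n k
  obtain ⟨hl, hu⟩ := abs_lt.mp (abs_lt_critPt_cube hβ hn k)
  set r := critPt β n k
  have ev (x : ℝ) : (dispersionPoly β n k).eval x = x ^ 3 - 3 * r ^ 2 * x - β * k := by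
    rw [eval_dispersionPoly, h]
  have hc (s : Set ℝ) : ContinuousOn (fun x => (dispersionPoly β n k).eval x) s :=
    (dispersionPoly β n k).continuous.continuousOn
  have e1 : (dispersionPoly β n k).eval (-2 * r) < 0 := by rw [ev]; nlinarith
  have e2 : 0 < (dispersionPoly β n k).eval (-r) := by rw [ev]; nlinarith
  have e3 : (dispersionPoly β n k).eval r < 0 := by rw [ev]; nlinarith
  have e4 : 0 < (dispersionPoly β n k).eval (2 * r) := by rw [ev]; nlinarith
  obtain ⟨x₁, ⟨-, h1⟩, r1⟩ := intermediate_value_Ioo (by linarith : -2 * r ≤ -r) (hc _) ⟨e1, e2⟩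
  obtain ⟨x₂, ⟨h2, h2'⟩, r2⟩ := intermediate_value_Ioo' (by linarith : -r ≤ r) (hc _) ⟨e3, e2⟩
  obtain ⟨x₃, ⟨h3, -⟩, r3⟩ := intermediate_value_Ioo (by linarith : r ≤ 2 * r) (hc _) ⟨e3, e4⟩
  refine ⟨x₁, x₂, x₃, h1, h2, h2', h3, ?_⟩
  have h0 : dispersionPoly β n k ≠ 0 := fun h0 => by
    have := natDegree_dispersionPoly β n k
    simp [h0] at this
  have hnd : (x₁ ::ₘ x₂ ::ₘ x₃ ::ₘ (0 : Multiset ℝ)).Nodup := by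
    simp only [Multiset.nodup_cons, Multiset.mem_cons, Multiset.notMem_zero, or_false, not_or,
      not_false_eq_true, Multiset.nodup_zero, and_true]
    exact ⟨⟨by linarith, by linarith⟩, by linarith⟩
  have hle : (x₁ ::ₘ x₂ ::ₘ x₃ ::ₘ (0 : Multiset ℝ)) ≤ (dispersionPoly β n k).roots := by
    rw [Multiset.le_iff_subset hnd]
    intro x hx
    rw [Polynomial.mem_roots h0, Polynomial.IsRoot]
    simp only [Multiset.mem_cons, Multiset.notMem_zero, or_false] at hx
    rcases hx with rfl | rfl | rfl <;> assumption
  have heq := Multiset.eq_of_le_of_card_le hle (by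
    have := (dispersionPoly β n k).card_roots'
    rw [natDegree_dispersionPoly] at this
    simpa using this)
  rw [← heq]
  have hs : ([x₁, x₂, x₃] : List ℝ).Pairwise (· ≤ ·) := by
    simp only [List.pairwise_cons, List.mem_cons, List.not_mem_nil, or_false, forall_eq_or_imp,
      forall_eq, IsEmpty.forall_iff, implies_true, List.Pairwise.nil, and_true]
    exact ⟨⟨by linarith, by linarith⟩, by linarith⟩
  exact List.Perm.eq_of_pairwise' (Multiset.pairwise_sort _ _) hs
    (Multiset.coe_eq_coe.mp (by rw [Multiset.sort_eq]; rfl))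

theorem tau_zero_zero (β : ℝ) (k : ℤ) : tau β 0 k 0 = k := rfl

theorem tau_spec (hβ : 0 < β) {n : ℕ} (hn : n ≠ 0) (k : ℤ) :
    tau β n k (-1) < -critPt β n k ∧ -critPt β n k < tau β n k 0 ∧
      tau β n k 0 < critPt β n k ∧ critPt β n k < tau β n k 1 ∧
      ∀ j, tau β n k j ^ 3 - ((k : ℝ) ^ 2 + β * (2 * n + 1)) * tau β n k j - β * k = 0 := by
  obtain ⟨x₁, x₂, x₃, h1, h2, h3, h4, h5⟩ := exists_roots hβ hn k
  have t1 : tau β n k (-1) = x₁ := by simp only [tau, if_neg hn, h5]; rfl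
  have t2 : tau β n k 0 = x₂ := by simp only [tau, if_neg hn, h5]; rfl
  have t3 : tau β n k 1 = x₃ := by simp only [tau, if_neg hn, h5]; rfl
  have hroot (x : ℝ) (hx : x ∈ [x₁, x₂, x₃]) :
      x ^ 3 - ((k : ℝ) ^ 2 + β * (2 * n + 1)) * x - β * k = 0 := by
    rw [← h5, Multiset.mem_sort] at hx
    rw [← eval_dispersionPoly]
    exact Polynomial.isRoot_of_mem_roots hx
  refine ⟨t1 ▸ h1, t2 ▸ h2, t2 ▸ h3, t3 ▸ h4, fun j => hroot _ ?_⟩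
  cases j
  · exact t2 ▸ (by simp)
  · exact t1 ▸ (by simp)
  · exact t3 ▸ (by simp)

theorem tau_zero_spec (hβ : 0 < β) (k : ℤ) :
    tau β 0 k (-1) < tau β 0 k 1 ∧
      ∀ j, j ≠ 0 → tau β 0 k j ^ 2 - k * tau β 0 k j - β = 0 := by
  have t1 : tau β 0 k (-1) = (k : ℝ) / 2 - √((k : ℝ) ^ 2 + 4 * β) / 2 := rfl
  have t3 : tau β 0 k 1 = (k : ℝ) / 2 + √((k : ℝ) ^ 2 + 4 * β) / 2 := rfl
  have h0 : 0 < √((k : ℝ) ^ 2 + 4 * β) := by positivity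
  have h1 : √((k : ℝ) ^ 2 + 4 * β) ^ 2 = (k : ℝ) ^ 2 + 4 * β := Real.sq_sqrt (by positivity)
  refine ⟨by rw [t1, t3]; linarith, fun j hj => ?_⟩
  cases j
  · exact absurd rfl hj
  · change tau β 0 k (-1) ^ 2 - k * tau β 0 k (-1) - β = 0
    rw [t1]; linear_combination h1 / 4
  · change tau β 0 k 1 ^ 2 - k * tau β 0 k 1 - β = 0
    rw [t3]; linear_combination h1 / 4

/-- For n = 0 the cubic is (τ + k)(τ² - kτ - β), and j = ±1 are the roots of the second factor. The
Kelvin frequency k must be excluded, as the cubic equals -2βk there. -/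
theorem tau_cubic (hβ : 0 < β) {n : ℕ} {k : ℤ} {j : SignType} (h : ¬(j = 0 ∧ n = 0)) :
    tau β n k j ^ 3 - ((k : ℝ) ^ 2 + β * (2 * n + 1)) * tau β n k j - β * k = 0 := by
  rcases eq_or_ne n 0 with rfl | hn
  · have := (tau_zero_spec hβ k).2 j (fun hj => h ⟨hj, rfl⟩)
    push_cast
    linear_combination (tau β 0 k j + k) * this
  · exact (tau_spec hβ hn k).2.2.2.2 j

theorem tau_n_zero_zero (hβ : 0 < β) (n : ℕ) : tau β n 0 0 = 0 := by
  rcases eq_or_ne n 0 with rfl | hn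
  · rw [tau_zero_zero]; simp
  · obtain ⟨-, h1, h2, -, h3⟩ := tau_spec hβ hn 0
    have h := h3 0
    have hc := critPt_sq hβ n 0
    rw [← hc] at h
    have hr := critPt_pos hβ n 0
    have h4 : tau β n 0 0 * (tau β n 0 0 ^ 2 - 3 * critPt β n 0 ^ 2) = 0 := by
      push_cast at h
      linear_combination h
    refine (mul_eq_zero.mp h4).resolve_right fun h5 => ?_
    have := sq_lt_sq' h1 h2
    nlinarith

theorem tau_ne_of_ne (hβ : 0 < β) {n : ℕ} {k : ℤ} {j j' : SignType} (hj : j ≠ j')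
    (h : ¬(j = 0 ∧ n = 0)) (h' : ¬(j' = 0 ∧ n = 0)) : tau β n k j ≠ tau β n k j' := by
  rcases eq_or_ne n 0 with rfl | hn
  · have h1 : tau β 0 k SignType.neg < tau β 0 k SignType.pos := (tau_zero_spec hβ k).1
    cases j <;> cases j' <;> first
      | exact absurd rfl hj
      | exact absurd ⟨rfl, rfl⟩ h
      | exact absurd ⟨rfl, rfl⟩ h'
      | exact h1.ne
      | exact h1.ne'
  · obtain ⟨h1, h2, h3, h4, -⟩ := tau_spec hβ hn k
    have hr := critPt_pos hβ n k
    have a1 : tau β n k SignType.neg < tau β n k SignType.zero := h1.trans h2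
    have a2 : tau β n k SignType.zero < tau β n k SignType.pos := h3.trans h4
    have a3 := a1.trans a2
    cases j <;> cases j' <;> first
      | exact absurd rfl hj
      | exact a1.ne
      | exact a1.ne'
      | exact a2.ne
      | exact a2.ne'
      | exact a3.ne
      | exact a3.ne'

theorem tau_ne_zero_of (hβ : 0 < β) {n : ℕ} {j : SignType} (hj : j ≠ 0) : tau β n 0 j ≠ 0 := by
  rcases eq_or_ne n 0 with rfl | hn
  · intro h
    have := (tau_zero_spec hβ 0).2 j hj
    rw [h] at this
    simp at this
    exact hβ.ne' this
  · obtain ⟨h1, h2, h3, h4, -⟩ := tau_spec hβ hn 0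
    have hr := critPt_pos hβ n 0
    have a1 : tau β n 0 SignType.neg < 0 := h1.trans (by linarith)
    have a2 : 0 < tau β n 0 SignType.pos := hr.trans h4
    cases j
    · exact absurd rfl hj
    · exact a1.ne
    · exact a2.ne'

/-- At τ = k the cubic equals -β(2n+2)k. So τ = k forces k = 0 and τ = 0, which occurs only for j =
0. -/
theorem tau_sub_ne_zero (hβ : 0 < β) {n : ℕ} {k : ℤ} {j : SignType} (h : ¬(j = 0 ∧ n = 0))
    (h' : ¬(j = 0 ∧ k = 0)) : tau β n k j - k ≠ 0 := by
  intro h0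
  have h1 := tau_cubic hβ (k := k) h
  have h2 : tau β n k j = k := by linarith
  rw [h2] at h1
  have h3 : β * (2 * n + 2) * (k : ℝ) = 0 := by linear_combination -h1
  have h4 : (k : ℝ) = 0 := (mul_eq_zero.mp h3).resolve_left (by positivity)
  have h5 : k = 0 := by exact_mod_cast h4
  subst h5
  have hj : j ≠ 0 := fun hj => h' ⟨hj, rfl⟩
  exact tau_ne_zero_of hβ hj (by simpa using h2)

/-- At τ = -k the cubic equals 2nβk. The condition n ≠ 0 is essential: for n = 0 a frequency does
equal -k when 2k² = β. -/
theorem tau_add_ne_zero (hβ : 0 < β) {n : ℕ} {k : ℤ} {j : SignType} (hn : n ≠ 0)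
    (h' : ¬(j = 0 ∧ k = 0)) : tau β n k j + k ≠ 0 := by
  intro h0
  have h1 := tau_cubic hβ (k := k) (j := j) (n := n) (fun h => hn h.2)
  have h2 : tau β n k j = -k := by linarith
  rw [h2] at h1
  have h3 : β * (2 * n) * (k : ℝ) = 0 := by linear_combination h1
  have hn' : (0 : ℝ) < n := by exact_mod_cast Nat.pos_of_ne_zero hn
  have h4 : (k : ℝ) = 0 := (mul_eq_zero.mp h3).resolve_left (by positivity)
  have h5 : k = 0 := by exact_mod_cast h4
  subst h5
  have hj : j ≠ 0 := fun hj => h' ⟨hj, rfl⟩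
  exact tau_ne_zero_of hβ hj (by simpa using h2)

/-- Every nonzero frequency has finite multiplicity. -/
theorem finite_tau_eq (hβ : 0 < β) {t : ℝ} (ht : t ≠ 0) :
    {i : ℕ × ℤ × SignType | tau β i.1 i.2.1 i.2.2 = t}.Finite := by
  have ht' : 0 < |t| := abs_pos.mpr ht
  obtain ⟨K, hK⟩ := exists_nat_ge (|t| + β / |t| + t ^ 2)
  obtain ⟨M, hM⟩ := exists_nat_ge ((|t| ^ 3 + β * K) / (|t| * β))
  refine Set.Finite.subset ((Set.finite_Iic M).prod
    ((Set.finite_Icc (-(K : ℤ)) K).prod Set.finite_univ)) ?_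
  rintro ⟨n, k, j⟩ h
  simp only [Set.mem_ofPred_eq] at h
  simp only [Set.mem_prod, Set.mem_Iic, Set.mem_Icc, Set.mem_univ, and_true]
  rw [← abs_le]
  suffices hs : |(k : ℝ)| ≤ K ∧ (n : ℝ) ≤ M from ⟨by exact_mod_cast hs.2, by exact_mod_cast hs.1⟩
  by_cases h0 : j = 0 ∧ n = 0
  · obtain ⟨rfl, rfl⟩ := h0
    rw [tau_zero_zero] at h
    refine ⟨?_, by simp⟩
    rw [h]
    have : 0 ≤ β / |t| + t ^ 2 := by positivity
    linarith
  · have hc := tau_cubic hβ (k := k) h0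
    rw [h] at hc
    -- For fixed t the relation t(k² + β(2n+1)) = t³ - βk has a left side quadratic in k and linear
    -- in n, against a right side linear in k. This bounds k, and then n.
    have h1 : |t| * ((k : ℝ) ^ 2 + β * (2 * n + 1)) ≤ |t| ^ 3 + β * |(k : ℝ)| := by
      have e : t * ((k : ℝ) ^ 2 + β * (2 * n + 1)) = t ^ 3 - β * k := by linear_combination -hc
      calc |t| * ((k : ℝ) ^ 2 + β * (2 * n + 1)) = |t * ((k : ℝ) ^ 2 + β * (2 * n + 1))| := by
            rw [abs_mul, abs_of_nonneg (show 0 ≤ (k : ℝ) ^ 2 + β * (2 * n + 1) by positivity)]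
        _ ≤ |t ^ 3| + |β * k| := by rw [e]; exact abs_sub _ _
        _ = _ := by rw [abs_pow, abs_mul, abs_of_pos hβ]
    have hk : |(k : ℝ)| ≤ K := by
      refine le_trans ?_ hK
      by_contra! hlt
      have h2 : |t| * |(k : ℝ)| ^ 2 ≤ |t| ^ 3 + β * |(k : ℝ)| := by
        rw [sq_abs]
        refine le_trans ?_ h1
        gcongr
        have : 0 ≤ β * (2 * (n : ℝ) + 1) := by positivity
        linarith
      have h3 : |t| < |(k : ℝ)| := by
        have : 0 ≤ β / |t| + t ^ 2 := by positivity
        linarith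
      have h4 : |t| * |(k : ℝ)| ^ 2 ≥ |t| * |(k : ℝ)| * (|t| + β / |t|) := by
        rw [pow_two, ← mul_assoc]
        gcongr
        have : 0 ≤ t ^ 2 := by positivity
        linarith
      have h5 : |t| * |(k : ℝ)| * (|t| + β / |t|) = |t| ^ 2 * |(k : ℝ)| + β * |(k : ℝ)| := by
        field_simp
      nlinarith [mul_pos ht' ht']
    refine ⟨hk, le_trans ?_ hM⟩
    rw [le_div_iff₀ (by positivity)]
    calc (n : ℝ) * (|t| * β) ≤ |t| * ((k : ℝ) ^ 2 + β * (2 * n + 1)) := by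
          have e1 : 0 ≤ |t| * (k : ℝ) ^ 2 := by positivity
          have e2 : 0 ≤ |t| * β * n := by positivity
          have e3 : 0 ≤ |t| * β := by positivity
          nlinarith
      _ ≤ |t| ^ 3 + β * |(k : ℝ)| := h1
      _ ≤ _ := by gcongr

end Dispersion

/-! ### Coefficients of the eigenvectors -/

section Coefficients

variable {β : ℝ}

/-- The index of the block of a mode; the Kelvin modes form the block `-1`. -/
def blockIdx (n : ℕ) (j : SignType) : ℤ := if j = 0 ∧ n = 0 then -1 else n

/-- The coefficient of `(ψ_{m-1}, 0, -ψ_{m-1})` in a mode. -/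
noncomputable def coefA (β : ℝ) (n : ℕ) (k : ℤ) (j : SignType) : ℂ :=
  if j = 0 ∧ n = 0 then 0
  else if j = 0 ∧ k = 0 then
    ((1 / √(2 * Real.pi * (2 * n + 1)) : ℝ) : ℂ) * ((-√(((n : ℝ) + 1) / 2) : ℝ) : ℂ)
  else normConst β n k j * (-Complex.I / ((tau β n k j + k : ℝ) : ℂ) * (√(β * n / 2) : ℝ))

/-- The coefficient of `(ψ_{m+1}, 0, ψ_{m+1})` in a mode. -/
noncomputable def coefB (β : ℝ) (n : ℕ) (k : ℤ) (j : SignType) : ℂ :=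
  if j = 0 ∧ n = 0 then ((1 / √(4 * Real.pi) : ℝ) : ℂ)
  else if j = 0 ∧ k = 0 then
    ((1 / √(2 * Real.pi * (2 * n + 1)) : ℝ) : ℂ) * ((-√((n : ℝ) / 2) : ℝ) : ℂ)
  else normConst β n k j * (Complex.I / ((tau β n k j - k : ℝ) : ℂ) * (√(β * (n + 1) / 2) : ℝ))

/-- The coefficient of `(0, ψ_m, 0)` in a mode. -/
noncomputable def coefC (β : ℝ) (n : ℕ) (k : ℤ) (j : SignType) : ℂ :=
  if j = 0 ∧ n = 0 then 0 else if j = 0 ∧ k = 0 then 0 else normConst β n k j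

theorem blockIdx_nonneg {n : ℕ} {j : SignType} (h : ¬(j = 0 ∧ n = 0)) : 0 ≤ blockIdx n j := by
  rw [blockIdx, if_neg h]; exact Int.natCast_nonneg n

theorem neg_one_le_blockIdx (n : ℕ) (j : SignType) : -1 ≤ blockIdx n j := by
  unfold blockIdx; split_ifs <;> omega

/-- Here ψ_{m-1} = 0, so a nonzero coefficient would be invisible in the mode and would falsify
`coef_norm` as a statement about its norm. -/
theorem coefA_eq_zero {n : ℕ} {k : ℤ} {j : SignType} (h : blockIdx n j ≤ 0) :
    coefA β n k j = 0 := by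
  unfold coefA
  split_ifs with h1 h2
  · rfl
  · exfalso
    rw [blockIdx, if_neg h1] at h
    exact h1 ⟨h2.1, by omega⟩
  · rw [blockIdx, if_neg h1] at h
    have : n = 0 := by omega
    subst this
    simp

theorem coefC_eq_zero {n : ℕ} {k : ℤ} {j : SignType} (h : blockIdx n j < 0) :
    coefC β n k j = 0 := by
  have : j = 0 ∧ n = 0 := by
    by_contra h1
    exact absurd (blockIdx_nonneg h1) (not_le.mpr h)
  rw [coefC, if_pos this]

theorem lad_natCast (β : ℝ) (n : ℕ) : lad β n = √(β * n / 2) := by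
  simp [lad]

theorem lad_natCast_add_one (β : ℝ) (n : ℕ) : lad β (n + 1) = √(β * (n + 1) / 2) := by
  simp [lad]

/-- The components of the eigenvalue equation in the Hermite basis. -/
theorem coef_eigen (hβ : 0 < β) (n : ℕ) (k : ℤ) (j : SignType) :
    coefC β n k j * lad β (blockIdx n j) = Complex.I * (tau β n k j + k) * coefA β n k j ∧
    coefC β n k j * lad β (blockIdx n j + 1) = -Complex.I * (tau β n k j - k) * coefB β n k j ∧
    2 * (lad β (blockIdx n j + 1) * coefB β n k j - lad β (blockIdx n j) * coefA β n k j) =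
      Complex.I * tau β n k j * coefC β n k j := by
  have hI : Complex.I * Complex.I = -1 := Complex.I_mul_I
  by_cases h1 : j = 0 ∧ n = 0
  · obtain ⟨rfl, rfl⟩ := h1
    rw [coefA_eq_zero (by simp [blockIdx]), coefC_eq_zero (by simp [blockIdx])]
    simp [blockIdx, tau_zero_zero, lad]
  by_cases h2 : j = 0 ∧ k = 0
  · obtain ⟨rfl, rfl⟩ := h2
    have hC : coefC β n 0 0 = 0 := by rw [coefC, if_neg h1, if_pos ⟨rfl, rfl⟩]
    rw [hC, tau_n_zero_zero hβ, blockIdx, if_neg h1, lad_natCast, lad_natCast_add_one, coefA,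
      if_neg h1, if_pos ⟨rfl, rfl⟩, coefB, if_neg h1, if_pos ⟨rfl, rfl⟩]
    refine ⟨by simp, by simp, ?_⟩
    have e : √(β * (n + 1) / 2) * √((n : ℝ) / 2) = √(β * n / 2) * √(((n : ℝ) + 1) / 2) := by
      rw [← Real.sqrt_mul (by positivity), ← Real.sqrt_mul (by positivity)]
      congr 1; ring
    have e' := congrArg (fun t : ℝ => (t : ℂ)) e
    push_cast at e' ⊢
    linear_combination (-2 * (1 / (√(2 * Real.pi * (2 * n + 1)) : ℂ))) * e'
  · rw [blockIdx, if_neg h1, lad_natCast, lad_natCast_add_one, coefA, if_neg h1, if_neg h2, coefB,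
      if_neg h1, if_neg h2, coefC, if_neg h1, if_neg h2]
    have hs : ((tau β n k j - k : ℝ) : ℂ) ≠ 0 := by exact_mod_cast tau_sub_ne_zero hβ h1 h2
    have hq : ((√(β * (n + 1) / 2) : ℝ) : ℂ) * ((√(β * (n + 1) / 2) : ℝ) : ℂ) = β * (n + 1) / 2 := by
      rw [← Complex.ofReal_mul, Real.mul_self_sqrt (by positivity)]
      push_cast; ring
    have hp : ((√(β * n / 2) : ℝ) : ℂ) * ((√(β * n / 2) : ℝ) : ℂ) = β * n / 2 := by
      rw [← Complex.ofReal_mul, Real.mul_self_sqrt (by positivity)]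
      push_cast; ring
    have hcub : ((tau β n k j : ℝ) : ℂ) ^ 3 - ((k : ℂ) ^ 2 + β * (2 * n + 1)) * (tau β n k j : ℝ)
        - β * k = 0 := by
      exact_mod_cast congrArg (fun t : ℝ => (t : ℂ)) (tau_cubic hβ (k := k) h1)
    set q : ℂ := ((√(β * (n + 1) / 2) : ℝ) : ℂ)
    set p : ℂ := ((√(β * n / 2) : ℝ) : ℂ) with hpdef
    set N : ℂ := (normConst β n k j : ℂ)
    have e2 : N * q = -Complex.I * ((tau β n k j : ℂ) - k) *
        (N * (Complex.I / ((tau β n k j - k : ℝ) : ℂ) * q)) := by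
      have : ((tau β n k j : ℂ) - k) = ((tau β n k j - k : ℝ) : ℂ) := by push_cast; rfl
      rw [this]
      field_simp
      linear_combination (N * q) * hI
    -- For n = 0 the coefficient A drops out, τ + k may vanish, and the third equation reduces to
    -- the quadratic. For n ≥ 1, clearing both denominators leaves the dispersion cubic.
    rcases eq_or_ne n 0 with rfl | hn
    · have hp0 : p = 0 := by simp [hpdef]
      have hquad : ((tau β 0 k j : ℝ) : ℂ) ^ 2 - k * (tau β 0 k j : ℝ) - β = 0 := by
        exact_mod_cast congrArg (fun t : ℝ => (t : ℂ))
          ((tau_zero_spec hβ k).2 j (fun hj => h1 ⟨hj, rfl⟩))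
      refine ⟨by rw [hp0]; ring, e2, ?_⟩
      rw [hp0]
      push_cast at hs hq ⊢
      field_simp
      linear_combination 2 * N * hq - N * hquad
    · have ha : ((tau β n k j + k : ℝ) : ℂ) ≠ 0 := by exact_mod_cast tau_add_ne_zero hβ hn h2
      refine ⟨?_, e2, ?_⟩
      · have : ((tau β n k j : ℂ) + k) = ((tau β n k j + k : ℝ) : ℂ) := by push_cast; rfl
        rw [this]
        field_simp
        linear_combination (N * p) * hI
      · push_cast at hs ha ⊢
        field_simp
        linear_combination 2 * N * (tau β n k j + k) * hq + 2 * N * (tau β n k j - k) * hp - N * hcub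

/-- This is the squared L² norm of the mode: 2π is the length of the circle, and the factors 2
appear because ψ_{m±1} occur in both η and u₂. -/
theorem coef_norm (hβ : 0 < β) (n : ℕ) (k : ℤ) (j : SignType) :
    2 * Real.pi * (2 * ‖coefA β n k j‖ ^ 2 + 2 * ‖coefB β n k j‖ ^ 2 + ‖coefC β n k j‖ ^ 2) = 1 := by
  have hpi := Real.pi_pos
  unfold coefA coefB coefC
  split_ifs with h1 h2
  · simp only [norm_zero, Complex.norm_real, Real.norm_eq_abs, sq_abs, div_pow, one_pow]
    rw [Real.sq_sqrt (by positivity)]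
    field_simp
    norm_num
  · simp only [norm_zero, norm_mul, Complex.norm_real, Real.norm_eq_abs, mul_pow, sq_abs, div_pow,
      one_pow, neg_sq]
    rw [Real.sq_sqrt (by positivity), Real.sq_sqrt (by positivity), Real.sq_sqrt (by positivity)]
    field_simp
    ring
  · simp only [norm_mul, norm_div, norm_neg, Complex.norm_I, Complex.norm_real, Real.norm_eq_abs,
      mul_pow, sq_abs, div_pow, one_pow]
    rw [Real.sq_sqrt (by positivity), Real.sq_sqrt (by positivity), normConst, div_pow, one_pow,
      Real.sq_sqrt (by positivity)]
    have : 0 < β * n / (tau β n k j + k) ^ 2 + β * (n + 1) / (tau β n k j - k) ^ 2 + 1 := by positivity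
    rw [show 2 * (1 / (2 * Real.pi * (β * n / (tau β n k j + k) ^ 2 + β * (n + 1) / (tau β n k j - k) ^ 2
      + 1)) * (1 / (tau β n k j + k) ^ 2 * (β * n / 2))) + 2 * (1 / (2 * Real.pi * (β * n /
      (tau β n k j + k) ^ 2 + β * (n + 1) / (tau β n k j - k) ^ 2 + 1)) * (1 / (tau β n k j - k) ^ 2 *
      (β * (n + 1) / 2))) + 1 / (2 * Real.pi * (β * n / (tau β n k j + k) ^ 2 + β * (n + 1) /
      (tau β n k j - k) ^ 2 + 1)) = 1 / (2 * Real.pi * (β * n / (tau β n k j + k) ^ 2 + β * (n + 1) /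
      (tau β n k j - k) ^ 2 + 1)) * (β * n / (tau β n k j + k) ^ 2 + β * (n + 1) /
      (tau β n k j - k) ^ 2 + 1) by ring]
    generalize β * n / (tau β n k j + k) ^ 2 + β * (n + 1) / (tau β n k j - k) ^ 2 + 1 = S at *
    field_simp

/-- Distinct modes of the same block are orthogonal. -/
theorem coef_orthogonal (hβ : 0 < β) {n : ℕ} {k : ℤ} {j j' : SignType} (hj : j ≠ j')
    (h : ¬(j = 0 ∧ n = 0)) (h' : ¬(j' = 0 ∧ n = 0)) :
    2 * (starRingEnd ℂ (coefA β n k j) * coefA β n k j') +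
      2 * (starRingEnd ℂ (coefB β n k j) * coefB β n k j') +
      starRingEnd ℂ (coefC β n k j) * coefC β n k j' = 0 := by
  obtain ⟨a1, a2, a3⟩ := coef_eigen hβ n k j
  obtain ⟨b1, b2, b3⟩ := coef_eigen hβ n k j'
  rw [blockIdx, if_neg h] at a1 a2 a3
  rw [blockIdx, if_neg h'] at b1 b2 b3
  have hne : ((tau β n k j' : ℂ) - tau β n k j) ≠ 0 := by
    rw [sub_ne_zero]
    exact_mod_cast (tau_ne_of_ne hβ hj h h').symm
  have c1 := congrArg (starRingEnd ℂ) a1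
  have c2 := congrArg (starRingEnd ℂ) a2
  have c3 := congrArg (starRingEnd ℂ) a3
  simp only [map_mul, map_sub, map_add, map_neg, Complex.conj_I, Complex.conj_ofReal, map_ofNat,
    map_intCast] at c1 c2 c3
  -- The block is skew-Hermitian for the product weighted by (2, 2, 1). Hence i(τ' - τ) times the
  -- product of two eigenvectors vanishes.
  refine (mul_eq_zero.mp (?_ : Complex.I * ((tau β n k j' : ℂ) - tau β n k j) * _ = 0)).resolve_left
    (mul_ne_zero Complex.I_ne_zero hne)
  set A := starRingEnd ℂ (coefA β n k j)
  set B := starRingEnd ℂ (coefB β n k j)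
  set C := starRingEnd ℂ (coefC β n k j)
  linear_combination (-2 * A) * b1 + (2 * B) * b2 - C * b3 - 2 * coefA β n k j' * c1 +
    2 * coefB β n k j' * c2 - coefC β n k j' * c3

end Coefficients

end EquatorialWaves

namespace EquatorialWaves

/-! ### Integration by parts on `ℝ × 𝕋` -/

section Parts

variable {E : Type*} [NormedAddCommGroup E] [NormedSpace ℝ E]

/-- The point reached from `x` at time `t` with velocity `v`. -/
noncomputable def shift (v : ℝ × ℝ) (x : Dom) (t : ℝ) : Dom :=
  (x.1 + t * v.1, x.2 + ((t * v.2 : ℝ) : Torus))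

theorem shift_eq_add (v : ℝ × ℝ) (x : Dom) (t : ℝ) :
    shift v x t = x + ((t * v.1, ((t * v.2 : ℝ) : Torus)) : Dom) := rfl

theorem shift_zero (v : ℝ × ℝ) (x : Dom) : shift v x 0 = x := by
  simp [shift]

theorem shift_shift (v : ℝ × ℝ) (x : Dom) (s t : ℝ) : shift v (shift v x s) t = shift v x (s + t) := by
  simp only [shift, add_mul, AddCircle.coe_add, add_assoc]

theorem continuous_shift (v : ℝ × ℝ) : Continuous fun p : Dom × ℝ => shift v p.1 p.2 := by
  refine Continuous.prodMk (by fun_prop) ((continuous_snd.comp continuous_fst).add ?_)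
  exact (AddCircle.continuous_mk' (2 * Real.pi)).comp (by fun_prop)

/-- `F'` is the derivative of `F` in the direction `v`. -/
def HasDir (v : ℝ × ℝ) (F F' : Dom → E) : Prop :=
  ∀ x, HasDerivAt (fun t : ℝ => F (shift v x t)) (F' x) 0

theorem HasDir.hasDerivAt {v : ℝ × ℝ} {F F' : Dom → E} (h : HasDir v F F') (x : Dom) (t : ℝ) :
    HasDerivAt (fun t : ℝ => F (shift v x t)) (F' (shift v x t)) t := by
  have h1 := h (shift v x t)
  simp only [shift_shift] at h1
  have h2 : HasDerivAt (fun s : ℝ => s - t) 1 t := (hasDerivAt_id t).sub_const t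
  have h3 : HasDerivAt (fun s => F (shift v x (t + s))) (F' (shift v x t)) (t - t) := by
    simpa using h1
  simpa [Function.comp_def] using HasDerivAt.scomp (h := fun s : ℝ => s - t) t h3 h2

/-- The integral of a derivative of a compactly supported function vanishes. -/
theorem HasDir.integral_eq_zero {v : ℝ × ℝ} {F F' : Dom → E} (h : HasDir v F F')
    (hF : Continuous F) (hFc : HasCompactSupport F) (hF' : Continuous F')
    (hFc' : HasCompactSupport F') : ∫ x, F' x = 0 := by
  obtain ⟨M, hM⟩ := hF'.bounded_above_of_compact_support hFc'
  have hM0 : 0 ≤ M := (norm_nonneg _).trans (hM 0)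
  -- The points from which a flow time |t| ≤ 1 can reach the support of F'. This set is compact, so
  -- M times its indicator dominates all the derivatives.
  let K : Set Dom := (fun p : Dom × ℝ => shift v p.1 (-p.2)) '' (tsupport F' ×ˢ Set.Icc (-1) 1)
  have hK : IsCompact K := (hFc'.prod isCompact_Icc).image
    ((continuous_shift v).comp (continuous_fst.prodMk continuous_snd.neg))
  have hmem {x : Dom} {t : ℝ} (ht : t ∈ Set.Icc (-1 : ℝ) 1) (hx : F' (shift v x t) ≠ 0) : x ∈ K := by
    refine ⟨(shift v x t, t), ⟨subset_tsupport _ hx, ht⟩, ?_⟩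
    simp [shift_shift, shift_zero]
  have hcont (t : ℝ) : Continuous fun x => shift v x t :=
    (continuous_shift v).comp (continuous_id.prodMk continuous_const)
  have key := (hasDerivAt_integral_of_dominated_loc_of_deriv_le (μ := volume) (𝕜 := ℝ)
    (F := fun (t : ℝ) (x : Dom) => F (shift v x t)) (F' := fun t x => F' (shift v x t)) (x₀ := 0)
    (s := Set.Icc (-1) 1) (bound := K.indicator fun _ => M)
    (Icc_mem_nhds (by norm_num) (by norm_num))
    (Eventually.of_forall fun t => (hF.comp (hcont t)).aestronglyMeasurable)
    (by simpa [shift_zero] using hF.integrable_of_hasCompactSupport hFc)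
    (hF'.comp (hcont 0)).aestronglyMeasurable
    (Eventually.of_forall fun x t ht => by
      by_cases hx : x ∈ K
      · rw [Set.indicator_of_mem hx]; exact hM _
      · have : F' (shift v x t) = 0 := by
          by_contra h0
          exact hx (hmem ht h0)
        rw [this, norm_zero]
        exact Set.indicator_nonneg (fun _ _ => hM0) _)
    ((integrable_indicator_iff hK.measurableSet).mpr (integrableOn_const hK.measure_lt_top.ne))
    (Eventually.of_forall fun x t _ => h.hasDerivAt x t)).2
  -- By translation invariance the integral does not depend on t, while its derivative at 0 is the
  -- integral of F'.
  have hconst : (fun t : ℝ => ∫ x, F (shift v x t)) = fun _ => ∫ x, F x := by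
    funext t
    simp only [shift_eq_add]
    exact integral_add_right_eq_self (μ := (volume : Measure ℝ).prod (volume : Measure Torus)) F _
  rw [hconst] at key
  have := key.unique (hasDerivAt_const 0 _)
  simpa [shift_zero] using this

theorem IsTest.hasDir {φ : Dom → ℂ} (h : IsTest φ) (v : ℝ × ℝ) : HasDir v φ (EquatorialWaves.dirDeriv v φ) := by
  intro x
  obtain ⟨y, rfl⟩ : ∃ y : ℝ × ℝ, ((y.1, (y.2 : Torus)) : Dom) = x := by
    obtain ⟨x₁, x₂⟩ := x
    obtain ⟨y₂, rfl⟩ := QuotientAddGroup.mk_surjective x₂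
    exact ⟨(x₁, y₂), rfl⟩
  have hd : DifferentiableAt ℝ (pullBack φ) y := h.1.differentiable (by simp) y
  have h1 : HasDerivAt (fun t : ℝ => y + t • v) v 0 := by
    simpa using ((hasDerivAt_id (0 : ℝ)).smul_const v).const_add y
  have h2 : HasFDerivAt (pullBack φ) (fderiv ℝ (pullBack φ) y) (y + (0 : ℝ) • v) := by
    simpa using hd.hasFDerivAt
  rw [dirDeriv_mk v φ y hd]
  exact h2.comp_hasDerivAt (0 : ℝ) h1

end Parts

section PartsSMul

variable {E : Type*} [NormedAddCommGroup E] [NormedSpace ℂ E]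

theorem HasDir.smul {v : ℝ × ℝ} {φ φ' : Dom → ℂ} {f f' : Dom → E} (hφ : HasDir v φ φ')
    (hf : HasDir v f f') : HasDir v (fun x => φ x • f x) (fun x => φ' x • f x + φ x • f' x) := by
  intro x
  have := (hφ x).smul (hf x)
  simp only [shift_zero] at this
  rw [add_comm] at this
  exact this

/-- Integration by parts against a test function. -/
theorem integral_dirDeriv_smul {v : ℝ × ℝ} {φ : Dom → ℂ} (hφ : IsTest φ) {f f' : Dom → E}
    (h : HasDir v f f') (hf : Continuous f) (hf' : Continuous f') :
    ∫ x, dirDeriv v φ x • f x = -∫ x, φ x • f' x := by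
  have hd := hφ.dirDeriv v
  have h1 : HasCompactSupport fun x => dirDeriv v φ x • f x := hd.2.smul_right
  have h2 : HasCompactSupport fun x => φ x • f' x := hφ.2.smul_right
  have c1 : Continuous fun x => dirDeriv v φ x • f x := hd.continuous.smul hf
  have c2 : Continuous fun x => φ x • f' x := hφ.continuous.smul hf'
  have key := ((hφ.hasDir v).smul h).integral_eq_zero (hφ.continuous.smul hf) hφ.2.smul_right
    (c1.add c2) (h1.add h2)
  rw [integral_add (c1.integrable_of_hasCompactSupport h1)
    (c2.integrable_of_hasCompactSupport h2)] at key
  exact eq_neg_of_add_eq_zero_left key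

end PartsSMul

/-! ### Products of profiles and characters -/

section Modes

variable {E : Type*} [NormedAddCommGroup E] [NormedSpace ℂ E]

/-- The field `e^{i k x₂} V(x₁)`. -/
noncomputable def wave (k : ℤ) (V : ℝ → E) (x : Dom) : E := fourier k x.2 • V x.1

theorem continuous_wave {k : ℤ} {V : ℝ → E} (hV : Continuous V) : Continuous (wave k V) :=
  ((map_continuous (fourier k)).comp continuous_snd).smul (hV.comp continuous_fst)

theorem norm_fourier_apply (k : ℤ) (x : Torus) : ‖(fourier k x : ℂ)‖ = 1 := by
  rw [fourier_apply]; exact Circle.norm_coe _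

theorem norm_wave (k : ℤ) (V : ℝ → E) (x : Dom) : ‖wave k V x‖ = ‖V x.1‖ := by
  rw [wave, norm_smul, norm_fourier_apply, one_mul]

theorem hasDir_wave_one {k : ℤ} {V V' : ℝ → E} (h : ∀ x, HasDerivAt V (V' x) x) :
    HasDir (1, 0) (wave k V) (wave k V') := by
  intro x
  simp only [wave, shift, mul_one, mul_zero, AddCircle.coe_zero, add_zero]
  have h1 : HasDerivAt (fun t : ℝ => x.1 + t) 1 0 := (hasDerivAt_id (0 : ℝ)).const_add x.1
  have h2 : HasDerivAt V (V' x.1) (x.1 + 0) := by simpa using h x.1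
  have h3 := h2.scomp (0 : ℝ) h1
  rw [one_smul] at h3
  exact h3.const_smul (fourier k x.2 : ℂ)

theorem hasDir_wave_two (k : ℤ) (V : ℝ → E) :
    HasDir (0, 1) (wave k V) (wave k fun x => (Complex.I * k) • V x) := by
  intro x
  simp only [wave, shift, mul_one, mul_zero, add_zero]
  have h1 := (hasDerivAt_fourier (2 * Real.pi) k 0).const_mul (fourier k x.2 : ℂ)
  have h2 : HasDerivAt (fun t : ℝ => (fourier k (x.2 + (t : Torus)) : ℂ))
      (fourier k x.2 * (Complex.I * k)) 0 := by
    have e : (fun t : ℝ => (fourier k (x.2 + (t : Torus)) : ℂ)) =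
        fun t : ℝ => (fourier k x.2 : ℂ) * fourier k (t : Torus) := by
      funext t
      simp only [fourier_apply, smul_add, AddCircle.toCircle_add, Circle.coe_mul]
    rw [e]
    refine h1.congr_deriv ?_
    have hpi : (Real.pi : ℂ) ≠ 0 := by exact_mod_cast Real.pi_ne_zero
    rw [AddCircle.coe_zero, fourier_eval_zero]
    push_cast
    field_simp
  have h3 := h2.smul_const (V x.1)
  rw [mul_smul] at h3
  exact h3

theorem integral_fourier (k : ℤ) :
    ∫ x : Torus, (fourier k x : ℂ) = if k = 0 then 2 * Real.pi else 0 := by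
  have h := fourierCoeff_fourier (T := 2 * Real.pi) k
  have h0 := congrFun h 0
  rw [fourierCoeff, AddCircle.integral_haarAddCircle] at h0
  simp only [neg_zero, fourier_zero, one_smul] at h0
  have hpi : (2 * Real.pi : ℝ) ≠ 0 := by have := Real.pi_pos; positivity
  have h1 : ∫ x : Torus, (fourier k x : ℂ) = (2 * Real.pi : ℝ) • (Pi.single k (1 : ℂ) : ℤ → ℂ) 0 := by
    rw [← h0, smul_smul, mul_inv_cancel₀ hpi, one_smul]
  rw [h1]
  by_cases hk : k = 0
  · subst hk; simp
  · rw [if_neg hk, Pi.single_eq_of_ne (Ne.symm hk), smul_zero, Complex.ofReal_zero]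

theorem integral_wave [CompleteSpace E] (k : ℤ) (V : ℝ → E) :
    ∫ x : Dom, wave k V x = if k = 0 then (2 * Real.pi : ℂ) • ∫ x, V x else 0 := by
  have h := integral_prod_smul (μ := (volume : Measure Torus)) (ν := (volume : Measure ℝ))
    (fun x : Torus => (fourier k x : ℂ)) V
  rw [integral_fourier] at h
  have h2 : ∫ x : Dom, wave k V x = ∫ z : Torus × ℝ, (fourier k z.1 : ℂ) • V z.2 :=
    integral_prod_swap (μ := (volume : Measure Torus)) (ν := (volume : Measure ℝ))
      (fun z : Torus × ℝ => (fourier k z.1 : ℂ) • V z.2)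
  rw [h2]
  refine h.trans ?_
  split_ifs <;> simp

theorem memLp_wave (k : ℤ) {V : ℝ → E} (hV : GaussDecay V) : MemLp (wave k V) 2 := by
  rw [memLp_two_iff_integrable_sq_norm (continuous_wave hV.1).aestronglyMeasurable]
  have h1 : Integrable fun x : ℝ => ‖V x‖ ^ 2 :=
    (memLp_two_iff_integrable_sq_norm hV.1.aestronglyMeasurable).mp hV.memLp_two
  have h2 : Integrable (fun _ : Torus => (1 : ℝ)) := integrable_const _
  refine (h1.mul_prod h2).congr (Eventually.of_forall fun x => ?_)
  simp [norm_wave]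

end Modes

/-! ### The eigenvectors as waves -/

section Profile

variable {β : ℝ}

/-- The derivatives of the profiles of the eigenvectors. -/
noncomputable def profile (β : ℝ) (n : ℕ) (k : ℤ) (j : SignType) (a : ℕ) (x : ℝ) : Val :=
  (psiD β a (blockIdx n j - 1) x : ℂ) • !₂[coefA β n k j, 0, -coefA β n k j] +
    (psiD β a (blockIdx n j + 1) x : ℂ) • !₂[coefB β n k j, 0, coefB β n k j] +
    (psiD β a (blockIdx n j) x : ℂ) • !₂[0, coefC β n k j, 0]

/-- The three cases of the definition merge into one formula, so the analysis below needs no case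
distinction. For Kelvin modes m = -1 and ψ_{m+1} is ψ_0. -/
theorem Psi_eq_wave (β : ℝ) (n : ℕ) (k : ℤ) (j : SignType) :
    Psi β n k j = wave k (profile β n k j 0) := by
  funext x
  unfold Psi wave profile
  simp only [psiD]
  split_ifs with h1 h2
  · obtain ⟨rfl, rfl⟩ := h1
    ext i
    fin_cases i <;> simp [coefA, coefB, coefC, blockIdx] <;> ring
  · obtain ⟨rfl, rfl⟩ := h2
    ext i
    have hn : n ≠ 0 := fun hn => h1 ⟨rfl, hn⟩
    fin_cases i <;> simp [coefA, coefB, coefC, blockIdx, hn] <;> ring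
  · ext i
    fin_cases i <;> simp [coefA, coefB, coefC, blockIdx, h1, h2] <;> ring

theorem gaussDecay_psiD (hβ : 0 < β) (a : ℕ) (m : ℤ) : GaussDecay (psiD β a m) := by
  induction a generalizing m with
  | zero => exact gaussDecay_psi hβ m
  | succ a ih => exact ((ih (m - 1)).const_mul _).sub ((ih (m + 1)).const_mul _)

theorem GaussDecay.ofReal_smul {E : Type*} [NormedAddCommGroup E] [NormedSpace ℂ E] {f : ℝ → ℝ}
    (hf : GaussDecay f) (v : E) : GaussDecay (fun x => (f x : ℂ) • v) :=
  hf.of_norm_le ((Complex.continuous_ofReal.comp hf.1).smul continuous_const) ‖v‖ fun x => by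
    rw [norm_smul, mul_comm, Complex.norm_real]

theorem gaussDecay_profile (hβ : 0 < β) (n : ℕ) (k : ℤ) (j : SignType) (a : ℕ) :
    GaussDecay (profile β n k j a) :=
  (((gaussDecay_psiD hβ a _).ofReal_smul _).add ((gaussDecay_psiD hβ a _).ofReal_smul _)).add
    ((gaussDecay_psiD hβ a _).ofReal_smul _)

theorem hasDerivAt_profile (hβ : 0 < β) (n : ℕ) (k : ℤ) (j : SignType) (a : ℕ) (x : ℝ) :
    HasDerivAt (profile β n k j a) (profile β n k j (a + 1) x) x :=
  (((hasDerivAt_psiD hβ a _ x).ofReal_comp.smul_const _).add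
    ((hasDerivAt_psiD hβ a _ x).ofReal_comp.smul_const _)).add
    ((hasDerivAt_psiD hβ a _ x).ofReal_comp.smul_const _)

theorem profile_apply_zero (β : ℝ) (n : ℕ) (k : ℤ) (j : SignType) (a : ℕ) (x : ℝ) :
    profile β n k j a x 0 = coefA β n k j * psiD β a (blockIdx n j - 1) x +
      coefB β n k j * psiD β a (blockIdx n j + 1) x := by
  simp [profile]; ring

theorem profile_apply_one (β : ℝ) (n : ℕ) (k : ℤ) (j : SignType) (a : ℕ) (x : ℝ) :
    profile β n k j a x 1 = coefC β n k j * psiD β a (blockIdx n j) x := by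
  simp [profile]; ring

theorem profile_apply_two (β : ℝ) (n : ℕ) (k : ℤ) (j : SignType) (a : ℕ) (x : ℝ) :
    profile β n k j a x 2 = -coefA β n k j * psiD β a (blockIdx n j - 1) x +
      coefB β n k j * psiD β a (blockIdx n j + 1) x := by
  simp [profile]; ring

/-- The eigenvalue equation for the profiles. -/
theorem profile_eigen (hβ : 0 < β) (n : ℕ) (k : ℤ) (j : SignType) (x : ℝ) :
    profile β n k j 1 x 1 + Complex.I * k * profile β n k j 0 x 2 =
      Complex.I * tau β n k j * profile β n k j 0 x 0 ∧
    β * x * profile β n k j 0 x 2 + profile β n k j 1 x 0 =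
      Complex.I * tau β n k j * profile β n k j 0 x 1 ∧
    -(β * x * profile β n k j 0 x 1) + Complex.I * k * profile β n k j 0 x 0 =
      Complex.I * tau β n k j * profile β n k j 0 x 2 := by
  obtain ⟨a1, a2, a3⟩ := coef_eigen hβ n k j
  simp only [profile_apply_zero, profile_apply_one, profile_apply_two]
  set m := blockIdx n j
  have hD (i : ℤ) : (psiD β 1 i x : ℂ) = lad β i * psiD β 0 (i - 1) x -
      lad β (i + 1) * psiD β 0 (i + 1) x := by
    simp only [psiD]; push_cast; ring
  have hx (i : ℤ) : (β : ℂ) * x * psiD β 0 i x = lad β i * psiD β 0 (i - 1) x +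
      lad β (i + 1) * psiD β 0 (i + 1) x := by
    have := congrArg (fun t : ℝ => (t : ℂ)) (mul_psi hβ i x)
    push_cast at this
    exact this
  -- In the second equation ψ_{m-1} meets the creation operator and ψ_{m+1} the annihilation
  -- operator. Both land on ψ_m, and the terms in ψ_{m±2} cancel.
  have x0 := hx m
  have x1 := hx (m - 1)
  have x2 := hx (m + 1)
  rw [hD m, hD (m - 1), hD (m + 1)]
  rw [sub_add_cancel] at x1 ⊢
  rw [add_sub_cancel_right] at x2 ⊢
  refine ⟨?_, ?_, ?_⟩
  · linear_combination (psiD β 0 (m - 1) x : ℂ) * a1 - (psiD β 0 (m + 1) x : ℂ) * a2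
  · linear_combination (psiD β 0 m x : ℂ) * a3 - coefA β n k j * x1 + coefB β n k j * x2
  · linear_combination -coefC β n k j * x0 - (psiD β 0 (m - 1) x : ℂ) * a1 -
      (psiD β 0 (m + 1) x : ℂ) * a2

/-- The eigenvectors as elements of `L²`. -/
noncomputable def eigvec (hβ : 0 < β) (i : ℕ × ℤ × SignType) : L2 :=
  (memLp_wave i.2.1 (gaussDecay_profile hβ i.1 i.2.1 i.2.2 0)).toLp _

theorem coeFn_eigvec (hβ : 0 < β) (i : ℕ × ℤ × SignType) :
    ⇑(eigvec hβ i) =ᵐ[volume] wave i.2.1 (profile β i.1 i.2.1 i.2.2 0) :=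
  MemLp.coeFn_toLp _

theorem hasDerivAt_profile_apply (hβ : 0 < β) (n : ℕ) (k : ℤ) (j : SignType) (a : ℕ) (i : Fin 3)
    (x : ℝ) :
    HasDerivAt (fun y => profile β n k j a y i) (profile β n k j (a + 1) x i) x := by
  have := (((EuclideanSpace.proj (𝕜 := ℂ) i : Val →L[ℂ] ℂ).restrictScalars ℝ).hasFDerivAt
    (x := profile β n k j a x)).comp_hasDerivAt x (hasDerivAt_profile hβ n k j a x)
  exact this

theorem continuous_profile_apply (hβ : 0 < β) (n : ℕ) (k : ℤ) (j : SignType) (a : ℕ) (i : Fin 3) :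
    Continuous fun y => profile β n k j a y i :=
  (EuclideanSpace.proj (𝕜 := ℂ) i : Val →L[ℂ] ℂ).continuous.comp (gaussDecay_profile hβ n k j a).1

/-- The eigenvectors satisfy `L Ψ = i τ Ψ` in the sense of distributions. -/
theorem lEq_eigvec (hβ : 0 < β) (n : ℕ) (k : ℤ) (j : SignType) :
    LEq β (eigvec hβ (n, k, j)) ((Complex.I * (tau β n k j : ℂ)) • eigvec hβ (n, k, j)) := by
  intro φ hφ
  set P := fun (i : Fin 3) (x : ℝ) => profile β n k j 0 x i with hP
  set P' := fun (i : Fin 3) (x : ℝ) => profile β n k j 1 x i with hP'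
  have cP (i : Fin 3) : Continuous (P i) := continuous_profile_apply hβ n k j 0 i
  have cP' (i : Fin 3) : Continuous (P' i) := continuous_profile_apply hβ n k j 1 i
  have cI (i : Fin 3) : Continuous fun x => (Complex.I * k) • P i x :=
    show Continuous ((Complex.I * (k : ℂ)) • P i) from (cP i).const_smul _
  have hae (i : Fin 3) : ∀ᵐ x : Dom, eigvec hβ (n, k, j) x i = wave k (P i) x := by
    filter_upwards [coeFn_eigvec hβ (n, k, j)] with x hx
    rw [hx]; rfl
  have hae' (i : Fin 3) : ∀ᵐ x : Dom, ((Complex.I * (tau β n k j : ℂ)) • eigvec hβ (n, k, j)) x i =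
      Complex.I * tau β n k j * wave k (P i) x := by
    filter_upwards [hae i, Lp.coeFn_smul (Complex.I * (tau β n k j : ℂ)) (eigvec hβ (n, k, j))]
      with x hx hx'
    rw [hx', Pi.smul_apply, PiLp.smul_apply, hx, smul_eq_mul]
  have p1 (i : Fin 3) : ∫ x, d1 φ x • wave k (P i) x = -∫ x, φ x • wave k (P' i) x :=
    integral_dirDeriv_smul hφ (hasDir_wave_one (hasDerivAt_profile_apply hβ n k j 0 i))
      (continuous_wave (cP i)) (continuous_wave (cP' i))
  have p2 (i : Fin 3) : ∫ x, d2 φ x • wave k (P i) x =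
      -∫ x, φ x • wave k (fun x => (Complex.I * k) • P i x) x :=
    integral_dirDeriv_smul hφ (hasDir_wave_two k (P i))
      (continuous_wave (cP i)) (continuous_wave (cI i))
  have int {w : Dom → ℂ} (hw : IsTest w) {V : ℝ → ℂ} (hV : Continuous V) :
      Integrable fun x => w x • wave k V x :=
    (hw.continuous.smul (continuous_wave hV)).integrable_of_hasCompactSupport hw.2.smul_right
  have int1 (i : Fin 3) : Integrable fun x => d1 φ x • wave k (P i) x := int (hφ.dirDeriv _) (cP i)
  have int2 (i : Fin 3) : Integrable fun x => d2 φ x • wave k (P i) x := int (hφ.dirDeriv _) (cP i)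
  have intI (i : Fin 3) : Integrable fun x => φ x • wave k (fun x => (Complex.I * k) • P i x) x :=
    int hφ (cI i)
  have intx (i : Fin 3) : Integrable fun x => φ x • wave k (fun x => (β * x : ℂ) • P i x) x :=
    int hφ (by have := cP i; fun_prop)
  have n1 : Integrable fun x => -(d1 φ x • wave k (P 1) x) := (int1 1).neg
  have nx : Integrable fun x => -(φ x • wave k (fun x => (β * x : ℂ) • P 1 x) x) := (intx 1).neg
  have eig (x : ℝ) := profile_eigen hβ n k j x
  refine ⟨?_, ?_, ?_⟩
  · calc _ = ∫ x, (-(d1 φ x • wave k (P 1) x) - d2 φ x • wave k (P 2) x) := by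
          refine integral_congr_ae ?_
          filter_upwards [hae 1, hae 2] with x h1 h2
          rw [h1, h2]; simp only [smul_eq_mul]; ring
      _ = ∫ x, (φ x • wave k (P' 1) x + φ x • wave k (fun x => (Complex.I * k) • P 2 x) x) := by
          rw [integral_sub n1 (int2 2), integral_neg, p1, p2,
            integral_add (int hφ (cP' 1)) (intI 2)]
          ring
      _ = _ := by
          refine integral_congr_ae ?_
          filter_upwards [hae' 0] with x h0
          rw [h0]
          simp only [wave, smul_eq_mul]
          linear_combination (fourier k x.2 * φ x) * (eig x.1).1
  · calc _ = ∫ x, (φ x • wave k (fun x => (β * x : ℂ) • P 2 x) x - d1 φ x • wave k (P 0) x) := by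
          refine integral_congr_ae ?_
          filter_upwards [hae 0, hae 2] with x h1 h2
          rw [h1, h2]; simp only [wave, smul_eq_mul]; push_cast; ring
      _ = ∫ x, (φ x • wave k (fun x => (β * x : ℂ) • P 2 x) x + φ x • wave k (P' 0) x) := by
          rw [integral_sub (intx 2) (int1 0), p1, integral_add (intx 2) (int hφ (cP' 0))]
          ring
      _ = _ := by
          refine integral_congr_ae ?_
          filter_upwards [hae' 1] with x h0
          rw [h0]
          simp only [wave, smul_eq_mul]
          linear_combination (fourier k x.2 * φ x) * (eig x.1).2.1
  · calc _ = ∫ x, (-(φ x • wave k (fun x => (β * x : ℂ) • P 1 x) x) - d2 φ x • wave k (P 0) x) := by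
          refine integral_congr_ae ?_
          filter_upwards [hae 0, hae 1] with x h1 h2
          rw [h1, h2]; simp only [wave, smul_eq_mul]; push_cast; ring
      _ = ∫ x, (-(φ x • wave k (fun x => (β * x : ℂ) • P 1 x) x) +
            φ x • wave k (fun x => (Complex.I * k) • P 0 x) x) := by
          rw [integral_sub nx (int2 0), p2, integral_add nx (intI 0)]
          ring
      _ = _ := by
          refine integral_congr_ae ?_
          filter_upwards [hae' 2] with x h0
          rw [h0]
          simp only [wave, smul_eq_mul]
          linear_combination (fourier k x.2 * φ x) * (eig x.1).2.2

end Profile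

end EquatorialWaves

namespace EquatorialWaves

/-! ### The Hilbert basis -/

section Basis

open scoped ComplexConjugate

variable {β : ℝ}

/-- The coefficient of a component of a field on `ψ_m(x₁) e^{i k x₂}`. -/
noncomputable def pairing (β : ℝ) (m k : ℤ) (Φ : L2) (i : Fin 3) : ℂ :=
  ∫ x : Dom, psi β m x.1 * fourier (-k) x.2 * Φ x i

theorem memLp_apply (Φ : L2) (i : Fin 3) : MemLp (fun x => Φ x i) 2 (volume : Measure Dom) :=
  (EuclideanSpace.proj (𝕜 := ℂ) i : Val →L[ℂ] ℂ).comp_memLp' (Lp.memLp Φ)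

theorem integrable_pairing (hβ : 0 < β) (m k : ℤ) (Φ : L2) (i : Fin 3) :
    Integrable fun x : Dom => psi β m x.1 * fourier (-k) x.2 * Φ x i :=
  (integrable_of_memLp_prod (gaussDecay_psi hβ m).ofReal (-k)).integrable_mul (memLp_apply Φ i)

theorem pairing_of_neg {m : ℤ} (hm : m < 0) (k : ℤ) (Φ : L2) (i : Fin 3) :
    pairing β m k Φ i = 0 := by
  simp [pairing, psi_of_neg β hm]

theorem inner_eigvec (hβ : 0 < β) (n : ℕ) (k : ℤ) (j : SignType) (Φ : L2) :
    inner ℂ (eigvec hβ (n, k, j)) Φ =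
      conj (coefA β n k j) * (pairing β (blockIdx n j - 1) k Φ 0 - pairing β (blockIdx n j - 1) k Φ 2) +
      conj (coefB β n k j) * (pairing β (blockIdx n j + 1) k Φ 0 + pairing β (blockIdx n j + 1) k Φ 2) +
      conj (coefC β n k j) * pairing β (blockIdx n j) k Φ 1 := by
  have hi := fun m i => integrable_pairing hβ m k Φ i
  simp only [pairing]
  rw [← integral_sub (hi _ _) (hi _ _), ← integral_add (hi _ _) (hi _ _), ← integral_const_mul,
    ← integral_const_mul, ← integral_const_mul, ← integral_add, ← integral_add, L2.inner_def]
  · refine integral_congr_ae ?_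
    filter_upwards [coeFn_eigvec hβ (n, k, j)] with x hx
    rw [hx, PiLp.inner_apply, Fin.sum_univ_three]
    simp only [wave, PiLp.smul_apply, RCLike.inner_apply, profile_apply_zero, profile_apply_one,
      profile_apply_two, smul_eq_mul, map_mul, map_add, map_neg, Complex.conj_ofReal, psiD,
      ← fourier_neg]
    ring
  · exact (((hi _ _).sub (hi _ _)).const_mul _).add (((hi _ _).add (hi _ _)).const_mul _)
  · exact (hi _ _).const_mul _
  · exact ((hi _ _).sub (hi _ _)).const_mul _
  · exact ((hi _ _).add (hi _ _)).const_mul _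

theorem pairing_eigvec (hβ : 0 < β) (m k : ℤ) (n : ℕ) (k' : ℤ) (j : SignType) (i : Fin 3) :
    pairing β m k (eigvec hβ (n, k', j)) i =
      if k = k' then 2 * Real.pi * ∫ x, (psi β m x : ℂ) * profile β n k' j 0 x i else 0 := by
  have h := integral_wave (k' - k) fun x => (psi β m x : ℂ) * profile β n k' j 0 x i
  have e : pairing β m k (eigvec hβ (n, k', j)) i =
      ∫ x : Dom, wave (k' - k) (fun x => (psi β m x : ℂ) * profile β n k' j 0 x i) x := by
    refine integral_congr_ae ?_
    filter_upwards [coeFn_eigvec hβ (n, k', j)] with x hx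
    rw [hx, sub_eq_add_neg]
    simp only [wave, PiLp.smul_apply, smul_eq_mul, fourier_add]
    ring
  rw [e, h]
  by_cases hk : k = k'
  · simp [hk]
  · rw [if_neg hk, if_neg (by omega)]

theorem integral_psi_mul_combination (hβ : 0 < β) (l m m' : ℤ) (a b : ℂ) :
    ∫ x, (psi β l x : ℂ) * (a * psi β m x + b * psi β m' x) =
      a * (if l = m ∧ 0 ≤ l then 1 else 0) + b * (if l = m' ∧ 0 ≤ l then 1 else 0) := by
  have hi (m : ℤ) : Integrable fun x => ((psi β l x * psi β m x : ℝ) : ℂ) :=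
    ((gaussDecay_psi hβ l).mul (gaussDecay_psi hβ m)).ofReal.integrable
  have hv (m : ℤ) : ∫ x, ((psi β l x * psi β m x : ℝ) : ℂ) = if l = m ∧ 0 ≤ l then 1 else 0 := by
    rw [integral_complex_ofReal, integral_psi_mul_psi hβ]
    split_ifs <;> simp
  rw [← hv m, ← hv m', ← integral_const_mul, ← integral_const_mul, ← integral_add
    ((hi m).const_mul a) ((hi m').const_mul b)]
  refine integral_congr_ae (Eventually.of_forall fun x => ?_)
  simp only
  push_cast
  ring

theorem pairing_eigvec_zero (hβ : 0 < β) (m k : ℤ) (n : ℕ) (k' : ℤ) (j : SignType) :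
    pairing β m k (eigvec hβ (n, k', j)) 0 = if k = k' then 2 * Real.pi *
      (coefA β n k' j * (if m = blockIdx n j - 1 ∧ 0 ≤ m then 1 else 0) +
        coefB β n k' j * (if m = blockIdx n j + 1 ∧ 0 ≤ m then 1 else 0)) else 0 := by
  rw [pairing_eigvec]
  simp only [profile_apply_zero, psiD, integral_psi_mul_combination hβ]

theorem pairing_eigvec_two (hβ : 0 < β) (m k : ℤ) (n : ℕ) (k' : ℤ) (j : SignType) :
    pairing β m k (eigvec hβ (n, k', j)) 2 = if k = k' then 2 * Real.pi *
      (-coefA β n k' j * (if m = blockIdx n j - 1 ∧ 0 ≤ m then 1 else 0) +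
        coefB β n k' j * (if m = blockIdx n j + 1 ∧ 0 ≤ m then 1 else 0)) else 0 := by
  rw [pairing_eigvec]
  simp only [profile_apply_two, psiD, integral_psi_mul_combination hβ]

theorem pairing_eigvec_one (hβ : 0 < β) (m k : ℤ) (n : ℕ) (k' : ℤ) (j : SignType) :
    pairing β m k (eigvec hβ (n, k', j)) 1 = if k = k' then 2 * Real.pi *
      (coefC β n k' j * (if m = blockIdx n j ∧ 0 ≤ m then 1 else 0)) else 0 := by
  rw [pairing_eigvec]
  have h := integral_psi_mul_combination hβ m (blockIdx n j) 0 (coefC β n k' j) 0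
  simp only [zero_mul, add_zero] at h
  simp only [profile_apply_one, psiD, h]

/-- Modes of different blocks are orthogonal because A, B and C each pair with their own kind of
vector. The indicators of nonnegative indices are harmless, since the coefficients vanish wherever
the Hermite function does. -/
theorem inner_eigvec_eigvec (hβ : 0 < β) (n : ℕ) (k : ℤ) (j : SignType) (n' : ℕ) (k' : ℤ)
    (j' : SignType) : inner ℂ (eigvec hβ (n, k, j)) (eigvec hβ (n', k', j')) =
      if k = k' ∧ blockIdx n j = blockIdx n' j' then 2 * Real.pi *
        (2 * (conj (coefA β n k j) * coefA β n' k' j') + 2 * (conj (coefB β n k j) * coefB β n' k' j') +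
          conj (coefC β n k j) * coefC β n' k' j') else 0 := by
  rw [inner_eigvec]
  simp only [pairing_eigvec_zero, pairing_eigvec_one, pairing_eigvec_two]
  by_cases hk : k = k'
  swap
  · simp [hk]
  subst hk
  have hA : blockIdx n j ≤ 0 → coefA β n k j = 0 := coefA_eq_zero
  have hC : blockIdx n j < 0 → coefC β n k j = 0 := coefC_eq_zero
  have hB := neg_one_le_blockIdx n j
  simp only [if_true, true_and]
  by_cases hm : blockIdx n j = blockIdx n' j'
  · rw [← hm]
    simp only [true_and, if_true, if_neg (show ¬(blockIdx n j - 1 = blockIdx n j + 1 ∧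
      0 ≤ blockIdx n j - 1) by omega), if_neg (show ¬(blockIdx n j + 1 = blockIdx n j - 1 ∧
      0 ≤ blockIdx n j + 1) by omega), if_pos (show 0 ≤ blockIdx n j + 1 by omega)]
    have e1 : conj (coefA β n k j) * (if 0 ≤ blockIdx n j - 1 then (1 : ℂ) else 0) =
        conj (coefA β n k j) := by
      split_ifs with h
      · simp
      · rw [hA (by omega)]; simp
    have e2 : conj (coefC β n k j) * (if 0 ≤ blockIdx n j then (1 : ℂ) else 0) =
        conj (coefC β n k j) := by
      split_ifs with h
      · simp
      · rw [hC (by omega)]; simp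
    linear_combination (4 * Real.pi * coefA β n' k j') * e1 + (2 * Real.pi * coefC β n' k j') * e2
  · have e (a b : ℤ) (c : ℤ) (h : a - b ≠ 0) : ¬(a + c = b + c ∧ 0 ≤ a + c) := by omega
    simp only [if_neg (show ¬(blockIdx n j = blockIdx n' j' ∧ 0 ≤ blockIdx n j) by omega),
      if_neg (show ¬(blockIdx n j - 1 = blockIdx n' j' - 1 ∧ 0 ≤ blockIdx n j - 1) by omega),
      if_neg (show ¬(blockIdx n j + 1 = blockIdx n' j' + 1 ∧ 0 ≤ blockIdx n j + 1) by omega),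
      if_neg hm]
    ring

theorem coef_inner_self (hβ : 0 < β) (n : ℕ) (k : ℤ) (j : SignType) : 2 * Real.pi *
    (2 * (conj (coefA β n k j) * coefA β n k j) + 2 * (conj (coefB β n k j) * coefB β n k j) +
      conj (coefC β n k j) * coefC β n k j) = 1 := by
  have := congrArg (fun t : ℝ => (t : ℂ)) (coef_norm hβ n k j)
  simp only [RCLike.conj_mul]
  push_cast at this
  exact this

theorem orthonormal_eigvec (hβ : 0 < β) : Orthonormal ℂ (eigvec hβ) := by
  classical
  rw [orthonormal_iff_ite]
  rintro ⟨n, k, j⟩ ⟨n', k', j'⟩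
  rw [inner_eigvec_eigvec]
  by_cases h : (n, k, j) = (n', k', j')
  · rw [if_pos h]
    obtain ⟨rfl, rfl, rfl⟩ := by simpa using h
    rw [if_pos ⟨rfl, rfl⟩, coef_inner_self hβ]
  · rw [if_neg h]
    split_ifs with h1
    · obtain ⟨rfl, hm⟩ := h1
      have hn : n = n' ∧ ¬(j = 0 ∧ n = 0) ∧ ¬(j' = 0 ∧ n' = 0) := by
        unfold blockIdx at hm
        by_cases a : j = 0 ∧ n = 0 <;> by_cases b : j' = 0 ∧ n' = 0
        · exact absurd (by rw [a.1, a.2, b.1, b.2]) h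
        · rw [if_pos a, if_neg b] at hm
          omega
        · rw [if_neg a, if_pos b] at hm
          omega
        · rw [if_neg a, if_neg b] at hm
          exact ⟨by omega, a, b⟩
      obtain ⟨rfl, a, b⟩ := hn
      have hj : j ≠ j' := fun hj => h (by rw [hj])
      rw [coef_orthogonal hβ hj a b, mul_zero]
    · rfl

/-- The coefficient vectors of a block form a basis. -/
theorem eq_zero_of_coef (hβ : 0 < β) (n : ℕ) (k : ℤ) {u v w : ℂ} (hu : n = 0 → u = 0)
    (h : ∀ j, ¬(j = 0 ∧ n = 0) → conj (coefA β n k j) * u + conj (coefB β n k j) * v +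
      conj (coefC β n k j) * w = 0) : u = 0 ∧ v = 0 ∧ w = 0 := by
  classical
  -- The rows of M are the conjugated modes, and the columns of R are the modes with the weights of
  -- the inner product. For n = 0 the index j = 0 belongs to the Kelvin block, and its slot is
  -- filled by the unit vector in the direction of the absent ψ_{-1}.
  let M : Matrix SignType (Fin 3) ℂ := fun j => if j = 0 ∧ n = 0 then ![1, 0, 0] else
    ![conj (coefA β n k j), conj (coefB β n k j), conj (coefC β n k j)]
  let R : Matrix (Fin 3) SignType ℂ := fun i j => if j = 0 ∧ n = 0 then ![1, 0, 0] i else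
    2 * Real.pi * ![2 * coefA β n k j, 2 * coefB β n k j, coefC β n k j] i
  have hMR : M * R = 1 := by
    ext j j'
    rw [Matrix.mul_apply, Fin.sum_univ_three, Matrix.one_apply]
    simp only [M, R]
    have hA (j : SignType) (h : n = 0) : coefA β n k j = 0 :=
      coefA_eq_zero (by unfold blockIdx; split_ifs <;> omega)
    by_cases hj : j = 0 ∧ n = 0
    · by_cases hj' : j' = 0 ∧ n = 0
      · simp [hj, hj']
      · simp only [if_pos hj, if_neg hj', if_neg fun e : j = j' => hj' ⟨e ▸ hj.1, hj.2⟩]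
        simp [hA j' hj.2]
    · by_cases hj' : j' = 0 ∧ n = 0
      · simp only [if_neg hj, if_pos hj', if_neg fun e : j = j' => hj ⟨e ▸ hj'.1, hj'.2⟩]
        simp [hA j hj'.2]
      · simp only [if_neg hj, if_neg hj']
        simp only [Matrix.cons_val_zero, Matrix.cons_val_one, Matrix.cons_val]
        split_ifs with e
        · subst e
          linear_combination coef_inner_self hβ n k j
        · linear_combination 2 * Real.pi * coef_orthogonal hβ (k := k) e hj hj'
  -- Orthonormality is M R = 1. Since `SignType` has three elements the matrices are square, and R M
  -- = 1 says that the modes span the block.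
  have hRM : R * M = 1 := (Matrix.mul_eq_one_comm_of_card_eq _ _ _ (by decide)).mp hMR
  have hMv : M.mulVec ![u, v, w] = 0 := by
    ext j
    simp only [Matrix.mulVec, dotProduct, Fin.sum_univ_three, M, Pi.zero_apply]
    by_cases hj : j = 0 ∧ n = 0
    · simp [hj, hu hj.2]
    · simp only [if_neg hj]
      simpa using h j hj
  have h0 : ![u, v, w] = 0 := by
    rw [← Matrix.one_mulVec ![u, v, w], ← hRM, ← Matrix.mulVec_mulVec, hMv, Matrix.mulVec_zero]
  exact ⟨congrFun h0 0, congrFun h0 1, congrFun h0 2⟩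

/-- The coefficient of η - u₂ on ψ_n is controlled by block n + 1, that of u₁ by block n, and that
of η + u₂ by block n - 1. For n = 0 the last one is the Kelvin block, so the Kelvin modes are
exactly what completes the system. -/
theorem eq_zero_of_inner_eigvec (hβ : 0 < β) {Φ : L2} (h : ∀ i, inner ℂ (eigvec hβ i) Φ = 0) :
    Φ = 0 := by
  have key (n : ℕ) (k : ℤ) : pairing β ((n : ℤ) - 1) k Φ 0 - pairing β ((n : ℤ) - 1) k Φ 2 = 0 ∧
      pairing β ((n : ℤ) + 1) k Φ 0 + pairing β ((n : ℤ) + 1) k Φ 2 = 0 ∧ pairing β n k Φ 1 = 0 := by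
    refine eq_zero_of_coef hβ n k (fun hn => ?_) fun j hj => ?_
    · rw [pairing_of_neg (by omega), pairing_of_neg (by omega), sub_zero]
    · have := h (n, k, j)
      rw [inner_eigvec, blockIdx, if_neg hj] at this
      exact this
  have kelvin (k : ℤ) : pairing β 0 k Φ 0 + pairing β 0 k Φ 2 = 0 := by
    have h1 := h (0, k, 0)
    have hpi := Real.pi_pos
    rw [inner_eigvec, coefA_eq_zero (by simp [blockIdx]), coefC_eq_zero (by simp [blockIdx])] at h1
    simp only [map_zero, zero_mul, zero_add, add_zero] at h1
    have hb : blockIdx 0 0 + 1 = 0 := by simp [blockIdx]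
    rw [hb] at h1
    refine (mul_eq_zero.mp h1).resolve_left ?_
    rw [coefB, if_pos ⟨rfl, rfl⟩, Complex.conj_ofReal]
    have : (1 / √(4 * Real.pi)) ≠ 0 := by positivity
    exact_mod_cast this
  have h0 (n : ℕ) (k : ℤ) : pairing β n k Φ 0 = 0 ∧ pairing β n k Φ 2 = 0 := by
    have e1 := (key (n + 1) k).1
    have e2 : pairing β n k Φ 0 + pairing β n k Φ 2 = 0 := by
      cases n with
      | zero => exact kelvin k
      | succ n =>
        have := (key n k).2.1
        push_cast
        exact this
    push_cast at e1
    rw [add_sub_cancel_right] at e1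
    exact ⟨by linear_combination (e1 + e2) / 2, by linear_combination (e2 - e1) / 2⟩
  have hz (i : Fin 3) : ∀ᵐ x : Dom, Φ x i = 0 := by
    refine ae_eq_zero_of_integral_psi_fourier_mul hβ (memLp_apply Φ i) fun n k => ?_
    fin_cases i
    · exact (h0 n k).1
    · exact (key n k).2.2
    · exact (h0 n k).2
  apply Lp.ext
  filter_upwards [hz 0, hz 1, hz 2, Lp.coeFn_zero Val 2 (volume : Measure Dom)] with x h0 h1 h2 hx
  rw [hx]
  ext i
  fin_cases i
  · exact h0
  · exact h1
  · exact h2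

/-- The Hilbert basis of eigenvectors. -/
noncomputable def eigBasis (hβ : 0 < β) : HilbertBasis (ℕ × ℤ × SignType) ℂ L2 :=
  HilbertBasis.mkOfOrthogonalEqBot (orthonormal_eigvec hβ) (by
    rw [Submodule.eq_bot_iff]
    intro Φ hΦ
    refine eq_zero_of_inner_eigvec hβ fun i => ?_
    exact (Submodule.mem_orthogonal _ _).mp hΦ _ (Submodule.subset_span ⟨i, rfl⟩))

theorem eigBasis_apply (hβ : 0 < β) (i : ℕ × ℤ × SignType) : eigBasis hβ i = eigvec hβ i := by
  unfold eigBasis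
  rw [HilbertBasis.coe_mkOfOrthogonalEqBot]

end Basis

end EquatorialWaves

namespace EquatorialWaves

/-! ### Eigenspaces -/

section Eigenspace

open scoped ComplexConjugate

variable {β : ℝ}

theorem contDiff_psi (β : ℝ) (m : ℤ) : ContDiff ℝ ∞ (psi β m) := by
  cases m with
  | ofNat n =>
    have h : ContDiff ℝ ∞ fun x : ℝ => Polynomial.aeval (√(2 * β) * x) (Polynomial.hermite n) :=
      (Polynomial.contDiff_aeval _ _).comp (contDiff_const.mul contDiff_id)
    have h2 : ContDiff ℝ ∞ fun x : ℝ => Real.exp (-(β * x ^ 2 / 2)) := by fun_prop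
    exact (contDiff_const.mul h).mul h2
  | negSucc n => exact contDiff_const

theorem contDiff_profile_apply (β : ℝ) (n : ℕ) (k : ℤ) (j : SignType) (i : Fin 3) :
    ContDiff ℝ ∞ fun x => profile β n k j 0 x i := by
  have h (m : ℤ) (v : Val) : ContDiff ℝ ∞ fun x => (psiD β 0 m x : ℂ) • v :=
    (Complex.ofRealCLM.contDiff.comp (contDiff_psi β m)).smul contDiff_const
  exact ((EuclideanSpace.proj (𝕜 := ℂ) i : Val →L[ℂ] ℂ).restrictScalars ℝ).contDiff.comp
    (((h _ _).add (h _ _)).add (h _ _))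

theorem isTest_wave (k : ℤ) {f : ℝ → ℂ} (hf : ContDiff ℝ ∞ f) (hc : HasCompactSupport f) :
    IsTest (wave k f) := by
  refine ⟨?_, ?_⟩
  · have e : pullBack (wave k f) = fun y : ℝ × ℝ =>
        Complex.exp (2 * Real.pi * Complex.I * k * y.2 / (2 * Real.pi : ℝ)) * f y.1 := by
      funext y
      simp only [pullBack, wave, fourier_coe_apply, smul_eq_mul]
    rw [e]
    have h1 : ContDiff ℝ ∞ fun y : ℝ × ℝ => (y.2 : ℂ) := Complex.ofRealCLM.contDiff.comp contDiff_snd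
    exact (Complex.contDiff_exp.comp ((contDiff_const.mul h1).div_const _)).mul (hf.comp contDiff_fst)
  · refine HasCompactSupport.intro (K := tsupport f ×ˢ Set.univ) (hc.prod isCompact_univ) fun x hx => ?_
    have : x.1 ∉ tsupport f := fun h => hx ⟨h, trivial⟩
    rw [wave, image_eq_zero_of_notMem_tsupport this, smul_zero]

theorem HasDir.dirDeriv_eq {v : ℝ × ℝ} {F F' : Dom → ℂ} (h : HasDir v F F') : dirDeriv v F = F' :=
  funext fun x => (h x).deriv

/-- The pairing of a component of a field with a wave. -/
noncomputable def waveIntegral (Φ : L2) (k : ℤ) (i : Fin 3) (f : ℝ → ℂ) : ℂ :=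
  ∫ x, Φ x i * wave k f x

theorem integrable_mul_wave (Φ : L2) (k : ℤ) (i : Fin 3) {f : ℝ → ℂ} (hf : GaussDecay f) :
    Integrable fun x => Φ x i * wave k f x :=
  (memLp_apply Φ i).integrable_mul (memLp_wave k hf)

theorem waveIntegral_add (Φ : L2) (k : ℤ) (i : Fin 3) {f g : ℝ → ℂ} (hf : GaussDecay f)
    (hg : GaussDecay g) : waveIntegral Φ k i (fun x => f x + g x) =
      waveIntegral Φ k i f + waveIntegral Φ k i g := by
  rw [waveIntegral, waveIntegral, waveIntegral,
    ← integral_add (integrable_mul_wave Φ k i hf) (integrable_mul_wave Φ k i hg)]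
  refine integral_congr_ae (Eventually.of_forall fun x => ?_)
  simp only [wave, smul_eq_mul]
  ring

theorem waveIntegral_const_mul (Φ : L2) (k : ℤ) (i : Fin 3) (c : ℂ) (f : ℝ → ℂ) :
    waveIntegral Φ k i (fun x => c * f x) = c * waveIntegral Φ k i f := by
  rw [waveIntegral, waveIntegral, ← integral_const_mul]
  refine integral_congr_ae (Eventually.of_forall fun x => ?_)
  simp only [wave, smul_eq_mul]
  ring

theorem tendsto_waveIntegral (Φ : L2) (k : ℤ) (i : Fin 3) {u : ℕ → ℝ → ℂ} {f g : ℝ → ℂ}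
    (hg : GaussDecay g) (hu : ∀ n, Continuous (u n)) (hb : ∀ n x, ‖u n x‖ ≤ ‖g x‖)
    (hlim : ∀ x, Tendsto (fun n => u n x) atTop (𝓝 (f x))) :
    Tendsto (fun n => waveIntegral Φ k i (u n)) atTop (𝓝 (waveIntegral Φ k i f)) := by
  refine tendsto_integral_of_dominated_convergence _ (fun n => ?_)
    (integrable_mul_wave Φ k i hg).norm (fun n => Eventually.of_forall fun x => ?_)
    (Eventually.of_forall fun x => ?_)
  · exact (memLp_apply Φ i).1.mul (continuous_wave (hu n)).aestronglyMeasurable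
  · rw [norm_mul, norm_mul, norm_wave, norm_wave]
    exact mul_le_mul_of_nonneg_left (hb n x.1) (norm_nonneg _)
  · exact ((hlim x.1).const_smul _).const_mul _

/-- The truncation of `f` at distance `n + 1`. -/
noncomputable def truncate (n : ℕ) (f : ℝ → ℂ) (x : ℝ) : ℂ :=
  (((⟨1, 2, one_pos, one_lt_two⟩ : ContDiffBump (0 : ℝ)) (x / (n + 1)) : ℝ) : ℂ) * f x

theorem contDiff_truncate (n : ℕ) {f : ℝ → ℂ} (hf : ContDiff ℝ ∞ f) :
    ContDiff ℝ ∞ (truncate n f) := by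
  refine (Complex.ofRealCLM.contDiff.comp ?_).mul hf
  exact (ContDiffBump.contDiff _).comp (contDiff_id.div_const _)

theorem hasCompactSupport_truncate (n : ℕ) (f : ℝ → ℂ) : HasCompactSupport (truncate n f) := by
  refine HasCompactSupport.intro (isCompact_closedBall (0 : ℝ) (2 * (n + 1))) fun x hx => ?_
  rw [truncate, ContDiffBump.zero_of_le_dist, Complex.ofReal_zero, zero_mul]
  rw [Metric.mem_closedBall, not_le, dist_zero_right] at hx
  rw [dist_zero_right, norm_div, le_div_iff₀ (norm_pos_iff.mpr (by positivity))]
  refine le_trans (le_of_eq ?_) hx.le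
  rw [Real.norm_of_nonneg (by positivity)]

theorem norm_truncate_le (n : ℕ) (f : ℝ → ℂ) (x : ℝ) : ‖truncate n f x‖ ≤ ‖f x‖ := by
  rw [truncate, norm_mul, Complex.norm_real, Real.norm_of_nonneg (ContDiffBump.nonneg _)]
  exact mul_le_of_le_one_left (norm_nonneg _) (ContDiffBump.le_one _)

theorem tendsto_truncate (f : ℝ → ℂ) (x : ℝ) :
    Tendsto (fun n => truncate n f x) atTop (𝓝 (f x)) := by
  refine tendsto_const_nhds.congr' ?_
  filter_upwards [eventually_ge_atTop ⌈|x|⌉₊] with n hn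
  rw [truncate, ContDiffBump.one_of_mem_closedBall, Complex.ofReal_one, one_mul]
  have h1 : |x| ≤ n := (Nat.le_ceil _).trans (by exact_mod_cast hn)
  rw [Metric.mem_closedBall, dist_zero_right, norm_div, Real.norm_eq_abs,
    Real.norm_of_nonneg (by positivity : (0 : ℝ) ≤ n + 1)]
  exact (div_le_one (by positivity)).mpr (h1.trans (by simp))

/-- The derivative of the truncations. -/
theorem exists_hasDerivAt_truncate {f f' : ℝ → ℂ} (h : ∀ x, HasDerivAt f (f' x) x)
    (hf' : Continuous f') : ∃ M : ℝ, 0 ≤ M ∧ ∃ u : ℕ → ℝ → ℂ,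
      (∀ n x, HasDerivAt (truncate n f) (u n x) x) ∧ (∀ n, Continuous (u n)) ∧
      (∀ n x, ‖u n x‖ ≤ M * ‖f x‖ + ‖f' x‖) ∧ ∀ x, Tendsto (fun n => u n x) atTop (𝓝 (f' x)) := by
  set χ : ContDiffBump (0 : ℝ) := ⟨1, 2, one_pos, one_lt_two⟩ with hχ
  have hs : ContDiff ℝ ∞ χ := χ.contDiff
  have hcd : Continuous (deriv χ) := hs.continuous_deriv (by simp)
  obtain ⟨M, hM⟩ := hcd.bounded_above_of_compact_support χ.hasCompactSupport.deriv
  have hM0 : 0 ≤ M := (norm_nonneg _).trans (hM 0)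
  have hf : Continuous f := continuous_iff_continuousAt.mpr fun x => (h x).continuousAt
  -- The derivative of the rescaled cutoff carries a factor 1/(n + 1). It is bounded by M uniformly
  -- and disappears in the limit.
  refine ⟨M, hM0, fun n x => ((deriv χ (x / (n + 1)) * (1 / (n + 1)) : ℝ) : ℂ) * f x +
    truncate n f' x, fun n x => ?_, fun n => ?_, fun n x => ?_, fun x => ?_⟩
  · have h1 : HasDerivAt (fun x : ℝ => χ (x / (n + 1))) (deriv χ (x / (n + 1)) * (1 / (n + 1))) x :=
      ((hs.differentiable (by simp) _).hasDerivAt).comp x ((hasDerivAt_id x).div_const _)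
    exact h1.ofReal_comp.mul (h x)
  · have h1 : Continuous (truncate n f') := by
      unfold truncate
      exact (Complex.continuous_ofReal.comp (χ.continuous.comp (by fun_prop))).mul hf'
    have h2 : Continuous fun x : ℝ => deriv χ (x / (n + 1)) := hcd.comp (by fun_prop)
    fun_prop
  · refine (norm_add_le _ _).trans (add_le_add ?_ (norm_truncate_le n f' x))
    rw [norm_mul, Complex.norm_real, norm_mul]
    refine mul_le_mul_of_nonneg_right ?_ (norm_nonneg _)
    refine (mul_le_of_le_one_right (norm_nonneg _) ?_).trans (hM _)
    rw [Real.norm_of_nonneg (by positivity), div_le_one (by positivity)]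
    simp
  · have h1 : Tendsto (fun n : ℕ => ((deriv χ (x / (n + 1)) * (1 / (n + 1)) : ℝ) : ℂ) * f x) atTop
        (𝓝 0) := by
      have h2 : Tendsto (fun n : ℕ => deriv χ (x / (n + 1)) * (1 / ((n : ℝ) + 1))) atTop (𝓝 0) := by
        refine squeeze_zero_norm (a := fun n : ℕ => M * (1 / ((n : ℝ) + 1))) (fun n => ?_) ?_
        · rw [norm_mul, Real.norm_of_nonneg (by positivity : (0 : ℝ) ≤ 1 / ((n : ℝ) + 1))]
          exact mul_le_mul_of_nonneg_right (hM _) (by positivity)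
        · simpa using tendsto_one_div_add_atTop_nhds_zero_nat.const_mul M
      have h3 := (Complex.continuous_ofReal.tendsto 0).comp h2
      simpa [Function.comp_def] using h3.mul_const (f x)
    simpa using h1.add (tendsto_truncate f' x)

/-- The distributional equations may be tested against waves with smooth, rapidly decreasing
profiles. -/
theorem LEq.wave {Φ G : L2} (h : LEq β Φ G) (k : ℤ) {f f' : ℝ → ℂ}
    (hs : ContDiff ℝ ∞ f) (hd : ∀ x, HasDerivAt f (f' x) x) (hf : GaussDecay f)
    (hf' : GaussDecay f') (hx : GaussDecay fun x : ℝ => (β * x : ℂ) * f x) :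
    (-waveIntegral Φ k 1 f' - Complex.I * k * waveIntegral Φ k 2 f = waveIntegral G k 0 f) ∧
    (waveIntegral Φ k 2 (fun x => (β * x : ℂ) * f x) - waveIntegral Φ k 0 f' =
      waveIntegral G k 1 f) ∧
    (-waveIntegral Φ k 1 (fun x => (β * x : ℂ) * f x) - Complex.I * k * waveIntegral Φ k 0 f =
      waveIntegral G k 2 f) := by
  -- A wave with rapidly decreasing profile need not have compact support. It is truncated, and
  -- every term passes to the limit by dominated convergence.
  obtain ⟨M, hM, u, hu, huc, hub, hul⟩ := exists_hasDerivAt_truncate hd hf'.1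
  have ct (n : ℕ) : Continuous (truncate n f) := (contDiff_truncate n hs).continuous
  have cx (n : ℕ) : Continuous fun x : ℝ => (β * x : ℂ) * truncate n f x := by
    have := ct n; fun_prop
  have gn (n : ℕ) : GaussDecay (truncate n f) :=
    hf.of_norm_le (ct n) 1 fun x => (norm_truncate_le n f x).trans_eq (one_mul _).symm
  have hB : GaussDecay fun x => ((M * ‖f x‖ + ‖f' x‖ : ℝ) : ℂ) := by
    have a1 : GaussDecay fun x => ‖f x‖ := hf.of_norm_le hf.1.norm 1 fun x => by simp
    have a2 : GaussDecay fun x => ‖f' x‖ := hf'.of_norm_le hf'.1.norm 1 fun x => by simp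
    exact ((a1.const_mul M).add a2).ofReal
  have hub' (n : ℕ) (x : ℝ) : ‖u n x‖ ≤ ‖((M * ‖f x‖ + ‖f' x‖ : ℝ) : ℂ)‖ := by
    rw [Complex.norm_real, Real.norm_of_nonneg (by positivity)]
    exact hub n x
  have gu (n : ℕ) : GaussDecay (u n) :=
    hB.of_norm_le (huc n) 1 fun x => by simpa using hub' n x
  have bx (n : ℕ) (x : ℝ) : ‖(β * x : ℂ) * truncate n f x‖ ≤ ‖(β * x : ℂ) * f x‖ := by
    rw [norm_mul, norm_mul _ (f x)]
    exact mul_le_mul_of_nonneg_left (norm_truncate_le n f x) (norm_nonneg _)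
  have gx (n : ℕ) : GaussDecay fun x : ℝ => (β * x : ℂ) * truncate n f x :=
    hx.of_norm_le (cx n) 1 fun x => by simpa using bx n x
  have t0 (A : L2) (i : Fin 3) : Tendsto (fun n => waveIntegral A k i (truncate n f)) atTop
      (𝓝 (waveIntegral A k i f)) :=
    tendsto_waveIntegral A k i hf ct (fun n x => norm_truncate_le n f x) (tendsto_truncate f)
  have t1 (i : Fin 3) : Tendsto (fun n => waveIntegral Φ k i (u n)) atTop
      (𝓝 (waveIntegral Φ k i f')) := tendsto_waveIntegral Φ k i hB huc hub' hul
  have t2 (i : Fin 3) : Tendsto (fun n => waveIntegral Φ k i (fun x => (β * x : ℂ) * truncate n f x))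
      atTop (𝓝 (waveIntegral Φ k i fun x => (β * x : ℂ) * f x)) :=
    tendsto_waveIntegral Φ k i hx cx bx fun x => (tendsto_truncate f x).const_mul _
  have key (n : ℕ) :
      (-waveIntegral Φ k 1 (u n) - Complex.I * k * waveIntegral Φ k 2 (truncate n f) =
        waveIntegral G k 0 (truncate n f)) ∧
      (waveIntegral Φ k 2 (fun x => (β * x : ℂ) * truncate n f x) - waveIntegral Φ k 0 (u n) =
        waveIntegral G k 1 (truncate n f)) ∧
      (-waveIntegral Φ k 1 (fun x => (β * x : ℂ) * truncate n f x) -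
        Complex.I * k * waveIntegral Φ k 0 (truncate n f) = waveIntegral G k 2 (truncate n f)) := by
    have hT : IsTest (EquatorialWaves.wave k (truncate n f)) :=
      isTest_wave k (contDiff_truncate n hs) (hasCompactSupport_truncate n f)
    have e1 : d1 (EquatorialWaves.wave k (truncate n f)) = EquatorialWaves.wave k (u n) :=
      (hasDir_wave_one (hu n)).dirDeriv_eq
    have e2 : d2 (EquatorialWaves.wave k (truncate n f)) = fun x =>
        Complex.I * k * EquatorialWaves.wave k (truncate n f) x := by
      refine (hasDir_wave_two k (truncate n f)).dirDeriv_eq.trans (funext fun x => ?_)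
      simp only [EquatorialWaves.wave, smul_eq_mul]; ring
    have e3 : (fun x : Dom => ((β * x.1 : ℝ) : ℂ) * EquatorialWaves.wave k (truncate n f) x) =
        EquatorialWaves.wave k (fun x => (β * x : ℂ) * truncate n f x) := by
      funext x
      simp only [EquatorialWaves.wave, smul_eq_mul]; push_cast; ring
    have e3' (x : Dom) := congrFun e3 x
    obtain ⟨a0, a1, a2⟩ := h _ hT
    simp only [e1, e2, e3'] at a0 a1 a2
    have j0 (i : Fin 3) := integrable_mul_wave Φ k i (gn n)
    have j1 (i : Fin 3) := integrable_mul_wave Φ k i (gu n)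
    have j2 (i : Fin 3) := integrable_mul_wave Φ k i (gx n)
    have c (i : Fin 3) : (fun x => Φ x i * (Complex.I * k * EquatorialWaves.wave k (truncate n f) x)) =
        fun x => Complex.I * k * (Φ x i * EquatorialWaves.wave k (truncate n f) x) := by
      funext x; ring
    have j0' (i : Fin 3) : Integrable fun x =>
        Φ x i * (Complex.I * k * EquatorialWaves.wave k (truncate n f) x) := by
      rw [c i]; exact (j0 i).const_mul _
    have j1n : Integrable fun x => -(Φ x 1 * EquatorialWaves.wave k (u n) x) := (j1 1).neg
    have j2n : Integrable fun x =>
      -(Φ x 1 * EquatorialWaves.wave k (fun x => (β * x : ℂ) * truncate n f x) x) := (j2 1).neg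
    rw [integral_sub j1n (j0' 2), integral_neg, c, integral_const_mul] at a0
    rw [integral_sub (j2 2) (j1 0)] at a1
    rw [integral_sub j2n (j0' 0), integral_neg, c, integral_const_mul] at a2
    exact ⟨a0, a1, a2⟩
  refine ⟨tendsto_nhds_unique (((t1 1).neg.sub ((t0 Φ 2).const_mul _)).congr fun n => (key n).1)
    (t0 G 0), tendsto_nhds_unique (((t2 2).sub (t1 0)).congr fun n => (key n).2.1) (t0 G 1),
    tendsto_nhds_unique (((t2 1).neg.sub ((t0 Φ 0).const_mul _)).congr fun n => (key n).2.2)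
    (t0 G 2)⟩

theorem waveIntegral_smul (μ : ℂ) (Φ : L2) (k : ℤ) (i : Fin 3) (f : ℝ → ℂ) :
    waveIntegral (μ • Φ) k i f = μ * waveIntegral Φ k i f := by
  rw [waveIntegral, waveIntegral, ← integral_const_mul]
  refine integral_congr_ae ?_
  filter_upwards [Lp.coeFn_smul μ Φ] with x hx
  rw [hx, Pi.smul_apply, PiLp.smul_apply, smul_eq_mul, mul_assoc]

/-- `L` is skew-symmetric with respect to the eigenvectors. -/
theorem eigenvalue_mul_inner_eigvec (hβ : 0 < β) {μ : ℂ} {Φ : L2} (h : LEq β Φ (μ • Φ)) (n : ℕ)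
    (k : ℤ) (j : SignType) : Complex.I * tau β n k j * inner ℂ (eigvec hβ (n, k, j)) Φ =
      μ * inner ℂ (eigvec hβ (n, k, j)) Φ := by
  set P : Fin 3 → ℝ → ℂ := fun i x => conj (profile β n k j 0 x i) with hP
  set P' : Fin 3 → ℝ → ℂ := fun i x => conj (profile β n k j 1 x i) with hP'
  have gd (a : ℕ) (i : Fin 3) : GaussDecay fun x => conj (profile β n k j a x i) :=
    (gaussDecay_profile hβ n k j a).of_norm_le
      (Complex.continuous_conj.comp (continuous_profile_apply hβ n k j a i)) 1 fun x => by
        rw [RCLike.norm_conj, one_mul]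
        exact PiLp.norm_apply_le _ _
  have gP (i : Fin 3) : GaussDecay (P i) := gd 0 i
  have gP' (i : Fin 3) : GaussDecay (P' i) := gd 1 i
  have gx (i : Fin 3) : GaussDecay fun x : ℝ => (β * x : ℂ) * P i x := by
    have h1 := ((gP i).pow_smul 1).const_smul (β : ℂ)
    refine h1.congr fun x => ?_
    simp
    ring
  have hs (i : Fin 3) : ContDiff ℝ ∞ (P i) :=
    Complex.conjCLE.contDiff.comp (contDiff_profile_apply β n k j i)
  have hd (i : Fin 3) (x : ℝ) : HasDerivAt (P i) (P' i x) x :=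
    (hasDerivAt_profile_apply hβ n k j 0 i x).star
  -- The weak formulation is bilinear, whereas the inner product is conjugate-linear in the mode.
  -- Hence the conjugated profiles and the frequency -k.
  have eqs (i : Fin 3) := h.wave (-k) (hs i) (hd i) (gP i) (gP' i) (gx i)
  simp only [waveIntegral_smul] at eqs
  have a0 := (eqs 0).1
  have a1 := (eqs 1).2.1
  have a2 := (eqs 2).2.2
  push_cast at a0 a1 a2
  have eig (x : ℝ) := profile_eigen hβ n k j x
  have J1 : Complex.I * tau β n k j * waveIntegral Φ (-k) 1 (P 1) =
      (-1) * waveIntegral Φ (-k) 1 (fun x => (β * x : ℂ) * P 2 x) +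
        (-1) * waveIntegral Φ (-k) 1 (P' 0) := by
    rw [← waveIntegral_const_mul, ← waveIntegral_const_mul, ← waveIntegral_const_mul,
      ← waveIntegral_add _ _ _ ((gx 2).const_mul (-1)) ((gP' 0).const_mul (-1))]
    congr 1
    funext x
    have := congrArg conj (eig x).2.1
    simp only [map_mul, map_add, Complex.conj_ofReal, Complex.conj_I] at this
    simp only [hP, hP']
    linear_combination this
  have J2 : Complex.I * tau β n k j * waveIntegral Φ (-k) 2 (P 2) =
      waveIntegral Φ (-k) 2 (fun x => (β * x : ℂ) * P 1 x) +
        Complex.I * k * waveIntegral Φ (-k) 2 (P 0) := by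
    rw [← waveIntegral_const_mul, ← waveIntegral_const_mul,
      ← waveIntegral_add _ _ _ (gx 1) ((gP 0).const_mul _)]
    congr 1
    funext x
    have := congrArg conj (eig x).2.2
    simp only [map_mul, map_add, map_neg, Complex.conj_ofReal, Complex.conj_I, map_intCast] at this
    simp only [hP]
    linear_combination this
  have J0 : Complex.I * tau β n k j * waveIntegral Φ (-k) 0 (P 0) =
      (-1) * waveIntegral Φ (-k) 0 (P' 1) + Complex.I * k * waveIntegral Φ (-k) 0 (P 2) := by
    rw [← waveIntegral_const_mul, ← waveIntegral_const_mul, ← waveIntegral_const_mul,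
      ← waveIntegral_add _ _ _ ((gP' 1).const_mul _) ((gP 2).const_mul _)]
    congr 1
    funext x
    have := congrArg conj (eig x).1
    simp only [map_mul, map_add, Complex.conj_ofReal, Complex.conj_I, map_intCast] at this
    simp only [hP, hP']
    linear_combination this
  have hin : inner ℂ (eigvec hβ (n, k, j)) Φ = waveIntegral Φ (-k) 0 (P 0) +
      waveIntegral Φ (-k) 1 (P 1) + waveIntegral Φ (-k) 2 (P 2) := by
    have I (i : Fin 3) := integrable_mul_wave Φ (-k) i (gP i)
    simp only [waveIntegral]
    have I01 : Integrable fun x => Φ x 0 * wave (-k) (P 0) x + Φ x 1 * wave (-k) (P 1) x :=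
      (I 0).add (I 1)
    rw [← integral_add (I 0) (I 1), ← integral_add I01 (I 2), L2.inner_def]
    refine integral_congr_ae ?_
    filter_upwards [coeFn_eigvec hβ (n, k, j)] with x hx
    rw [hx, PiLp.inner_apply, Fin.sum_univ_three]
    simp only [wave, PiLp.smul_apply, RCLike.inner_apply, smul_eq_mul, map_mul, ← fourier_neg, hP]
  rw [hin]
  -- In the sum, every term of the conjugated profile equations cancels one of the weak equations:
  -- this is the skew-symmetry of L.
  linear_combination J0 + J1 + J2 + a0 + a1 + a2

/-- An element of the eigenspace has zero coefficient on every mode with iτ ≠ μ. Only finitely many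
modes remain, so its expansion is a finite sum over a fixed set. -/
theorem finiteDimensional_eigenspace (hβ : 0 < β) {μ : ℂ} (hμ : μ ≠ 0) :
    FiniteDimensional ℂ (eigenspace β μ) := by
  set S : Set (ℕ × ℤ × SignType) := {i | Complex.I * (tau β i.1 i.2.1 i.2.2 : ℂ) = μ} with hS
  have hfin : S.Finite := by
    by_cases hne : S.Nonempty
    · obtain ⟨i₀, h₀⟩ := hne
      have ht : tau β i₀.1 i₀.2.1 i₀.2.2 ≠ 0 := by
        intro h
        rw [hS, Set.mem_ofPred_eq, h, Complex.ofReal_zero, mul_zero] at h₀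
        exact hμ h₀.symm
      refine (finite_tau_eq hβ ht).subset fun i hi => ?_
      have h1 : Complex.I * (tau β i.1 i.2.1 i.2.2 : ℂ) =
        Complex.I * (tau β i₀.1 i₀.2.1 i₀.2.2 : ℂ) := hi.trans h₀.symm
      exact_mod_cast mul_left_cancel₀ Complex.I_ne_zero h1
    · rw [Set.not_nonempty_iff_eq_empty.mp hne]
      exact Set.finite_empty
  have hle : eigenspace β μ ≤ Submodule.span ℂ (eigvec hβ '' S) := by
    intro Φ hΦ
    have h0 : ∀ i, i ∉ hfin.toFinset → (inner ℂ (eigvec hβ i) Φ : ℂ) • eigvec hβ i = 0 := by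
      intro i hi
      have h1 := eigenvalue_mul_inner_eigvec hβ hΦ i.1 i.2.1 i.2.2
      have h2 : (Complex.I * (tau β i.1 i.2.1 i.2.2 : ℂ) - μ) * inner ℂ (eigvec hβ i) Φ = 0 := by
        linear_combination h1
      rw [Set.Finite.mem_toFinset] at hi
      rw [(mul_eq_zero.mp h2).resolve_left (fun h => hi (sub_eq_zero.mp h)), zero_smul]
    have h1 := (eigBasis hβ).hasSum_repr Φ
    simp only [HilbertBasis.repr_apply_apply, eigBasis_apply] at h1
    rw [h1.unique (hasSum_sum_of_ne_finset_zero h0)]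
    refine Submodule.sum_mem _ fun i hi => Submodule.smul_mem _ _ (Submodule.subset_span ?_)
    exact ⟨i, by simpa using hi, rfl⟩
  have : FiniteDimensional ℂ (Submodule.span ℂ (eigvec hβ '' S)) :=
    FiniteDimensional.span_of_finite ℂ (hfin.image _)
  exact Submodule.finiteDimensional_of_le hle

end Eigenspace

end EquatorialWaves

namespace EquatorialWaves

/-! ### The norms of `W^{s,∞}` -/

section WeakDerivatives

theorem IsTest.iterate_dirDeriv {φ : Dom → ℂ} (h : IsTest φ) (v : ℝ × ℝ) (b : ℕ) :
    IsTest ((EquatorialWaves.dirDeriv v)^[b] φ) := by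
  induction b generalizing φ with
  | zero => exact h
  | succ b ih => exact ih (h.dirDeriv v)

theorem integral_iterate_d2_smul_wave {φ : Dom → ℂ} (hφ : IsTest φ) (k : ℤ) {V : ℝ → Val}
    (hV : Continuous V) (b : ℕ) : ∫ x, (d2^[b] φ) x • wave k V x =
      (-1 : ℂ) ^ b • ∫ x, φ x • wave k (fun x => (Complex.I * k) ^ b • V x) x := by
  induction b generalizing φ with
  | zero => simp
  | succ b ih =>
    have hc (b : ℕ) : Continuous fun x => (Complex.I * (k : ℂ)) ^ b • V x :=
      hV.fun_const_smul ((Complex.I * (k : ℂ)) ^ b)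
    have e := integral_dirDeriv_smul hφ (hasDir_wave_two k fun x => (Complex.I * (k : ℂ)) ^ b • V x)
      (continuous_wave (hc b)) (continuous_wave (by
        simp only [smul_smul, ← pow_succ']; exact hc (b + 1)))
    rw [Function.iterate_succ_apply]
    refine (ih (hφ.dirDeriv (0, 1))).trans ?_
    rw [e]
    simp only [smul_smul, ← pow_succ']
    rw [pow_succ (-1 : ℂ), mul_neg_one, neg_smul, smul_neg]

theorem integral_iterate_d1_smul_wave {φ : Dom → ℂ} (hφ : IsTest φ) (k : ℤ) {V : ℕ → ℝ → Val}
    (hV : ∀ a x, HasDerivAt (V a) (V (a + 1) x) x) (a : ℕ) : ∫ x, (d1^[a] φ) x • wave k (V 0) x =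
      (-1 : ℂ) ^ a • ∫ x, φ x • wave k (V a) x := by
  induction a generalizing φ with
  | zero => simp
  | succ a ih =>
    have hc (a : ℕ) : Continuous (V a) :=
      continuous_iff_continuousAt.mpr fun x => (hV a x).continuousAt
    have e := integral_dirDeriv_smul hφ (hasDir_wave_one (k := k) (hV a))
      (continuous_wave (hc a)) (continuous_wave (hc (a + 1)))
    rw [Function.iterate_succ_apply]
    refine (ih (hφ.dirDeriv (1, 0))).trans ?_
    rw [e, pow_succ (-1 : ℂ), mul_neg_one, neg_smul, smul_neg]

theorem isWeakDeriv_wave (k : ℤ) {V : ℕ → ℝ → Val} (hV : ∀ a x, HasDerivAt (V a) (V (a + 1) x) x)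
    (α : ℕ × ℕ) :
    IsWeakDeriv α (wave k (V 0)) (wave k fun x => (Complex.I * (k : ℂ)) ^ α.2 • V α.1 x) := by
  have hc (a : ℕ) : Continuous (V a) :=
    continuous_iff_continuousAt.mpr fun x => (hV a x).continuousAt
  refine ⟨(continuous_wave (hc 0)).locallyIntegrable,
    (continuous_wave ((hc α.1).fun_const_smul ((Complex.I * (k : ℂ)) ^ α.2))).locallyIntegrable, fun φ hφ => ?_⟩
  have h2 : IsTest (d2^[α.2] φ) := hφ.iterate_dirDeriv (0, 1) α.2
  rw [integral_iterate_d1_smul_wave h2 k hV, integral_iterate_d2_smul_wave hφ k (hc α.1), smul_smul,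
    pow_add]

end WeakDerivatives

/-! ### Lipschitz bounds for waves and interpolation to Hölder seminorms. -/

section Lipschitz

/-- After factoring out one character, the representative of x - y of least absolute value reduces
this to |e^{is} - 1| ≤ |s|. -/
theorem norm_fourier_sub_le (k : ℤ) (x y : Torus) :
    ‖(fourier k x - fourier k y : ℂ)‖ ≤ |(k : ℝ)| * dist x y := by
  have key (t : Torus) : ‖(fourier k t - 1 : ℂ)‖ ≤ |(k : ℝ)| * ‖t‖ := by
    obtain ⟨r, rfl⟩ := QuotientAddGroup.mk_surjective t
    set r' : ℝ := r - round ((2 * Real.pi)⁻¹ * r) * (2 * Real.pi) with hr'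
    have e : (QuotientAddGroup.mk r : Torus) = ((r' : ℝ) : Torus) := by
      rw [hr', AddCircle.coe_sub, ← zsmul_eq_mul, AddCircle.coe_zsmul, AddCircle.coe_period,
        smul_zero, sub_zero]
    have hn : ‖(QuotientAddGroup.mk r : Torus)‖ = |r'| := AddCircle.norm_eq _
    rw [hn, e, fourier_coe_apply, ← abs_mul]
    have hpi : (Real.pi : ℂ) ≠ 0 := by exact_mod_cast Real.pi_ne_zero
    have h2 : 2 * Real.pi * Complex.I * k * r' / (2 * Real.pi : ℝ) =
        Complex.I * ((k * r' : ℝ) : ℂ) := by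
      push_cast; field_simp
    rw [h2]
    exact Real.norm_exp_I_mul_ofReal_sub_one_le
  have h : (fourier k x - fourier k y : ℂ) = fourier k y * (fourier k (x - y) - 1) := by
    have : (fourier k x : ℂ) = fourier k y * fourier k (x - y) := by
      simp only [fourier_apply, ← Circle.coe_mul, ← AddCircle.toCircle_add, ← smul_add,
        add_sub_cancel]
    rw [this]; ring
  rw [h, norm_mul, norm_fourier_apply, one_mul, dist_eq_norm]
  exact key _

theorem norm_wave_sub_le (k : ℤ) {V V' : ℝ → Val} (hV : ∀ x, HasDerivAt V (V' x) x) {M M' : ℝ}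
    (hM : ∀ x, ‖V x‖ ≤ M) (hM' : ∀ x, ‖V' x‖ ≤ M') (x y : Dom) :
    ‖wave k V x - wave k V y‖ ≤ (M' + |(k : ℝ)| * M) * dist x y := by
  have h0 : 0 ≤ M := (norm_nonneg _).trans (hM 0)
  have h0' : 0 ≤ M' := (norm_nonneg _).trans (hM' 0)
  have e : wave k V x - wave k V y = (fourier k x.2 : ℂ) • (V x.1 - V y.1) +
      (fourier k x.2 - fourier k y.2 : ℂ) • V y.1 := by
    simp only [wave, smul_sub, sub_smul]; abel
  have h1 : ‖V x.1 - V y.1‖ ≤ M' * dist x y := by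
    refine ((convex_univ (𝕜 := ℝ)).norm_image_sub_le_of_norm_hasDerivWithin_le
      (fun z _ => (hV z).hasDerivWithinAt) (fun z _ => hM' z) (Set.mem_univ y.1)
      (Set.mem_univ x.1)).trans ?_
    rw [← dist_eq_norm]
    exact mul_le_mul_of_nonneg_left (le_max_left _ _) h0'
  have h2 : ‖(fourier k x.2 - fourier k y.2 : ℂ)‖ ≤ |(k : ℝ)| * dist x y :=
    (norm_fourier_sub_le k x.2 y.2).trans
      (mul_le_mul_of_nonneg_left (le_max_right _ _) (abs_nonneg _))
  rw [e]
  refine (norm_add_le _ _).trans ?_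
  rw [norm_smul, norm_smul, norm_fourier_apply, one_mul, add_mul]
  refine add_le_add h1 ?_
  calc _ ≤ |(k : ℝ)| * dist x y * M := mul_le_mul h2 (hM _) (norm_nonneg _) (by positivity)
    _ = _ := by ring

/-- Interpolation through min(1, t) ≤ t^σ with t = N · dist x y. -/
theorem holderSeminorm_le {g : Dom → Val} {M N σ : ℝ} (hM : 0 ≤ M) (hN : 0 ≤ N) (hσ : 0 < σ)
    (hσ1 : σ < 1) (h : ∀ x y, ‖g x - g y‖ ≤ M) (h' : ∀ x y, ‖g x - g y‖ ≤ M * (N * dist x y)) :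
    holderSeminorm σ g ≤ ENNReal.ofReal (M * N ^ σ) := by
  refine iSup₂_le fun x y => ENNReal.div_le_of_le_mul ?_
  have hd : 0 ≤ dist x y := dist_nonneg
  rw [edist_dist, edist_dist, ENNReal.ofReal_rpow_of_nonneg hd hσ.le,
    ← ENNReal.ofReal_mul (by positivity), dist_eq_norm (g x)]
  refine ENNReal.ofReal_le_ofReal ?_
  rw [mul_assoc, ← Real.mul_rpow hN hd]
  obtain ht | ht := le_total (N * dist x y) 1
  · refine (h' x y).trans (mul_le_mul_of_nonneg_left ?_ hM)
    exact Real.self_le_rpow_of_le_one (by positivity) ht hσ1.le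
  · refine (h x y).trans (le_mul_of_one_le_right hM ?_)
    exact Real.one_le_rpow ht hσ.le

end Lipschitz

/-! ### Sup and W^{s,∞} bounds for the modes. -/

section WNorm

variable {β : ℝ}

theorem coef_norm_sq_le (hβ : 0 < β) (n : ℕ) (k : ℤ) (j : SignType) :
    2 * ‖coefA β n k j‖ ^ 2 + 2 * ‖coefB β n k j‖ ^ 2 + ‖coefC β n k j‖ ^ 2 ≤ 1 := by
  have h := coef_norm hβ n k j
  have hpi := Real.pi_gt_three
  have h0 : 0 ≤ 2 * ‖coefA β n k j‖ ^ 2 + 2 * ‖coefB β n k j‖ ^ 2 + ‖coefC β n k j‖ ^ 2 := by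
    positivity
  nlinarith

theorem abs_blockIdx_le (n : ℕ) (j : SignType) : |(blockIdx n j : ℝ)| ≤ n + 1 := by
  unfold blockIdx
  split_ifs
  · simp
  · push_cast; rw [abs_of_nonneg (by positivity)]; linarith

/-- The coefficients are bounded by 1 because the modes are normalized, so only the growth of the
derivatives of ψ_l with |l| ≤ n + 2 matters. -/
theorem exists_profile_bound (hβ : 0 < β) (a : ℕ) : ∃ D, 0 < D ∧ ∀ (n : ℕ) (k : ℤ) (j : SignType)
    (x : ℝ), ‖profile β n k j a x‖ ≤ D * √(1 + (k : ℝ) ^ 2 + n) ^ a := by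
  obtain ⟨C, hC, h⟩ := exists_psiD_bound hβ a
  refine ⟨3 * (C * √3 ^ a), by positivity, fun n k j x => ?_⟩
  set N : ℝ := 1 + (k : ℝ) ^ 2 + n with hN
  have hb := abs_le.mp (abs_blockIdx_le n j)
  have bound (m : ℤ) (hm : |(m : ℝ)| ≤ n + 2) (v : Val) (hv : ‖v‖ ≤ 1) :
      ‖(psiD β a m x : ℂ) • v‖ ≤ C * √3 ^ a * √N ^ a := by
    rw [norm_smul, Complex.norm_real, Real.norm_eq_abs]
    refine (mul_le_of_le_one_right (abs_nonneg _) hv).trans ((h m x).trans ?_)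
    rw [mul_assoc, ← mul_pow, ← Real.sqrt_mul (by norm_num)]
    refine mul_le_mul_of_nonneg_left (pow_le_pow_left₀ (Real.sqrt_nonneg _)
      (Real.sqrt_le_sqrt ?_) _) hC.le
    have : (0 : ℝ) ≤ n := by positivity
    nlinarith [sq_nonneg (k : ℝ)]
  have hc := coef_norm_sq_le hβ n k j
  have hA : ‖(!₂[coefA β n k j, 0, -coefA β n k j] : Val)‖ ≤ 1 := by
    rw [← sq_le_one_iff₀ (norm_nonneg _), EuclideanSpace.norm_sq_eq, Fin.sum_univ_three]
    simp
    nlinarith [sq_nonneg ‖coefB β n k j‖, sq_nonneg ‖coefC β n k j‖]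
  have hB : ‖(!₂[coefB β n k j, 0, coefB β n k j] : Val)‖ ≤ 1 := by
    rw [← sq_le_one_iff₀ (norm_nonneg _), EuclideanSpace.norm_sq_eq, Fin.sum_univ_three]
    simp
    nlinarith [sq_nonneg ‖coefA β n k j‖, sq_nonneg ‖coefC β n k j‖]
  have hC' : ‖(!₂[0, coefC β n k j, 0] : Val)‖ ≤ 1 := by
    rw [← sq_le_one_iff₀ (norm_nonneg _), EuclideanSpace.norm_sq_eq, Fin.sum_univ_three]
    simp
    nlinarith [sq_nonneg ‖coefA β n k j‖, sq_nonneg ‖coefB β n k j‖]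
  have e1 := bound (blockIdx n j - 1) (by
    push_cast; rw [abs_le]; constructor <;> linarith [hb.1, hb.2]) _ hA
  have e2 := bound (blockIdx n j + 1) (by
    push_cast; rw [abs_le]; constructor <;> linarith [hb.1, hb.2]) _ hB
  have e3 := bound (blockIdx n j) (by
    rw [abs_le]; constructor <;> linarith [hb.1, hb.2]) _ hC'
  unfold profile
  refine (norm_add₃_le).trans ?_
  linarith

/-- The classical derivatives of the eigenvectors. -/
noncomputable def modeDeriv (β : ℝ) (n : ℕ) (k : ℤ) (j : SignType) (α : ℕ × ℕ) : Dom → Val :=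
  wave k fun x => (Complex.I * (k : ℂ)) ^ α.2 • profile β n k j α.1 x

theorem abs_le_sqrt_one_add (n : ℕ) (k : ℤ) : |(k : ℝ)| ≤ √(1 + (k : ℝ) ^ 2 + n) := by
  refine Real.abs_le_sqrt ?_
  have : (0 : ℝ) ≤ n := by positivity
  linarith

theorem exists_modeDeriv_bound (hβ : 0 < β) (m : ℕ) : ∃ D, 0 < D ∧ ∀ (n : ℕ) (k : ℤ)
    (j : SignType) (α : ℕ × ℕ), α.1 + α.2 ≤ m → ∀ x y,
      ‖modeDeriv β n k j α x‖ ≤ D * √(1 + (k : ℝ) ^ 2 + n) ^ (α.1 + α.2) ∧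
      ‖modeDeriv β n k j α x - modeDeriv β n k j α y‖ ≤
        D * √(1 + (k : ℝ) ^ 2 + n) ^ (α.1 + α.2 + 1) * dist x y := by
  choose D hD h using fun a => exists_profile_bound hβ a
  set E := ∑ a ∈ Finset.range (m + 2), D a with hE
  have hle (a : ℕ) (ha : a < m + 2) : D a ≤ E :=
    Finset.single_le_sum (fun a _ => (hD a).le) (Finset.mem_range.mpr ha)
  have hE0 : 0 < E := (hD 0).trans_le (hle 0 (by omega))
  refine ⟨2 * E, by positivity, fun n k j α hα x y => ?_⟩
  set N : ℝ := √(1 + (k : ℝ) ^ 2 + n) with hN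
  have hk : |(k : ℝ)| ≤ N := abs_le_sqrt_one_add n k
  have hN0 : 0 ≤ N := Real.sqrt_nonneg _
  have hb (a b : ℕ) (ha : a < m + 2) (z : ℝ) :
      ‖(Complex.I * (k : ℂ)) ^ b • profile β n k j a z‖ ≤ E * N ^ (a + b) := by
    rw [norm_smul, norm_pow, norm_mul, Complex.norm_I, one_mul, Complex.norm_intCast]
    calc |(k : ℝ)| ^ b * ‖profile β n k j a z‖ ≤ N ^ b * (E * N ^ a) := by
          refine mul_le_mul (pow_le_pow_left₀ (abs_nonneg _) hk b) ((h a n k j z).trans ?_)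
            (norm_nonneg _) (by positivity)
          exact mul_le_mul_of_nonneg_right (hle a ha) (by positivity)
      _ = E * N ^ (a + b) := by rw [pow_add]; ring
  refine ⟨?_, ?_⟩
  · rw [modeDeriv, norm_wave]
    refine (hb α.1 α.2 (by omega) x.1).trans ?_
    exact mul_le_mul_of_nonneg_right (by linarith) (by positivity)
  · have hd (z : ℝ) : HasDerivAt (fun x => (Complex.I * (k : ℂ)) ^ α.2 • profile β n k j α.1 x)
        ((Complex.I * (k : ℂ)) ^ α.2 • profile β n k j (α.1 + 1) z) z :=
      (hasDerivAt_profile hβ n k j α.1 z).fun_const_smul _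
    refine (norm_wave_sub_le k hd (hb α.1 α.2 (by omega)) (hb (α.1 + 1) α.2 (by omega)) x y).trans ?_
    refine mul_le_mul_of_nonneg_right ?_ dist_nonneg
    have h1 : |(k : ℝ)| * (E * N ^ (α.1 + α.2)) ≤ N * (E * N ^ (α.1 + α.2)) :=
      mul_le_mul_of_nonneg_right hk (by positivity)
    calc _ ≤ E * N ^ (α.1 + 1 + α.2) + N * (E * N ^ (α.1 + α.2)) := by gcongr
      _ = _ := by ring

theorem exists_eLpNorm_Psi_bound (hβ : 0 < β) : ∃ C, 0 < C ∧ ∀ (n : ℕ) (k : ℤ) (j : SignType),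
    eLpNorm (Psi β n k j) ∞ volume ≤ ENNReal.ofReal C := by
  obtain ⟨D, hD, h⟩ := exists_profile_bound hβ 0
  refine ⟨D, hD, fun n k j => ?_⟩
  rw [eLpNorm_exponent_top]
  refine eLpNormEssSup_le_of_ae_bound (Eventually.of_forall fun x => ?_)
  rw [Psi_eq_wave, norm_wave]
  simpa using h n k j x.1

theorem exists_WNorm_Psi_bound (hβ : 0 < β) {s : ℝ} (hs : 0 ≤ s) : ∃ C, 0 < C ∧
    ∀ (n : ℕ) (k : ℤ) (j : SignType),
      WNorm s (Psi β n k j) ≤ ENNReal.ofReal (C * (1 + (k : ℝ) ^ 2 + n) ^ (s / 2)) := by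
  set m := ⌊s⌋₊ with hm
  have hms : (m : ℝ) ≤ s := Nat.floor_le hs
  have hsm : s < m + 1 := Nat.lt_floor_add_one s
  obtain ⟨D, hD, h⟩ := exists_modeDeriv_bound hβ m
  -- One D for the sup norms and 2D for the Hölder seminorms, since a difference of two values is at
  -- most twice the sup bound.
  refine ⟨D + 2 * D, by positivity, fun n k j => ?_⟩
  set K : ℝ := 1 + (k : ℝ) ^ 2 + n with hK
  have hn : (0 : ℝ) ≤ n := by positivity
  have hK1 : 1 ≤ K := by nlinarith [sq_nonneg (k : ℝ)]
  have hK0 : 0 ≤ K := by linarith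
  have hS1 : 1 ≤ √K := Real.one_le_sqrt.mpr hK1
  have hsq : K ^ (s / 2) = √K ^ s := by
    rw [Real.sqrt_eq_rpow, ← Real.rpow_mul hK0]; congr 1; ring
  have hpow {p : ℕ} (hp : p ≤ m) : √K ^ p ≤ √K ^ s := by
    rw [← Real.rpow_natCast]
    exact Real.rpow_le_rpow_of_exponent_le hS1 (le_trans (by exact_mod_cast hp) hms)
  have hpos : 0 ≤ √K ^ s := Real.rpow_nonneg (Real.sqrt_nonneg _) _
  refine iInf₂_le_of_le (modeDeriv β n k j) (fun α _ => ?_) ?_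
  · rw [Psi_eq_wave]
    exact isWeakDeriv_wave k (fun a x => hasDerivAt_profile hβ n k j a x) α
  rw [hsq, add_mul, ENNReal.ofReal_add (by positivity) (by positivity)]
  refine add_le_add (iSup₂_le fun α hα => ?_) ?_
  · rw [eLpNorm_exponent_top]
    refine eLpNormEssSup_le_of_ae_bound (Eventually.of_forall fun x => ?_)
    exact (h n k j α hα x x).1.trans (mul_le_mul_of_nonneg_left (hpow hα) hD.le)
  · split_ifs with hsi
    · exact zero_le
    · refine iSup₂_le fun α hα => ?_
      have hσ : 0 < s - m := sub_pos.mpr (lt_of_le_of_ne hms (Ne.symm hsi))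
      have e : 2 * D * √K ^ s = 2 * D * √K ^ m * √K ^ (s - m) := by
        rw [← Real.rpow_natCast, mul_assoc (2 * D), ← Real.rpow_add (by linarith)]
        congr 2; ring
      rw [e]
      refine holderSeminorm_le (by positivity) (by positivity) hσ (by linarith) (fun x y => ?_)
        fun x y => ?_
      · have h1 := (h n k j α hα.le x y).1
        have h2 := (h n k j α hα.le y x).1
        rw [hα] at h1 h2
        refine (norm_sub_le _ _).trans ?_
        linarith
      · refine (h n k j α hα.le x y).2.trans ?_
        rw [hα, pow_succ]
        have : 0 ≤ D * (√K ^ m * √K) * dist x y := by positivity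
        linarith

end WNorm

end EquatorialWaves

namespace EquatorialWaves

/-! ### The norms of `H^s` -/

section HNorm

variable {β : ℝ}

theorem fourierTransform_Psi (hβ : 0 < β) (n : ℕ) (k : ℤ) (j : SignType) (ξ : ℝ) (l : ℤ) :
    fourierTransform (Psi β n k j) ξ l = if l = k then (2 * Real.pi : ℂ) •
      (ft (fun x => (psi β (blockIdx n j - 1) x : ℂ)) ξ • !₂[coefA β n k j, 0, -coefA β n k j] +
        ft (fun x => (psi β (blockIdx n j + 1) x : ℂ)) ξ • !₂[coefB β n k j, 0, coefB β n k j] +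
        ft (fun x => (psi β (blockIdx n j) x : ℂ)) ξ • !₂[0, coefC β n k j, 0]) else 0 := by
  have e : fourierTransform (Psi β n k j) ξ l = ∫ x : Dom, wave (k - l)
      (fun x : ℝ => Complex.exp (-(Complex.I * ξ * x)) • profile β n k j 0 x) x := by
    rw [fourierTransform, Psi_eq_wave]
    refine integral_congr_ae (Eventually.of_forall fun x => ?_)
    simp only [wave, smul_smul, sub_eq_add_neg, fourier_add]
    congr 1
    ring
  rw [e, integral_wave]
  by_cases hl : l = k
  swap
  · rw [if_neg hl, if_neg (by omega)]
  rw [if_pos hl, if_pos (by omega)]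
  congr 1
  have I (m : ℤ) (v : Val) : Integrable fun x : ℝ =>
      (Complex.exp (-(Complex.I * ξ * x)) * psi β m x) • v :=
    (((gaussDecay_psi hβ m).ofReal.exp_mul ξ).integrable).smul_const v
  have I2 (m m' : ℤ) (v v' : Val) : Integrable fun x : ℝ =>
      (Complex.exp (-(Complex.I * ξ * x)) * psi β m x) • v +
      (Complex.exp (-(Complex.I * ξ * x)) * psi β m' x) • v' := (I m v).add (I m' v')
  simp only [ft]
  rw [← integral_smul_const, ← integral_smul_const, ← integral_smul_const,
    ← integral_add (I _ _) (I _ _), ← integral_add (I2 _ _ _ _) (I _ _)]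
  refine integral_congr_ae (Eventually.of_forall fun x => ?_)
  simp only [profile, psiD, smul_add, smul_smul]

/-- The cross terms between A and B cancel by the parallelogram law, pointwise in frequency. The
weighted norms of the modes are therefore exact sums, and lower bounds survive. -/
theorem norm_sq_combination (a b c A B C : ℂ) :
    ‖a • (!₂[A, 0, -A] : Val) + b • !₂[B, 0, B] + c • !₂[0, C, 0]‖ ^ 2 =
      2 * ‖A‖ ^ 2 * ‖a‖ ^ 2 + 2 * ‖B‖ ^ 2 * ‖b‖ ^ 2 + ‖C‖ ^ 2 * ‖c‖ ^ 2 := by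
  rw [EuclideanSpace.norm_sq_eq, Fin.sum_univ_three]
  have h := parallelogram_law_with_norm ℝ (a * A) (b * B)
  have h2 : ‖-(a * A) + b * B‖ = ‖a * A - b * B‖ := by rw [norm_sub_rev]; congr 1; ring
  simp only [PiLp.add_apply, PiLp.smul_apply, smul_eq_mul, mul_zero, mul_neg, add_zero, zero_add,
    Matrix.cons_val_zero, Matrix.cons_val_one, Matrix.cons_val, h2]
  simp only [norm_mul] at h ⊢
  linear_combination h

theorem integrable_rpow_mul_norm_sq_ft (hβ : 0 < β) {κ s : ℝ} (hκ : 0 ≤ κ) (hs : 0 ≤ s) (m : ℤ) :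
    Integrable fun ξ : ℝ => (1 + ξ ^ 2 + κ) ^ s * ‖ft (fun x => (psi β m x : ℂ)) ξ‖ ^ 2 := by
  have h := ((integrable_wt_rpow hβ hκ hs m).const_mul (2 * Real.pi / β)).comp_div hβ.ne'
  refine h.congr (Eventually.of_forall fun ξ => ?_)
  simp only
  rw [norm_sq_ft_psi hβ, wt, ← mul_pow, mul_div_cancel₀ _ hβ.ne']
  ring

theorem integral_rpow_mul_norm_sq_ft (hβ : 0 < β) (κ s : ℝ) (m : ℤ) :
    ∫ ξ : ℝ, (1 + ξ ^ 2 + κ) ^ s * ‖ft (fun x => (psi β m x : ℂ)) ξ‖ ^ 2 =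
      2 * Real.pi * ∫ x, wt β κ x ^ s * psi β m x ^ 2 := by
  have h := Measure.integral_comp_div (fun x => 2 * Real.pi / β * (wt β κ x ^ s * psi β m x ^ 2)) β
  rw [integral_const_mul, integral_const_mul, abs_of_pos hβ, smul_eq_mul, ← mul_assoc β,
    mul_div_cancel₀ _ hβ.ne', ← integral_const_mul] at h
  rw [← h]
  refine integral_congr_ae (Eventually.of_forall fun ξ => ?_)
  simp only
  rw [norm_sq_ft_psi hβ, wt, ← mul_pow, mul_div_cancel₀ _ hβ.ne']
  ring

/-- The norms of the eigenvectors in terms of weighted norms of Hermite functions. -/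
theorem HNorm_Psi (hβ : 0 < β) {s : ℝ} (hs : 0 ≤ s) (n : ℕ) (k : ℤ) (j : SignType) :
    HNorm s (Psi β n k j) = ENNReal.ofReal √((2 * Real.pi) ^ 3 *
      (2 * ‖coefA β n k j‖ ^ 2 * ∫ x, wt β (k ^ 2) x ^ s * psi β (blockIdx n j - 1) x ^ 2) +
      (2 * Real.pi) ^ 3 *
      (2 * ‖coefB β n k j‖ ^ 2 * ∫ x, wt β (k ^ 2) x ^ s * psi β (blockIdx n j + 1) x ^ 2) +
      (2 * Real.pi) ^ 3 *
      (‖coefC β n k j‖ ^ 2 * ∫ x, wt β (k ^ 2) x ^ s * psi β (blockIdx n j) x ^ 2)) := by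
  have hpi := Real.pi_pos
  have hk : (0 : ℝ) ≤ (k : ℝ) ^ 2 := sq_nonneg _
  have I (c : ℝ) (m : ℤ) := (integrable_rpow_mul_norm_sq_ft hβ hk hs m).const_mul c
  have I3 (c c' c'' : ℝ) (m m' m'' : ℤ) : Integrable fun ξ : ℝ =>
      c * ((1 + ξ ^ 2 + (k : ℝ) ^ 2) ^ s * ‖ft (fun x => (psi β m x : ℂ)) ξ‖ ^ 2) +
      c' * ((1 + ξ ^ 2 + (k : ℝ) ^ 2) ^ s * ‖ft (fun x => (psi β m' x : ℂ)) ξ‖ ^ 2) +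
      c'' * ((1 + ξ ^ 2 + (k : ℝ) ^ 2) ^ s * ‖ft (fun x => (psi β m'' x : ℂ)) ξ‖ ^ 2) :=
    ((I c m).add (I c' m')).add (I c'' m'')
  unfold HNorm
  -- Only the frequency k contributes. In (2π)³, two factors come from squaring the integral over
  -- the circle and one from `integral_rpow_mul_norm_sq_ft`.
  rw [tsum_eq_single k]
  · have e (ξ : ℝ) : ENNReal.ofReal ((1 + ξ ^ 2 + (k : ℝ) ^ 2) ^ s) *
        ‖fourierTransform (Psi β n k j) ξ k‖ₑ ^ 2 = ENNReal.ofReal (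
        (2 * Real.pi) ^ 2 * (2 * ‖coefA β n k j‖ ^ 2) * ((1 + ξ ^ 2 + (k : ℝ) ^ 2) ^ s *
          ‖ft (fun x => (psi β (blockIdx n j - 1) x : ℂ)) ξ‖ ^ 2) +
        (2 * Real.pi) ^ 2 * (2 * ‖coefB β n k j‖ ^ 2) * ((1 + ξ ^ 2 + (k : ℝ) ^ 2) ^ s *
          ‖ft (fun x => (psi β (blockIdx n j + 1) x : ℂ)) ξ‖ ^ 2) +
        (2 * Real.pi) ^ 2 * ‖coefC β n k j‖ ^ 2 * ((1 + ξ ^ 2 + (k : ℝ) ^ 2) ^ s *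
          ‖ft (fun x => (psi β (blockIdx n j) x : ℂ)) ξ‖ ^ 2)) := by
      rw [fourierTransform_Psi hβ, if_pos rfl, ← ofReal_norm, ← ENNReal.ofReal_pow (norm_nonneg _),
        ← ENNReal.ofReal_mul (by positivity), norm_smul, mul_pow, norm_sq_combination]
      congr 1
      rw [norm_mul, Complex.norm_real, Complex.norm_two, Real.norm_of_nonneg hpi.le]
      ring
    simp only [e]
    rw [← ofReal_integral_eq_lintegral_ofReal (I3 _ _ _ _ _ _)
      (Eventually.of_forall fun ξ => by positivity), integral_add_add (I _ _) (I _ _) (I _ _),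
      integral_const_mul, integral_const_mul, integral_const_mul]
    simp only [integral_rpow_mul_norm_sq_ft hβ]
    rw [ENNReal.ofReal_rpow_of_nonneg _ (by norm_num), ← Real.sqrt_eq_rpow]
    · congr 2
      ring
    · have hT (l : ℤ) : 0 ≤ ∫ x, wt β (k ^ 2) x ^ s * psi β l x ^ 2 :=
        integral_nonneg fun x => mul_nonneg (Real.rpow_nonneg (wt_pos hk x).le _) (sq_nonneg _)
      have := hT (blockIdx n j - 1)
      have := hT (blockIdx n j + 1)
      have := hT (blockIdx n j)
      positivity
  · intro l hl
    simp [fourierTransform_Psi hβ, hl]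

theorem rpow_le_rpow_of_le_two_mul {x y s : ℝ} (hx : 0 ≤ x) (hy : 0 ≤ y) (hs : 0 ≤ s) (h : x ≤ 2 * y) :
    x ^ s ≤ 2 ^ s * y ^ s := by
  rw [← Real.mul_rpow (by norm_num) hy]
  exact Real.rpow_le_rpow hx h hs

/-- The indices l that occur satisfy |l - n| ≤ 1, so 1 + k² + l and 1 + k² + n agree up to a factor
2, and `coef_norm` adds up the three contributions. -/
theorem exists_HNorm_Psi_bounds (hβ : 0 < β) {s : ℝ} (hs : 0 ≤ s) : ∃ C, 0 < C ∧
    ∀ (n : ℕ) (k : ℤ) (j : SignType),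
      ENNReal.ofReal (C⁻¹ * (1 + (k : ℝ) ^ 2 + n) ^ (s / 2)) ≤ HNorm s (Psi β n k j) ∧
      HNorm s (Psi β n k j) ≤ ENNReal.ofReal (C * (1 + (k : ℝ) ^ 2 + n) ^ (s / 2)) := by
  obtain ⟨K, hK, h⟩ := exists_wt_rpow_bounds hβ hs
  set D := K * 2 ^ s + 1 with hD
  have h2s : (0 : ℝ) < 2 ^ s := by positivity
  have hD1 : 1 ≤ D := by have := mul_pos hK h2s; linarith
  have hpi := Real.pi_gt_three
  refine ⟨2 * Real.pi * D, by positivity, fun n k j => ?_⟩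
  set N : ℝ := 1 + (k : ℝ) ^ 2 + n with hN
  have hn : (0 : ℝ) ≤ n := by positivity
  have hk := sq_nonneg (k : ℝ)
  have hN0 : 0 < N := by positivity
  have hNs : 0 < N ^ s := Real.rpow_pos_of_pos hN0 s
  -- For l < 0 the integral is zero and the lower bound can only hold because the coefficient q
  -- vanishes too. The last hypothesis also covers the Kelvin modes, where n = 0 and l = 0.
  have term (l : ℤ) (q : ℝ) (hq : 0 ≤ q) (hl : l < 0 → q = 0)
      (hln : 0 ≤ l → (n : ℤ) - 1 ≤ l ∧ l ≤ n + 1) :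
      D⁻¹ * q * N ^ s ≤ q * ∫ x, wt β (k ^ 2) x ^ s * psi β l x ^ 2 ∧
      q * ∫ x, wt β (k ^ 2) x ^ s * psi β l x ^ 2 ≤ D * q * N ^ s := by
    obtain hl0 | hl0 := lt_or_ge l 0
    · rw [hl hl0]; simp
    obtain ⟨a1, a2⟩ := h l (k ^ 2) hl0 hk
    obtain ⟨b1, b2⟩ := hln hl0
    have b1' : (n : ℝ) - 1 ≤ l := by exact_mod_cast b1
    have b2' : (l : ℝ) ≤ n + 1 := by exact_mod_cast b2
    have hl0' : (0 : ℝ) ≤ l := by exact_mod_cast hl0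
    have c1 : N ^ s ≤ 2 ^ s * (1 + (k : ℝ) ^ 2 + l) ^ s :=
      rpow_le_rpow_of_le_two_mul hN0.le (by positivity) hs (by linarith)
    have c2 : (1 + (k : ℝ) ^ 2 + l) ^ s ≤ 2 ^ s * N ^ s :=
      rpow_le_rpow_of_le_two_mul (by positivity) hN0.le hs (by linarith)
    have hDK : K * 2 ^ s ≤ D := by linarith
    have u1 : N ^ s ≤ D * ∫ x, wt β (k ^ 2) x ^ s * psi β l x ^ 2 := by
      rw [inv_mul_le_iff₀ hK] at a1
      have hT : 0 ≤ ∫ x, wt β (k ^ 2) x ^ s * psi β l x ^ 2 :=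
        integral_nonneg fun x => mul_nonneg (Real.rpow_nonneg (wt_pos hk x).le _) (sq_nonneg _)
      calc N ^ s ≤ 2 ^ s * (K * ∫ x, wt β (k ^ 2) x ^ s * psi β l x ^ 2) :=
            c1.trans (mul_le_mul_of_nonneg_left a1 h2s.le)
        _ = K * 2 ^ s * ∫ x, wt β (k ^ 2) x ^ s * psi β l x ^ 2 := by ring
        _ ≤ _ := mul_le_mul_of_nonneg_right hDK hT
    have u2 : ∫ x, wt β (k ^ 2) x ^ s * psi β l x ^ 2 ≤ D * N ^ s :=
      calc _ ≤ K * (2 ^ s * N ^ s) := a2.trans (mul_le_mul_of_nonneg_left c2 hK.le)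
        _ = K * 2 ^ s * N ^ s := by ring
        _ ≤ _ := mul_le_mul_of_nonneg_right hDK hNs.le
    constructor
    · rw [mul_assoc, inv_mul_le_iff₀ (by linarith)]
      calc q * N ^ s ≤ q * (D * ∫ x, wt β (k ^ 2) x ^ s * psi β l x ^ 2) :=
            mul_le_mul_of_nonneg_left u1 hq
        _ = _ := by ring
    · calc _ ≤ q * (D * N ^ s) := mul_le_mul_of_nonneg_left u2 hq
        _ = _ := by ring
  have hbi := neg_one_le_blockIdx n j
  have hb : blockIdx n j = n ∨ (blockIdx n j = -1 ∧ n = 0) := by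
    unfold blockIdx
    split_ifs with h
    · exact Or.inr ⟨rfl, h.2⟩
    · exact Or.inl rfl
  obtain ⟨A1, A2⟩ := term (blockIdx n j - 1) (2 * ‖coefA β n k j‖ ^ 2) (by positivity)
    (fun hl => by rw [coefA_eq_zero (by omega)]; simp) (by omega)
  obtain ⟨B1, B2⟩ := term (blockIdx n j + 1) (2 * ‖coefB β n k j‖ ^ 2) (by positivity)
    (by omega) (by omega)
  obtain ⟨C1, C2⟩ := term (blockIdx n j) (‖coefC β n k j‖ ^ 2) (by positivity)
    (fun hl => by rw [coefC_eq_zero hl]; simp) (by omega)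
  have hsum := coef_norm hβ n k j
  have hNN : N ^ s = (N ^ (s / 2)) ^ 2 := by
    rw [← Real.rpow_natCast, ← Real.rpow_mul hN0.le]; congr 1; push_cast; ring
  have hN2 : 0 < N ^ (s / 2) := Real.rpow_pos_of_pos hN0 _
  have hp3 : 0 < (2 * Real.pi) ^ 3 := by positivity
  have hDi : 0 < D⁻¹ := by positivity
  have hDi1 : D⁻¹ ≤ 1 := inv_le_one_of_one_le₀ hD1
  have lo : (2 * Real.pi) ^ 3 * (D⁻¹ * (2 * ‖coefA β n k j‖ ^ 2) * N ^ s) +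
      (2 * Real.pi) ^ 3 * (D⁻¹ * (2 * ‖coefB β n k j‖ ^ 2) * N ^ s) +
      (2 * Real.pi) ^ 3 * (D⁻¹ * ‖coefC β n k j‖ ^ 2 * N ^ s) = (2 * Real.pi) ^ 2 * D⁻¹ * N ^ s := by
    linear_combination ((2 * Real.pi) ^ 2 * D⁻¹ * N ^ s) * hsum
  have up : (2 * Real.pi) ^ 3 * (D * (2 * ‖coefA β n k j‖ ^ 2) * N ^ s) +
      (2 * Real.pi) ^ 3 * (D * (2 * ‖coefB β n k j‖ ^ 2) * N ^ s) +
      (2 * Real.pi) ^ 3 * (D * ‖coefC β n k j‖ ^ 2 * N ^ s) = (2 * Real.pi) ^ 2 * D * N ^ s := by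
    linear_combination ((2 * Real.pi) ^ 2 * D * N ^ s) * hsum
  rw [HNorm_Psi hβ hs]
  constructor
  · refine ENNReal.ofReal_le_ofReal (Real.le_sqrt_of_sq_le ?_)
    refine le_trans ?_ (add_le_add (add_le_add (mul_le_mul_of_nonneg_left A1 hp3.le)
      (mul_le_mul_of_nonneg_left B1 hp3.le)) (mul_le_mul_of_nonneg_left C1 hp3.le))
    rw [lo, mul_pow, ← hNN]
    refine mul_le_mul_of_nonneg_right ?_ hNs.le
    rw [mul_inv, mul_pow]
    have e1 : (2 * Real.pi)⁻¹ ^ 2 ≤ (2 * Real.pi) ^ 2 := by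
      refine pow_le_pow_left₀ (by positivity) ?_ 2
      exact (inv_le_one_of_one_le₀ (by linarith)).trans (by linarith)
    have e2 : D⁻¹ ^ 2 ≤ D⁻¹ := by nlinarith
    exact mul_le_mul e1 e2 (by positivity) (by positivity)
  · refine ENNReal.ofReal_le_ofReal (Real.sqrt_le_iff.mpr ⟨by positivity, ?_⟩)
    refine (add_le_add (add_le_add (mul_le_mul_of_nonneg_left A2 hp3.le)
      (mul_le_mul_of_nonneg_left B2 hp3.le)) (mul_le_mul_of_nonneg_left C2 hp3.le)).trans ?_
    rw [up, mul_pow (2 * Real.pi * D), ← hNN, mul_pow (2 * Real.pi) D]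
    refine mul_le_mul_of_nonneg_right (mul_le_mul_of_nonneg_left ?_ (by positivity)) hNs.le
    nlinarith

end HNorm

end EquatorialWaves

/-! ### Assembly of the main theorem. -/

theorem proposition2p2p3 (β : ℝ) (hβ : 0 < β) :
    (∃ b : HilbertBasis (ℕ × ℤ × SignType) ℂ EquatorialWaves.L2,
      ∀ (n : ℕ) (k : ℤ) (j : SignType),
        (⇑(b (n, k, j)) =ᵐ[volume] EquatorialWaves.Psi β n k j) ∧
        EquatorialWaves.LEq β (b (n, k, j))
          ((Complex.I * (EquatorialWaves.tau β n k j : ℂ)) • b (n, k, j))) ∧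
    (∃ C : ℝ → ℝ, (∀ s, 0 < C s) ∧
      (∀ (n : ℕ) (k : ℤ) (j : SignType),
        eLpNorm (EquatorialWaves.Psi β n k j) ∞ volume ≤ ENNReal.ofReal (C 0)) ∧
      ∀ s : ℝ, 0 ≤ s → ∀ (n : ℕ) (k : ℤ) (j : SignType),
        EquatorialWaves.WNorm s (EquatorialWaves.Psi β n k j) ≤
          ENNReal.ofReal (C s * (1 + (k : ℝ) ^ 2 + n) ^ (s / 2)) ∧
        ENNReal.ofReal ((C s)⁻¹ * (1 + (k : ℝ) ^ 2 + n) ^ (s / 2)) ≤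
          EquatorialWaves.HNorm s (EquatorialWaves.Psi β n k j) ∧
        EquatorialWaves.HNorm s (EquatorialWaves.Psi β n k j) ≤
          ENNReal.ofReal (C s * (1 + (k : ℝ) ^ 2 + n) ^ (s / 2))) ∧
    (∀ μ : ℂ, μ ≠ 0 → FiniteDimensional ℂ (EquatorialWaves.eigenspace β μ)) := by
  refine ⟨⟨EquatorialWaves.eigBasis hβ, fun n k j => ?_⟩, ?_, fun μ hμ =>
    EquatorialWaves.finiteDimensional_eigenspace hβ hμ⟩
  · rw [EquatorialWaves.eigBasis_apply, EquatorialWaves.Psi_eq_wave]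
    exact ⟨EquatorialWaves.coeFn_eigvec hβ (n, k, j), EquatorialWaves.lEq_eigvec hβ n k j⟩
  obtain ⟨A, hA, hAb⟩ := EquatorialWaves.exists_eLpNorm_Psi_bound hβ
  have hW (s : ℝ) : ∃ C, 0 < C ∧ (0 ≤ s → ∀ (n : ℕ) (k : ℤ) (j : SignType),
      EquatorialWaves.WNorm s (EquatorialWaves.Psi β n k j) ≤
        ENNReal.ofReal (C * (1 + (k : ℝ) ^ 2 + n) ^ (s / 2))) := by
    obtain hs | hs := le_or_gt 0 s
    · obtain ⟨C, hC, h⟩ := EquatorialWaves.exists_WNorm_Psi_bound hβ hs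
      exact ⟨C, hC, fun _ => h⟩
    · exact ⟨1, one_pos, fun h => absurd h (not_le.mpr hs)⟩
  have hH (s : ℝ) : ∃ C, 0 < C ∧ (0 ≤ s → ∀ (n : ℕ) (k : ℤ) (j : SignType),
      ENNReal.ofReal (C⁻¹ * (1 + (k : ℝ) ^ 2 + n) ^ (s / 2)) ≤
        EquatorialWaves.HNorm s (EquatorialWaves.Psi β n k j) ∧
      EquatorialWaves.HNorm s (EquatorialWaves.Psi β n k j) ≤
        ENNReal.ofReal (C * (1 + (k : ℝ) ^ 2 + n) ^ (s / 2))) := by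
    obtain hs | hs := le_or_gt 0 s
    · obtain ⟨C, hC, h⟩ := EquatorialWaves.exists_HNorm_Psi_bounds hβ hs
      exact ⟨C, hC, fun _ => h⟩
    · exact ⟨1, one_pos, fun h => absurd h (not_le.mpr hs)⟩
  choose B hB hBb using hW
  choose D hD hDb using hH
  -- One constant must serve all the bounds: enlarging it weakens the upper bounds and, through its
  -- inverse, the lower bound. For s < 0 it is arbitrary.
  refine ⟨fun s => A + B s + D s, fun s => by have := hB s; have := hD s; positivity,
    fun n k j => (hAb n k j).trans (ENNReal.ofReal_le_ofReal ?_), fun s hs n k j => ?_⟩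
  · linarith [hB 0, hD 0]
  have hN : 0 ≤ (1 + (k : ℝ) ^ 2 + n) ^ (s / 2) := by positivity
  have hBs := hB s
  have hDs := hD s
  refine ⟨(hBb s hs n k j).trans ?_, le_trans ?_ (hDb s hs n k j).1, (hDb s hs n k j).2.trans ?_⟩
  · exact ENNReal.ofReal_le_ofReal (mul_le_mul_of_nonneg_right (by linarith) hN)
  · exact ENNReal.ofReal_le_ofReal (mul_le_mul_of_nonneg_right
      (inv_anti₀ hDs (by linarith)) hN)
  · exact ENNReal.ofReal_le_ofReal (mul_le_mul_of_nonneg_right (by linarith) hN)
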